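/- **Setting.** Let $G=(V,E,w)$ be a weighted undirected graph with $n\ge 1$ vertices, $V=\{0,\dots,n-1\}$, and nonnegative real edge weights. A hierarchical clustering (HC) tree of $G$ is a rooted binary tree $\mathcal T$ in which every internal node has two children and whose leaves are in bijection with $V$. For a set $X$ of leaves, $\mathrm{lca}_{\mathcal T}(X)$ is the lowest common ancestor of $X$ in $\mathcal T$. Dasgupta's cost of $\mathcal T$ is $$\mathrm{cost}_G(\mathcal T)=\sum_{e=\{u,v\}\in E} w(e)\cdot\#\{\text{leaves of }\mathcal T\text{ below }\mathrm{lca}_{\mathcal T}(\{u,v\})\},$$ and $\mathrm{OPT}(G)$ is its minimum over all HC trees of $G$. In a set $X$ of three distinct vertices, $x\in X$ *splits away* from the two others in $\mathcal T$ if $\mathrm{lca}_{\mathcal T}(\{x,u\})=\mathrm{lca}_{\mathcal T}(X)$ for both $u\in X\setminus\{x\}$. **Oracle.** Let $\mathcal T^*$ be an HC tree with $\mathrm{cost}_G(\mathcal T^*)=\mathrm{OPT}(G)$. A splitting oracle for $\mathcal T^*$ is a random function $\mathcal O$ that assigns a vertex to each unordered triplet of distinct vertices, such that there are mutually independent events $D_X$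 of probability $9/10$, one for each triplet $X$, with the property that on $D_X$ the answer $\mathcal O(X)$ is the vertex of $X$ that splits away from the two others in $\mathcal T^*$. Outside $D_X$ the answer is arbitrary (adversarial). The answers are drawn once: repeated queries on the same triplet get the same answer. **Machine model.** An algorithm is a fixed program (not depending on $n$ or $G$) for a random access machine with integer registers, integer arrays and arrays of real weights. Its unit-cost operations are addition, truncated subtraction and comparison of integers, addition, subtraction and comparison of weights, array access, reading an entry of the weighted adjacency matrix of $G$, querying the oracle on a triplet, and writing an integer on the output. The program is given $n$, and it outputs a tree by writing its preorder code. **Theorem.** There are a constant $\alpha$ and an absolute constant $C$ such that for every $c\in\mathbb N$ there are a deterministic algorithm and constants $k,K\in\mathbb N$ with the following properties, for every $n\ge 1$ and every weighted undirected graph $G$ with $n$ vertices. 1. For every possible function $\mathcal O$ of oracle answers, the algorithm halts after at most $K n^{k}$ steps and at most $C n^3$ queries to $\mathcal O$. 2. For every optimal HC tree $\mathcal T^*$ of $G$ and every splitting oracle $\mathcal O$ for $\mathcal T^*$, with probability at least $1-n^{-c}$ the algorithm outputs an HC tree $\mathcal T$ of $G$ with $$\mathrm{cost}_G(\mathcal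 T)\le\alpha\cdot\mathrm{cost}_G(\mathcal T^*)=\alpha\cdot\mathrm{OPT}(G).$$ -/

import Mathlib

open MeasureTheory ProbabilityTheory

/-! ## Weighted graphs, hierarchical clustering trees, Dasgupta's cost -/

/-- A weighted undirected graph on the vertex set `{0, …, n-1}` with nonnegative edge weights. -/
structure WeightedGraph (n : ℕ) where
  graph : SimpleGraph (Fin n)
  weight : Sym2 (Fin n) → ℝ
  weight_nonneg : ∀ e ∈ graph.edgeSet, 0 ≤ weight e

open Classical in
/-- The adjacency matrix: the weight of the edge `{i, j}`, and `0` if this is not an edge. -/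
noncomputable def WeightedGraph.entry {n : ℕ} (G : WeightedGraph n) (i j : ℕ) : ℝ :=
  if h : i < n ∧ j < n then
    if G.graph.Adj ⟨i, h.1⟩ ⟨j, h.2⟩ then G.weight s(⟨i, h.1⟩, ⟨j, h.2⟩) else 0
  else 0

/-- Rooted binary trees whose leaves are labelled by elements of `V`. -/
inductive HCTree (V : Type*) where
  | leaf (v : V) : HCTree V
  | node (l r : HCTree V) : HCTree V

namespace HCTree

variable {V : Type*}

/-- The labels of the leaves, from left to right. -/
def leafList : HCTree V → List V
  | leaf v => [v]
  | node l r => l.leafList ++ r.leafList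

/-- The set of (labels of) leaves. -/
def leaves [DecidableEq V] (T : HCTree V) : Finset V := T.leafList.toFinset

/-- `T` is a hierarchical clustering tree of `V`: every element of `V` labels exactly one leaf. -/
def IsHC (T : HCTree V) : Prop := T.leafList.Nodup ∧ ∀ v : V, v ∈ T.leafList

/-- The subtree of `T` rooted at the lowest common ancestor of the leaves in `X`
(for a nonempty set `X` of leaves of `T`). -/
def lca [DecidableEq V] : HCTree V → Finset V → HCTree V
  | leaf v, _ => leaf v
  | node l r, X =>
      if X ⊆ l.leaves then l.lca X else if X ⊆ r.leaves then r.lca X else node l r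

/-- Among the vertices of `X` (a set of three vertices), `x` is the one that splits away from
the others in `T`: its lowest common ancestor with each of the others is that of all of `X`. -/
def SplitsAway [DecidableEq V] (T : HCTree V) (X : Finset V) (x : V) : Prop :=
  x ∈ X ∧ ∀ u ∈ X, u ≠ x → T.lca {x, u} = T.lca X

/-- The preorder code of a tree: `0` for an internal node, `v + 1` for the leaf `v`. -/
def code {n : ℕ} : HCTree (Fin n) → List ℕ
  | leaf v => [(v : ℕ) + 1]
  | node l r => 0 :: (l.code ++ r.code)

open Classical in
/-- Dasgupta's cost: the sum over the edges `e = {u, v}` of `w(e)` times the number of leaves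
below the lowest common ancestor of `u` and `v`. -/
noncomputable def cost {n : ℕ} (G : WeightedGraph n) (T : HCTree (Fin n)) : ℝ :=
  ∑ e ∈ G.graph.edgeFinset, G.weight e * ((T.lca e.toFinset).leaves.card : ℝ)

/-- `T` is a hierarchical clustering tree of minimum Dasgupta cost. -/
def IsOptimal {n : ℕ} (G : WeightedGraph n) (T : HCTree (Fin n)) : Prop :=
  T.IsHC ∧ ∀ T' : HCTree (Fin n), T'.IsHC → T.cost G ≤ T'.cost G

end HCTree

/-! ## The splitting oracle -/

/-- Unordered triplets of distinct vertices. -/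
abbrev Triplet (n : ℕ) : Type := {X : Finset (Fin n) // X.card = 3}

/-- The random oracle `O` is a splitting oracle for `T` with success probability `9/10`: there are
mutually independent events `D X`, one for each triplet `X`, each of probability `9/10`, such that
on `D X` the answer on `X` is correct. Off `D X` the answer is arbitrary; it may depend on
everything else. One outcome `ω` fixes all the answers. -/
def IsSplittingOracle {n : ℕ} {Ω : Type*} [MeasurableSpace Ω] (μ : Measure Ω)
    (T : HCTree (Fin n)) (O : Ω → Triplet n → Fin n) : Prop :=
  (∀ X, Measurable fun ω => O ω X) ∧
  ∃ D : Triplet n → Set Ω,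
    (∀ X, MeasurableSet (D X)) ∧ iIndepSet D μ ∧ (∀ X, μ (D X) = 9 / 10) ∧
    ∀ X, ∀ ω ∈ D X, T.SplitsAway X.1 (O ω X)

/-- The answer to the query `(i, j, k)`; it is `0` if these are not three distinct vertices. -/
def oracleAnswer {n : ℕ} (O : Triplet n → Fin n) (i j k : ℕ) : ℕ :=
  if h : i < n ∧ j < n ∧ k < n then
    if h3 : ({⟨i, h.1⟩, ⟨j, h.2.1⟩, ⟨k, h.2.2⟩} : Finset (Fin n)).card = 3 then
      (O ⟨_, h3⟩ : ℕ)
    else 0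
  else 0

/-! ## The machine model

A random access machine with integer registers, integer arrays and arrays of real weights. The
unit-cost operations are addition, (truncated) subtraction and comparison of integers, addition,
subtraction and comparison of weights, array access, reading an entry of the adjacency matrix,
a query to the oracle, and writing an integer on the output. There is no multiplication, so that
the bit length of a number grows by a constant at most in each operation. -/

namespace RAM

/-- Integer expressions. -/
inductive AExpr where
  | lit (m : ℕ) : AExpr
  | var (x : ℕ) : AExpr
  | load (a : ℕ) (i : AExpr) : AExpr
  | add (e₁ e₂ : AExpr) : AExpr
  | sub (e₁ e₂ : AExpr) : AExpr

/-- Weight expressions. -/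
inductive WExpr where
  | zero : WExpr
  | edge (i j : AExpr) : WExpr
  | load (a : ℕ) (i : AExpr) : WExpr
  | add (e₁ e₂ : WExpr) : WExpr
  | sub (e₁ e₂ : WExpr) : WExpr

/-- Tests. -/
inductive Test where
  | lt (e₁ e₂ : AExpr) : Test
  | wlt (e₁ e₂ : WExpr) : Test
  | neg (b : Test) : Test
  | conj (b₁ b₂ : Test) : Test

/-- Programs. -/
inductive Cmd where
  | skip : Cmd
  | assign (x : ℕ) (e : AExpr) : Cmd
  | store (a : ℕ) (i e : AExpr) : Cmd
  | wstore (a : ℕ) (i : AExpr) (e : WExpr) : Cmd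
  | query (x : ℕ) (i j k : AExpr) : Cmd
  | emit (e : AExpr) : Cmd
  | seq (P Q : Cmd) : Cmd
  | ite (b : Test) (P Q : Cmd) : Cmd
  | loop (b : Test) (P : Cmd) : Cmd

/-- The external data: the adjacency matrix and the answers of the oracle. -/
structure Env where
  edge : ℕ → ℕ → ℝ
  ans : ℕ → ℕ → ℕ → ℕ

/-- The memory (registers, integer arrays, weight arrays) and the output written so far. -/
structure State where
  var : ℕ → ℕ
  arr : ℕ → ℕ → ℕ
  warr : ℕ → ℕ → ℝ
  out : List ℕ

/-- The initial state: register `0` holds `n`, all other cells are `0`, the output is empty. -/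
def State.init (n : ℕ) : State where
  var := fun x => if x = 0 then n else 0
  arr := fun _ _ => 0
  warr := fun _ _ => 0
  out := []

def State.setVar (s : State) (x m : ℕ) : State :=
  { s with var := Function.update s.var x m }

def State.setArr (s : State) (a i m : ℕ) : State :=
  { s with arr := Function.update s.arr a (Function.update (s.arr a) i m) }

noncomputable def State.setWarr (s : State) (a i : ℕ) (r : ℝ) : State :=
  { s with warr := Function.update s.warr a (Function.update (s.warr a) i r) }

def State.write (s : State) (m : ℕ) : State :=
  { s with out := s.out ++ [m] }

def AExpr.eval (s : State) : AExpr → ℕ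
  | lit m => m
  | var x => s.var x
  | load a i => s.arr a (i.eval s)
  | add e₁ e₂ => e₁.eval s + e₂.eval s
  | sub e₁ e₂ => e₁.eval s - e₂.eval s

def AExpr.cost : AExpr → ℕ
  | lit _ => 1
  | var _ => 1
  | load _ i => i.cost + 1
  | add e₁ e₂ => e₁.cost + e₂.cost + 1
  | sub e₁ e₂ => e₁.cost + e₂.cost + 1

noncomputable def WExpr.eval (E : Env) (s : State) : WExpr → ℝ
  | zero => 0
  | edge i j => E.edge (i.eval s) (j.eval s)
  | load a i => s.warr a (i.eval s)
  | add e₁ e₂ => e₁.eval E s + e₂.eval E s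
  | sub e₁ e₂ => e₁.eval E s - e₂.eval E s

def WExpr.cost : WExpr → ℕ
  | zero => 1
  | edge i j => i.cost + j.cost + 1
  | load _ i => i.cost + 1
  | add e₁ e₂ => e₁.cost + e₂.cost + 1
  | sub e₁ e₂ => e₁.cost + e₂.cost + 1

def Test.Holds (E : Env) (s : State) : Test → Prop
  | lt e₁ e₂ => e₁.eval s < e₂.eval s
  | wlt e₁ e₂ => e₁.eval E s < e₂.eval E s
  | neg b => ¬ b.Holds E s
  | conj b₁ b₂ => b₁.Holds E s ∧ b₂.Holds E s

def Test.cost : Test → ℕ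
  | lt e₁ e₂ => e₁.cost + e₂.cost + 1
  | wlt e₁ e₂ => e₁.cost + e₂.cost + 1
  | neg b => b.cost + 1
  | conj b₁ b₂ => b₁.cost + b₂.cost + 1

/-- `Exec E P s s' t q`: started in state `s`, the program `P` halts in state `s'` after `t` steps,
`q` of which are queries to the oracle. -/
inductive Exec (E : Env) : Cmd → State → State → ℕ → ℕ → Prop where
  | skip (s : State) : Exec E Cmd.skip s s 1 0
  | assign (x : ℕ) (e : AExpr) (s : State) :
      Exec E (Cmd.assign x e) s (s.setVar x (e.eval s)) (e.cost + 1) 0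
  | store (a : ℕ) (i e : AExpr) (s : State) :
      Exec E (Cmd.store a i e) s (s.setArr a (i.eval s) (e.eval s)) (i.cost + e.cost + 1) 0
  | wstore (a : ℕ) (i : AExpr) (e : WExpr) (s : State) :
      Exec E (Cmd.wstore a i e) s (s.setWarr a (i.eval s) (e.eval E s)) (i.cost + e.cost + 1) 0
  | query (x : ℕ) (i j k : AExpr) (s : State) :
      Exec E (Cmd.query x i j k) s (s.setVar x (E.ans (i.eval s) (j.eval s) (k.eval s)))
        (i.cost + j.cost + k.cost + 1) 1
  | emit (e : AExpr) (s : State) :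
      Exec E (Cmd.emit e) s (s.write (e.eval s)) (e.cost + 1) 0
  | seq {P Q : Cmd} {s₁ s₂ s₃ : State} {t₁ t₂ q₁ q₂ : ℕ}
      (h₁ : Exec E P s₁ s₂ t₁ q₁) (h₂ : Exec E Q s₂ s₃ t₂ q₂) :
      Exec E (Cmd.seq P Q) s₁ s₃ (t₁ + t₂) (q₁ + q₂)
  | iteTrue {b : Test} {P : Cmd} (Q : Cmd) {s s' : State} {t q : ℕ}
      (hb : b.Holds E s) (h : Exec E P s s' t q) :
      Exec E (Cmd.ite b P Q) s s' (b.cost + t + 1) q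
  | iteFalse {b : Test} (P : Cmd) {Q : Cmd} {s s' : State} {t q : ℕ}
      (hb : ¬ b.Holds E s) (h : Exec E Q s s' t q) :
      Exec E (Cmd.ite b P Q) s s' (b.cost + t + 1) q
  | loopTrue {b : Test} {P : Cmd} {s₁ s₂ s₃ : State} {t₁ t₂ q₁ q₂ : ℕ}
      (hb : b.Holds E s₁) (h₁ : Exec E P s₁ s₂ t₁ q₁)
      (h₂ : Exec E (Cmd.loop b P) s₂ s₃ t₂ q₂) :
      Exec E (Cmd.loop b P) s₁ s₃ (b.cost + t₁ + 1 + t₂) (q₁ + q₂)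
  | loopFalse {b : Test} (P : Cmd) {s : State} (hb : ¬ b.Holds E s) :
      Exec E (Cmd.loop b P) s s (b.cost + 1) 0

/-- Programs are deterministic: the final state, the time and the number of queries are unique. -/
theorem Exec.unique {E : Env} {P : Cmd} {s s' : State} {t q : ℕ} (h : Exec E P s s' t q) :
    ∀ {s'' : State} {t' q' : ℕ}, Exec E P s s'' t' q' → s' = s'' ∧ t = t' ∧ q = q' := by
  induction h with
  | seq _ _ ih₁ ih₂ =>
    intro _ _ _ h'
    cases h' with
    | seq g₁ g₂ =>
      obtain ⟨rfl, rfl, rfl⟩ := ih₁ g₁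
      obtain ⟨rfl, rfl, rfl⟩ := ih₂ g₂
      exact ⟨rfl, rfl, rfl⟩
  | iteTrue _ hb _ ih =>
    intro _ _ _ h'
    cases h' with
    | iteTrue _ _ g => obtain ⟨rfl, rfl, rfl⟩ := ih g; exact ⟨rfl, rfl, rfl⟩
    | iteFalse _ hb' _ => exact absurd hb hb'
  | iteFalse _ hb _ ih =>
    intro _ _ _ h'
    cases h' with
    | iteTrue _ hb' _ => exact absurd hb' hb
    | iteFalse _ _ g => obtain ⟨rfl, rfl, rfl⟩ := ih g; exact ⟨rfl, rfl, rfl⟩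
  | loopTrue hb _ _ ih₁ ih₂ =>
    intro _ _ _ h'
    cases h' with
    | loopTrue _ g₁ g₂ =>
      obtain ⟨rfl, rfl, rfl⟩ := ih₁ g₁
      obtain ⟨rfl, rfl, rfl⟩ := ih₂ g₂
      exact ⟨rfl, rfl, rfl⟩
    | loopFalse _ hb' => exact absurd hb hb'
  | loopFalse _ hb =>
    intro _ _ _ h'
    cases h' with
    | loopTrue hb' _ _ => exact absurd hb' hb
    | loopFalse _ _ => exact ⟨rfl, rfl, rfl⟩
  | _ => intro _ _ _ h'; cases h'; exact ⟨rfl, rfl, rfl⟩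

/-- `Runs P G O s t q`: on the input graph `G` and the oracle `O`, the program `P` halts in state
`s` after `t` steps, `q` of which are queries. -/
def Runs {n : ℕ} (P : Cmd) (G : WeightedGraph n) (O : Triplet n → Fin n)
    (s : State) (t q : ℕ) : Prop :=
  Exec ⟨G.entry, oracleAnswer O⟩ P (State.init n) s t q

/-- On the input `G` with oracle `O`, the program `P` halts and outputs the tree `T`. -/
def Outputs {n : ℕ} (P : Cmd) (G : WeightedGraph n) (O : Triplet n → Fin n)
    (T : HCTree (Fin n)) : Prop :=
  ∃ (s : State) (t q : ℕ), Runs P G O s t q ∧ s.out = T.code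

end RAM

/-!
The algorithm achieves `α = 2` with at most `n ^ 3` queries.

In a tree `T`, call the number `T.joinSize u v` of leaves below the lowest common ancestor of `u`
and `v` their distance; it is an ultrametric. In a triplet, the vertex that splits away is the one
that is farther from the two others than these are from each other. For `u ≠ v`, the answers on the
triplets `{u, v, w}` therefore tell which `w` are at most as far from `u` as `v` is. Balls in this
ultrametric are small: at most `t` vertices are within distance `t` of `u`, and if `u` and `v` have
distance `t`, then exactly `t` vertices are at most as far from `u` as `v`. Counting the `w` that
seem to be at most as far from `u` as `v` thus estimates the distance of `u` and `v`, provided that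
the count is confined to a ball around `u` that is not much larger than the scale in question, so
that the wrong answers are few compared with it. The scales are scanned downwards, and the estimates
found so far provide the ball (`Scanned.test`). If among the `w` within distance `t` of `u` at most
`t / 8` have a wrong answer, for all `t` from `m` on (`Reliable`), then the resulting estimates `h`
satisfy `h ≤ 2 r`, and `r ≤ h` wherever the distance `r` is at least `m` (`run_estProg`). By
Hoeffding's inequality and a union bound this holds with probability at least `1 - n ^ (-c)` for
some `m` of order `log n` (`one_sub_le_measureReal_reliable`).

Single linkage on the estimates then produces a good tree. Pairs with estimate at most `m` are
merged at the start; since `r > m` implies `h > m`, the classes have at most `m` vertices, and all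
their subsets, at most `n * 2 ^ m` in number and hence polynomially many, are put into a family of
vertex sets. Then the pairs are merged in the order of their estimates, and each new class is added
to the family. A class that appears at threshold `t` has at most `t` vertices, and a pair `{a, b}`
joined at this moment has `t ≤ h a b ≤ 2 * r a b`; so the cost of the new node is at most twice what
the optimal tree pays for the same pairs (`Linkage.step`). Within the classes of the start the
optimal tree itself can be used, as all the subsets are available (`Hereditary.exists_derivable`).
Hence the family supports a tree of cost at most twice the optimum, and dynamic programming over the
family finds the best tree that it supports (`TableAt.le_nodeCost`, `TableAt.exists_represents`).

The programs are written in a language with counting loops (`RAM.Prog`), for which the final state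
is a total function, the running time is bounded syntactically, and the machine is shown to reach
that state (`RAM.Prog.exec_run`).
-/

/-! ### Programs with bounded loops -/

namespace RAM

/-- Programs whose only loops are counting loops: `forTo i b P` runs `P` with register `i` equal to
`0, 1, …, m - 1`, where `m` is the content of register `b`. -/
inductive Prog where
  | skip : Prog
  | assign (x : ℕ) (e : AExpr) : Prog
  | store (a : ℕ) (i e : AExpr) : Prog
  | wstore (a : ℕ) (i : AExpr) (e : WExpr) : Prog
  | query (x : ℕ) (i j k : AExpr) : Prog
  | emit (e : AExpr) : Prog
  | seq (P Q : Prog) : Prog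
  | ite (b : Test) (P Q : Prog) : Prog
  | forTo (i b : ℕ) (P : Prog) : Prog

namespace Prog

/-- The translation into the language of the machine. -/
def toCmd : Prog → Cmd
  | skip => .skip
  | assign x e => .assign x e
  | store a i e => .store a i e
  | wstore a i e => .wstore a i e
  | query x i j k => .query x i j k
  | emit e => .emit e
  | seq P Q => .seq P.toCmd Q.toCmd
  | ite b P Q => .ite b P.toCmd Q.toCmd
  | forTo i b P =>
      .seq (.assign i (.lit 0))
        (.loop (.lt (.var i) (.var b)) (.seq P.toCmd (.assign i (.add (.var i) (.lit 1)))))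

/-- The registers that a program may write. -/
def regs : Prog → List ℕ
  | assign x _ => [x]
  | query x _ _ _ => [x]
  | seq P Q => P.regs ++ Q.regs
  | ite _ P Q => P.regs ++ Q.regs
  | forTo i _ P => i :: P.regs
  | _ => []

/-- The integer arrays that a program may write. -/
def arrs : Prog → List ℕ
  | store a _ _ => [a]
  | seq P Q => P.arrs ++ Q.arrs
  | ite _ P Q => P.arrs ++ Q.arrs
  | forTo _ _ P => P.arrs
  | _ => []

/-- The weight arrays that a program may write. -/
def warrs : Prog → List ℕ
  | wstore a _ _ => [a]
  | seq P Q => P.warrs ++ Q.warrs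
  | ite _ P Q => P.warrs ++ Q.warrs
  | forTo _ _ P => P.warrs
  | _ => []

/-- Whether a program may write on the output. -/
def emits : Prog → Bool
  | emit _ => true
  | seq P Q => P.emits || Q.emits
  | ite _ P Q => P.emits || Q.emits
  | forTo _ _ P => P.emits
  | _ => false

/-- The registers that bound the loops of a program. -/
def bounds : Prog → List ℕ
  | seq P Q => P.bounds ++ Q.bounds
  | ite _ P Q => P.bounds ++ Q.bounds
  | forTo _ b P => b :: P.bounds
  | _ => []

/-- No loop body writes the counter of its loop. -/
def countersOk : Prog → Bool
  | seq P Q => P.countersOk && Q.countersOk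
  | ite _ P Q => P.countersOk && Q.countersOk
  | forTo i _ P => decide (i ∉ P.regs) && P.countersOk
  | _ => true

/-- No loop body writes the counter of its loop, and no register that bounds a loop is written. -/
def wf (P : Prog) : Bool := P.countersOk && P.bounds.all fun b => decide (b ∉ P.regs)

/-- The state after `k` rounds of a loop whose round number `j` is `f j`. -/
def rounds (f : ℕ → State → State) (s : State) : ℕ → State
  | 0 => s
  | k + 1 => f k (rounds f s k)

open Classical in
/-- The final state of a program; for well-formed programs it is the one reached by the machine. -/
noncomputable def run (E : Env) : Prog → State → State
  | skip, s => s
  | assign x e, s => s.setVar x (e.eval s)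
  | store a i e, s => s.setArr a (i.eval s) (e.eval s)
  | wstore a i e, s => s.setWarr a (i.eval s) (e.eval E s)
  | query x i j k, s => s.setVar x (E.ans (i.eval s) (j.eval s) (k.eval s))
  | emit e, s => s.write (e.eval s)
  | seq P Q, s => Q.run E (P.run E s)
  | ite b P Q, s => if b.Holds E s then P.run E s else Q.run E s
  | forTo i b P, s => (rounds (fun k s' => P.run E (s'.setVar i k)) s (s.var b)).setVar i (s.var b)

theorem run_seq (E : Env) (P Q : Prog) (s : State) :
    (seq P Q).run E s = Q.run E (P.run E s) := rfl

/-- A bound for the time, if all loop bounds are at most `N`. -/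
def time (N : ℕ) : Prog → ℕ
  | skip => 1
  | assign _ e => e.cost + 1
  | store _ i e => i.cost + e.cost + 1
  | wstore _ i e => i.cost + e.cost + 1
  | query _ i j k => i.cost + j.cost + k.cost + 1
  | emit e => e.cost + 1
  | seq P Q => P.time N + Q.time N
  | ite b P Q => b.cost + (P.time N + Q.time N) + 1
  | forTo _ _ P => 6 + N * (P.time N + 8)

/-- A bound for the number of queries, if all loop bounds are at most `N`. -/
def queries (N : ℕ) : Prog → ℕ
  | query _ _ _ _ => 1
  | seq P Q => P.queries N + Q.queries N
  | ite _ P Q => P.queries N + Q.queries N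
  | forTo _ _ P => N * P.queries N
  | _ => 0

/-- The state `s'` differs from `s` at most in cells that `P` may write. -/
structure Frame (P : Prog) (s s' : State) : Prop where
  var : ∀ x, x ∉ P.regs → s'.var x = s.var x
  arr : ∀ a, a ∉ P.arrs → s'.arr a = s.arr a
  warr : ∀ a, a ∉ P.warrs → s'.warr a = s.warr a
  out : P.emits = false → s'.out = s.out

theorem Frame.refl (P : Prog) (s : State) : P.Frame s s :=
  ⟨fun _ _ => rfl, fun _ _ => rfl, fun _ _ => rfl, fun _ => rfl⟩

theorem Frame.trans {P : Prog} {s₁ s₂ s₃ : State} (h : P.Frame s₁ s₂) (h' : P.Frame s₂ s₃) :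
    P.Frame s₁ s₃ :=
  ⟨fun x hx => (h'.var x hx).trans (h.var x hx), fun x hx => (h'.arr x hx).trans (h.arr x hx),
    fun x hx => (h'.warr x hx).trans (h.warr x hx), fun hx => (h'.out hx).trans (h.out hx)⟩

theorem Frame.mono {P Q : Prog} {s s' : State} (h : P.Frame s s') (h₁ : P.regs ⊆ Q.regs)
    (h₂ : P.arrs ⊆ Q.arrs) (h₃ : P.warrs ⊆ Q.warrs) (h₄ : Q.emits = false → P.emits = false) :
    Q.Frame s s' :=
  ⟨fun x hx => h.var x fun h => hx (h₁ h), fun x hx => h.arr x fun h => hx (h₂ h),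
    fun x hx => h.warr x fun h => hx (h₃ h), fun hx => h.out (h₄ hx)⟩

theorem frame_setVar {P : Prog} {i : ℕ} (h : i ∈ P.regs) (s : State) (k : ℕ) :
    P.Frame s (s.setVar i k) :=
  ⟨fun x hx => by
    have : x ≠ i := fun e => hx (e ▸ h)
    simp [State.setVar, this], fun _ _ => rfl, fun _ _ => rfl, fun _ => rfl⟩

theorem frame_run (E : Env) (P : Prog) (s : State) : P.Frame s (P.run E s) := by
  induction P generalizing s with
  | skip => exact Frame.refl _ _
  | assign x e => exact frame_setVar (by simp [regs]) _ _
  | store a i e =>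
    refine ⟨fun _ _ => rfl, fun b hb => ?_, fun _ _ => rfl, fun _ => rfl⟩
    have : b ≠ a := by simpa [arrs] using hb
    simp [run, State.setArr, this]
  | wstore a i e =>
    refine ⟨fun _ _ => rfl, fun _ _ => rfl, fun b hb => ?_, fun _ => rfl⟩
    have : b ≠ a := by simpa [warrs] using hb
    simp [run, State.setWarr, this]
  | query x i j k => exact frame_setVar (by simp [regs]) _ _
  | emit e => exact ⟨fun _ _ => rfl, fun _ _ => rfl, fun _ _ => rfl, fun h => by simp [emits] at h⟩
  | seq P Q ihP ihQ =>
    exact ((ihP s).mono (by simp [regs]) (by simp [arrs]) (by simp [warrs])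
      (by simp +contextual [emits])).trans ((ihQ _).mono (by simp [regs]) (by simp [arrs])
      (by simp [warrs]) (by simp +contextual [emits]))
  | ite b P Q ihP ihQ =>
    rw [run]
    split_ifs
    · exact (ihP s).mono (by simp [regs]) (by simp [arrs]) (by simp [warrs])
        (by simp +contextual [emits])
    · exact (ihQ s).mono (by simp [regs]) (by simp [arrs]) (by simp [warrs])
        (by simp +contextual [emits])
  | forTo i b P ih =>
    have key : ∀ k, (forTo i b P).Frame s (rounds (fun k s' => P.run E (s'.setVar i k)) s k) := by
      intro k
      induction k with
      | zero => exact Frame.refl _ _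
      | succ k ihk =>
        exact (ihk.trans (frame_setVar (by simp [regs]) _ _)).trans
          ((ih _).mono (by simp [regs]) (by simp [arrs]) (by simp [warrs]) (by simp [emits]))
    exact (key _).trans (frame_setVar (by simp [regs]) _ _)

/-- The invariant rule for counting loops. The frame is available in each round. -/
theorem run_forTo {E : Env} {i b : ℕ} {P : Prog} {s : State} (I : ℕ → State → Prop)
    (h0 : I 0 s)
    (hstep : ∀ k s', k < s.var b → (forTo i b P).Frame s s' → I k s' →
      I (k + 1) (P.run E (s'.setVar i k))) :
    ∃ s', (forTo i b P).run E s = s'.setVar i (s.var b) ∧ (forTo i b P).Frame s s' ∧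
      I (s.var b) s' := by
  have key : ∀ k, k ≤ s.var b →
      (forTo i b P).Frame s (rounds (fun k s' => P.run E (s'.setVar i k)) s k) ∧
      I k (rounds (fun k s' => P.run E (s'.setVar i k)) s k) := by
    intro k
    induction k with
    | zero => exact fun _ => ⟨Frame.refl _ _, h0⟩
    | succ k ih =>
      intro hk
      obtain ⟨hF, hI⟩ := ih (by omega)
      refine ⟨?_, hstep k _ (by omega) hF hI⟩
      exact (hF.trans (frame_setVar (by simp [regs]) _ _)).trans
          ((frame_run E P _).mono (by simp [regs]) (by simp [arrs]) (by simp [warrs])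
            (by simp [emits]))
  exact ⟨_, rfl, (key _ le_rfl).1, (key _ le_rfl).2⟩

/-- The machine executes a well-formed program within the bounds `time` and `queries`. -/
theorem exec_run (E : Env) (P : Prog) (N : ℕ) (hc : P.countersOk = true)
    (hb : ∀ b ∈ P.bounds, b ∉ P.regs) (s : State) (hN : ∀ b ∈ P.bounds, s.var b ≤ N) :
    ∃ t q, Exec E P.toCmd s (P.run E s) t q ∧ t ≤ P.time N ∧ q ≤ P.queries N := by
  induction P generalizing s with
  | skip => exact ⟨_, _, Exec.skip s, le_rfl, le_rfl⟩
  | assign x e => exact ⟨_, _, Exec.assign x e s, le_rfl, le_rfl⟩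
  | store a i e => exact ⟨_, _, Exec.store a i e s, le_rfl, le_rfl⟩
  | wstore a i e => exact ⟨_, _, Exec.wstore a i e s, le_rfl, le_rfl⟩
  | query x i j k => exact ⟨_, _, Exec.query x i j k s, le_rfl, le_rfl⟩
  | emit e => exact ⟨_, _, Exec.emit e s, le_rfl, le_rfl⟩
  | seq P Q ihP ihQ =>
    simp only [countersOk, Bool.and_eq_true, bounds, regs, List.mem_append, not_or] at hc hb hN
    obtain ⟨t₁, q₁, h₁, ht₁, hq₁⟩ := ihP hc.1 (fun b h => (hb b (.inl h)).1) s
      (fun b h => hN b (.inl h))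
    obtain ⟨t₂, q₂, h₂, ht₂, hq₂⟩ := ihQ hc.2 (fun b h => (hb b (.inr h)).2) (P.run E s)
      (fun b h => by rw [(frame_run E P s).var b (hb b (.inr h)).1]; exact hN b (.inr h))
    exact ⟨_, _, Exec.seq h₁ h₂, Nat.add_le_add ht₁ ht₂, Nat.add_le_add hq₁ hq₂⟩
  | ite b P Q ihP ihQ =>
    simp only [countersOk, Bool.and_eq_true, bounds, regs, List.mem_append, not_or] at hc hb hN
    by_cases h : b.Holds E s
    · obtain ⟨t₁, q₁, h₁, ht₁, hq₁⟩ := ihP hc.1 (fun b h => (hb b (.inl h)).1) s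
        (fun b h => hN b (.inl h))
      refine ⟨_, _, by rw [run, if_pos h]; exact Exec.iteTrue _ h h₁, ?_, ?_⟩
      · simp only [time]; omega
      · simp only [queries]; omega
    · obtain ⟨t₁, q₁, h₁, ht₁, hq₁⟩ := ihQ hc.2 (fun b h => (hb b (.inr h)).2) s
        (fun b h => hN b (.inr h))
      refine ⟨_, _, by rw [run, if_neg h]; exact Exec.iteFalse _ h h₁, ?_, ?_⟩
      · simp only [time]; omega
      · simp only [queries]; omega
  | forTo i b P ih =>
    simp only [countersOk, Bool.and_eq_true, decide_eq_true_eq, bounds, regs, List.mem_cons,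
      not_or, forall_eq_or_imp] at hc hb hN
    obtain ⟨hi, hc⟩ := hc
    obtain ⟨⟨hbi, hbP⟩, hb⟩ := hb
    obtain ⟨hbN, hN⟩ := hN
    set S := rounds (fun k s' => P.run E (s'.setVar i k)) s with hS
    have hFr : ∀ k, (forTo i b P).Frame s (S k) := by
      intro k
      induction k with
      | zero => exact Frame.refl _ _
      | succ k ihk =>
        exact (ihk.trans (frame_setVar (by simp [regs]) _ _)).trans
          ((frame_run E P _).mono (by simp [regs]) (by simp [arrs]) (by simp [warrs])
            (by simp [emits]))
    have hvar : ∀ k x, x ≠ i → x ∉ P.regs → (S k).var x = s.var x := fun k x h1 h2 =>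
      (hFr k).var x (by simp [regs, h1, h2])
    have key : ∀ d k, k + d = s.var b → ∃ t q,
        Exec E (.loop (.lt (.var i) (.var b)) (.seq P.toCmd (.assign i (.add (.var i) (.lit 1)))))
          ((S k).setVar i k) ((S (s.var b)).setVar i (s.var b)) t q ∧
          t ≤ 4 + d * (P.time N + 8) ∧ q ≤ d * P.queries N := by
      intro d
      induction d with
      | zero =>
        intro k hk
        obtain rfl : k = s.var b := by omega
        refine ⟨_, _, Exec.loopFalse _ ?_, ?_, ?_⟩
        · simp [Test.Holds, AExpr.eval, State.setVar, hbi, hvar _ b hbi hbP]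
        · simp [Test.cost, AExpr.cost]
        · simp
      | succ d ihd =>
        intro k hk
        obtain ⟨t₁, q₁, h₁, ht₁, hq₁⟩ := ih hc (fun b h => (hb b h).2) ((S k).setVar i k)
          (fun b h => by
            have := hb b h
            simpa [State.setVar, this.1, hvar k b this.1 this.2] using hN b h)
        obtain ⟨t₂, q₂, h₂, ht₂, hq₂⟩ := ihd (k + 1) (by omega)
        have e : (P.run E ((S k).setVar i k)).setVar i ((AExpr.add (.var i) (.lit 1)).eval
            (P.run E ((S k).setVar i k))) = (S (k + 1)).setVar i (k + 1) := by
          have : (P.run E ((S k).setVar i k)).var i = k := by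
            rw [(frame_run E P _).var i hi]; simp [State.setVar]
          simp only [AExpr.eval, this]
          rfl
        refine ⟨_, _, Exec.loopTrue ?_ (Exec.seq h₁ (e ▸ Exec.assign _ _ _)) h₂, ?_, ?_⟩
        · simp only [Test.Holds, AExpr.eval, State.setVar]
          simp [hbi, hvar _ b hbi hbP]; omega
        · simp only [Test.cost, AExpr.cost]
          rw [Nat.add_mul]; omega
        · rw [Nat.add_mul]; omega
    obtain ⟨t, q, h, ht, hq⟩ := key (s.var b) 0 (by omega)
    refine ⟨_, _, Exec.seq (Exec.assign _ _ _) h, ?_, ?_⟩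
    · have : s.var b * (P.time N + 8) ≤ N * (P.time N + 8) := Nat.mul_le_mul_right _ hbN
      simp only [time, AExpr.cost]
      omega
    · have : s.var b * P.queries N ≤ N * P.queries N := Nat.mul_le_mul_right _ hbN
      simp only [queries]
      omega

theorem wf_spec {P : Prog} (h : P.wf = true) :
    P.countersOk = true ∧ ∀ b ∈ P.bounds, b ∉ P.regs := by
  simpa [wf] using h

/-- The depth of the nesting of loops. -/
def depth : Prog → ℕ
  | seq P Q => max P.depth Q.depth
  | ite _ P Q => max P.depth Q.depth
  | forTo _ _ P => P.depth + 1
  | _ => 0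

/-- The time of a program is polynomial in the loop bounds. -/
theorem time_le (N : ℕ) (P : Prog) : P.time N ≤ P.time 1 * (N + 1) ^ P.depth := by
  have mono : ∀ {a b c : ℕ}, b ≤ c → a * (N + 1) ^ b ≤ a * (N + 1) ^ c := fun h =>
    Nat.mul_le_mul_left _ (Nat.pow_le_pow_right (by omega) h)
  induction P with
  | seq P Q ihP ihQ =>
    simp only [time, depth]
    rw [Nat.add_mul]
    exact Nat.add_le_add (ihP.trans (mono (le_max_left _ _))) (ihQ.trans (mono (le_max_right _ _)))
  | ite b P Q ihP ihQ =>
    simp only [time, depth]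
    have h1 := ihP.trans (mono (le_max_left P.depth Q.depth))
    have h2 := ihQ.trans (mono (le_max_right P.depth Q.depth))
    have h3 : 1 ≤ (N + 1) ^ (max P.depth Q.depth) := Nat.one_le_pow _ _ (by omega)
    nlinarith
  | forTo i b P ih =>
    simp only [time, depth]
    have h3 : 1 ≤ (N + 1) ^ P.depth := Nat.one_le_pow _ _ (by omega)
    rw [pow_succ]
    nlinarith [Nat.mul_le_mul_left N ih, Nat.mul_le_mul_left N h3]
  | _ => simp [time, depth]

end Prog
end RAM

/-! ### Lowest common ancestors -/

namespace HCTree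

variable {V : Type*} [DecidableEq V]

@[simp] theorem leaves_leaf (v : V) : (leaf v).leaves = {v} := by simp [leaves, leafList]

@[simp] theorem leaves_node (l r : HCTree V) : (node l r).leaves = l.leaves ∪ r.leaves := by
  simp [leaves, leafList]

theorem leaves_nonempty (T : HCTree V) : T.leaves.Nonempty := by
  induction T with
  | leaf v => simp
  | node l r ihl ihr => simp [ihl]

theorem nodup_node {l r : HCTree V} (h : (node l r).leafList.Nodup) :
    l.leafList.Nodup ∧ r.leafList.Nodup ∧ Disjoint l.leaves r.leaves := by
  rw [leafList, List.nodup_append] at h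
  refine ⟨h.1, h.2.1, Finset.disjoint_left.2 fun a ha hb => ?_⟩
  exact h.2.2 a (List.mem_toFinset.1 ha) a (List.mem_toFinset.1 hb) rfl

/-- The number of leaves below the lowest common ancestor of `u` and `v`: an ultrametric on the
leaves. -/
def joinSize (T : HCTree V) (u v : V) : ℕ := (T.lca {u, v}).leaves.card

theorem joinSize_comm (T : HCTree V) (u v : V) : T.joinSize u v = T.joinSize v u := by
  rw [joinSize, joinSize, Finset.pair_comm]

theorem joinSize_node_left {l r : HCTree V} {u v : V} (hu : u ∈ l.leaves) (hv : v ∈ l.leaves) :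
    (node l r).joinSize u v = l.joinSize u v := by
  simp [joinSize, lca, Finset.insert_subset_iff, hu, hv]

theorem joinSize_node_right {l r : HCTree V} (h : Disjoint l.leaves r.leaves) {u v : V}
    (hu : u ∈ r.leaves) (hv : v ∈ r.leaves) : (node l r).joinSize u v = r.joinSize u v := by
  have := Finset.disjoint_right.1 h hu
  simp [joinSize, lca, Finset.insert_subset_iff, hu, hv, this]

theorem joinSize_node_cross {l r : HCTree V} (h : Disjoint l.leaves r.leaves) {u v : V}
    (hu : u ∈ l.leaves) (hv : v ∈ r.leaves) :
    (node l r).joinSize u v = (node l r).leaves.card := by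
  have h1 := Finset.disjoint_right.1 h hv
  have h2 := Finset.disjoint_left.1 h hu
  simp [joinSize, lca, Finset.insert_subset_iff, h1, h2]

theorem joinSize_self {T : HCTree V} (hT : T.leafList.Nodup) {u : V} (hu : u ∈ T.leaves) :
    T.joinSize u u = 1 := by
  induction T with
  | leaf x => simp [joinSize, lca]
  | node l r ihl ihr =>
    obtain ⟨hl, hr, hd⟩ := nodup_node hT
    rcases Finset.mem_union.1 (leaves_node l r ▸ hu) with hu | hu
    · rw [joinSize_node_left hu hu]; exact ihl hl hu
    · rw [joinSize_node_right hd hu hu]; exact ihr hr hu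

theorem leaves_lca_subset (T : HCTree V) (X : Finset V) : (T.lca X).leaves ⊆ T.leaves := by
  induction T with
  | leaf v => simp [lca]
  | node l r ihl ihr =>
    rw [lca, leaves_node]
    split_ifs
    · exact ihl.trans Finset.subset_union_left
    · exact ihr.trans Finset.subset_union_right
    · rw [leaves_node]

theorem joinSize_le (T : HCTree V) (u v : V) : T.joinSize u v ≤ T.leaves.card :=
  Finset.card_le_card (T.leaves_lca_subset _)

theorem one_le_joinSize (T : HCTree V) (u v : V) : 1 ≤ T.joinSize u v :=
  Finset.card_pos.2 (leaves_nonempty _)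

theorem card_lca_mono {T : HCTree V} (hT : T.leafList.Nodup) {X Y : Finset V}
    (hY : Y.Nonempty) (hYX : Y ⊆ X) : (T.lca Y).leaves.card ≤ (T.lca X).leaves.card := by
  induction T with
  | leaf v => simp [lca]
  | node l r ihl ihr =>
    obtain ⟨hl, hr, hd⟩ := nodup_node hT
    simp only [lca]
    by_cases h1 : X ⊆ l.leaves
    · rw [if_pos h1, if_pos (hYX.trans h1)]; exact ihl hl
    · rw [if_neg h1]
      by_cases h2 : X ⊆ r.leaves
      · have : ¬ Y ⊆ l.leaves := fun h => by
          obtain ⟨y, hy⟩ := hY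
          exact Finset.disjoint_left.1 hd (h hy) (h2 (hYX hy))
        rw [if_pos h2, if_neg this, if_pos (hYX.trans h2)]; exact ihr hr
      · rw [if_neg h2]
        exact Finset.card_le_card (leaves_lca_subset (node l r) Y)

theorem joinSize_le_max {T : HCTree V} (hT : T.leafList.Nodup) {u v w : V} (hu : u ∈ T.leaves)
    (hv : v ∈ T.leaves) (hw : w ∈ T.leaves) :
    T.joinSize u w ≤ max (T.joinSize u v) (T.joinSize v w) := by
  induction T with
  | leaf x => simp [joinSize, lca]
  | node l r ihl ihr =>
    obtain ⟨hl, hr, hd⟩ := nodup_node hT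
    have hle := joinSize_le (node l r) u w
    have hc : ∀ {a b}, a ∈ r.leaves → b ∈ l.leaves →
        (node l r).joinSize a b = (node l r).leaves.card := fun ha hb => by
      rw [joinSize_comm, joinSize_node_cross hd hb ha]
    rw [leaves_node, Finset.mem_union] at hu hv hw
    rcases hu with hu | hu <;> rcases hv with hv | hv
    · rcases hw with hw | hw
      · rw [joinSize_node_left hu hw, joinSize_node_left hu hv, joinSize_node_left hv hw]
        exact ihl hl hu hv hw
      · rw [joinSize_node_cross hd hv hw]; exact hle.trans (le_max_right _ _)
    · rw [joinSize_node_cross hd hu hv]; exact hle.trans (le_max_left _ _)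
    · rw [hc hu hv]; exact hle.trans (le_max_left _ _)
    · rcases hw with hw | hw
      · rw [hc hv hw]; exact hle.trans (le_max_right _ _)
      · rw [joinSize_node_right hd hu hw, joinSize_node_right hd hu hv,
          joinSize_node_right hd hv hw]
        exact ihr hr hu hv hw

theorem card_joinSize_le {T : HCTree V} (hT : T.leafList.Nodup) {u : V} (hu : u ∈ T.leaves)
    {t : ℕ} (ht : 1 ≤ t) : (T.leaves.filter fun w => T.joinSize u w ≤ t).card ≤ t := by
  induction T with
  | leaf x => exact (Finset.card_filter_le _ _).trans (by simpa using ht)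
  | node l r ihl ihr =>
    obtain ⟨hl, hr, hd⟩ := nodup_node hT
    by_cases hle : (node l r).leaves.card ≤ t
    · exact (Finset.card_filter_le _ _).trans hle
    rcases Finset.mem_union.1 (leaves_node l r ▸ hu) with hu | hu
    · refine (Finset.card_le_card fun w hw => ?_).trans (ihl hl hu)
      rw [Finset.mem_filter, leaves_node, Finset.mem_union] at hw
      obtain ⟨hw | hw, h⟩ := hw
      · rw [joinSize_node_left hu hw] at h
        exact Finset.mem_filter.2 ⟨hw, h⟩
      · rw [joinSize_node_cross hd hu hw] at h
        exact absurd h hle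
    · refine (Finset.card_le_card fun w hw => ?_).trans (ihr hr hu)
      rw [Finset.mem_filter, leaves_node, Finset.mem_union] at hw
      obtain ⟨hw | hw, h⟩ := hw
      · rw [joinSize_comm, joinSize_node_cross hd hw hu] at h
        exact absurd h hle
      · rw [joinSize_node_right hd hu hw] at h
        exact Finset.mem_filter.2 ⟨hw, h⟩

theorem joinSize_le_card {T : HCTree V} (hT : T.leafList.Nodup) {u v : V} (hu : u ∈ T.leaves)
    (hv : v ∈ T.leaves) :
    T.joinSize u v ≤ (T.leaves.filter fun w => T.joinSize u w ≤ T.joinSize u v).card := by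
  induction T with
  | leaf x => simp [joinSize, lca]
  | node l r ihl ihr =>
    obtain ⟨hl, hr, hd⟩ := nodup_node hT
    have top : (node l r).joinSize u v = (node l r).leaves.card →
        (node l r).joinSize u v ≤ ((node l r).leaves.filter fun w =>
          (node l r).joinSize u w ≤ (node l r).joinSize u v).card := fun h => by
      rw [Finset.filter_true_of_mem fun w _ => h ▸ joinSize_le _ u w, h]
    rw [leaves_node, Finset.mem_union] at hu hv
    rcases hu with hu | hu <;> rcases hv with hv | hv
    · rw [joinSize_node_left hu hv]
      refine (ihl hl hu hv).trans (Finset.card_le_card fun w hw => ?_)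
      rw [Finset.mem_filter] at hw ⊢
      rw [joinSize_node_left hu hw.1, leaves_node]
      exact ⟨Finset.mem_union_left _ hw.1, hw.2⟩
    · exact top (joinSize_node_cross hd hu hv)
    · exact top (by rw [joinSize_comm, joinSize_node_cross hd hv hu])
    · rw [joinSize_node_right hd hu hv]
      refine (ihr hr hu hv).trans (Finset.card_le_card fun w hw => ?_)
      rw [Finset.mem_filter] at hw ⊢
      rw [joinSize_node_right hd hu hw.1, leaves_node]
      exact ⟨Finset.mem_union_right _ hw.1, hw.2⟩

/-- The vertex that splits away is strictly farther from the other two than they are from each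
other. -/
theorem SplitsAway.joinSize_lt {T : HCTree V} (hT : T.leafList.Nodup) {u v w : V}
    (hu : u ∈ T.leaves) (hv : v ∈ T.leaves) (hw : w ∈ T.leaves) (huv : u ≠ v) (huw : u ≠ w)
    (hvw : v ≠ w) (h : T.SplitsAway {u, v, w} w) : T.joinSize u v < T.joinSize u w := by
  induction T with
  | leaf x => simp_all
  | node l r ihl ihr =>
    obtain ⟨hl, hr, hd⟩ := nodup_node hT
    have hwu := h.2 u (by simp) huw
    have hwv := h.2 v (by simp) hvw
    have cardl : l.leaves.card < (node l r).leaves.card := by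
      rw [leaves_node, Finset.card_union_of_disjoint hd]
      have := r.leaves_nonempty.card_pos
      omega
    have cardr : r.leaves.card < (node l r).leaves.card := by
      rw [leaves_node, Finset.card_union_of_disjoint hd]
      have := l.leaves_nonempty.card_pos
      omega
    by_cases h1 : ({u, v, w} : Finset V) ⊆ l.leaves
    · simp only [Finset.insert_subset_iff, Finset.singleton_subset_iff] at h1
      obtain ⟨h1, h2, h3⟩ := h1
      rw [joinSize_node_left h1 h2, joinSize_node_left h1 h3]
      refine ihl hl h1 h2 h3 ⟨h.1, fun x hx hxw => ?_⟩
      have := h.2 x hx hxw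
      have hxl : x ∈ l.leaves := by
        simp only [Finset.mem_insert, Finset.mem_singleton] at hx
        rcases hx with rfl | rfl | rfl <;> assumption
      simpa [lca, Finset.insert_subset_iff, h1, h2, h3, hxl] using this
    by_cases h2 : ({u, v, w} : Finset V) ⊆ r.leaves
    · simp only [Finset.insert_subset_iff, Finset.singleton_subset_iff] at h2
      obtain ⟨h1, h2, h3⟩ := h2
      rw [joinSize_node_right hd h1 h2, joinSize_node_right hd h1 h3]
      refine ihr hr h1 h2 h3 ⟨h.1, fun x hx hxw => ?_⟩
      have := h.2 x hx hxw
      have hxl : x ∈ r.leaves := by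
        simp only [Finset.mem_insert, Finset.mem_singleton] at hx
        rcases hx with rfl | rfl | rfl <;> assumption
      simpa [lca, Finset.insert_subset_iff, h1, h2, h3, hxl, Finset.disjoint_right.1 hd h1,
        Finset.disjoint_right.1 hd h3] using this
    have hX : (node l r).lca {u, v, w} = node l r := by rw [lca, if_neg h1, if_neg h2]
    rw [hX] at hwu hwv
    have eu : (node l r).joinSize u w = (node l r).leaves.card := by
      rw [joinSize_comm, joinSize, hwu]
    have ev : (node l r).joinSize v w = (node l r).leaves.card := by
      rw [joinSize_comm, joinSize, hwv]
    rw [eu]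
    rw [leaves_node, Finset.mem_union] at hu hv hw
    rcases hw with hw | hw
    · have hu' : u ∈ r.leaves := hu.resolve_left fun hu => by
        rw [joinSize_node_left hu hw] at eu
        exact absurd (l.joinSize_le u w) (by omega)
      have hv' : v ∈ r.leaves := hv.resolve_left fun hv => by
        rw [joinSize_node_left hv hw] at ev
        exact absurd (l.joinSize_le v w) (by omega)
      rw [joinSize_node_right hd hu' hv']
      exact (r.joinSize_le u v).trans_lt cardr
    · have hu' : u ∈ l.leaves := hu.resolve_right fun hu => by
        rw [joinSize_node_right hd hu hw] at eu
        exact absurd (r.joinSize_le u w) (by omega)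
      have hv' : v ∈ l.leaves := hv.resolve_right fun hv => by
        rw [joinSize_node_right hd hv hw] at ev
        exact absurd (r.joinSize_le v w) (by omega)
      rw [joinSize_node_left hu' hv']
      exact (l.joinSize_le u v).trans_lt cardl

/-- A vertex that is strictly farther from `u` than `v` is the one that splits away. -/
theorem SplitsAway.eq_of_joinSize_lt {T : HCTree V} (hT : T.leafList.Nodup) {u v w x : V}
    (h : T.SplitsAway {u, v, w} x) (hlt : T.joinSize u v < T.joinSize u w) (huw : u ≠ w)
    (huv : u ≠ v) : x = w := by
  have hx := h.1
  simp only [Finset.mem_insert, Finset.mem_singleton] at hx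
  rcases hx with rfl | rfl | rfl
  · have h1 := h.2 v (by simp) huv.symm
    have h2 := h.2 w (by simp) huw.symm
    rw [joinSize, joinSize, h1, h2] at hlt
    omega
  · have h1 := h.2 u (by simp) huv
    rw [joinSize_comm, joinSize, h1] at hlt
    have : T.joinSize u w ≤ _ := card_lca_mono (X := {u, x, w}) hT (by simp) (by
      intro a; simp; tauto)
    omega
  · rfl

/-! ### Dasgupta's cost as a sum over internal nodes -/

/-- Dasgupta's cost with respect to a weight function `w`, node by node. -/
def nodeCost (w : V → V → ℝ) : HCTree V → ℝ
  | leaf _ => 0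
  | node l r => l.nodeCost w + r.nodeCost w +
      (node l r).leaves.card * ∑ a ∈ l.leaves, ∑ b ∈ r.leaves, w a b

/-- Twice the cost that the pairs of vertices in `S` have in `T`. -/
def pairCost (w : V → V → ℝ) (T : HCTree V) (S : Finset V) : ℝ :=
  ∑ a ∈ S, ∑ b ∈ S, w a b * T.joinSize a b

theorem pairCost_union {w : V → V → ℝ} (hw : ∀ a b, w a b = w b a) (T : HCTree V)
    {A B : Finset V} (h : Disjoint A B) :
    T.pairCost w (A ∪ B) = T.pairCost w A + T.pairCost w B +
      2 * ∑ a ∈ A, ∑ b ∈ B, w a b * T.joinSize a b := by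
  have e : ∑ b ∈ B, ∑ a ∈ A, w b a * (T.joinSize b a : ℝ) =
      ∑ a ∈ A, ∑ b ∈ B, w a b * T.joinSize a b := by
    rw [Finset.sum_comm]
    exact Finset.sum_congr rfl fun a _ => Finset.sum_congr rfl fun b _ => by
      rw [hw, T.joinSize_comm]
  simp only [pairCost, Finset.sum_union h, Finset.sum_add_distrib, e]
  ring

theorem pairCost_congr {w : V → V → ℝ} {T T' : HCTree V} {S : Finset V}
    (h : ∀ a ∈ S, ∀ b ∈ S, T.joinSize a b = T'.joinSize a b) :
    T.pairCost w S = T'.pairCost w S :=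
  Finset.sum_congr rfl fun a ha => Finset.sum_congr rfl fun b hb => by rw [h a ha b hb]

theorem two_mul_nodeCost {w : V → V → ℝ} (hw : ∀ a b, w a b = w b a) (hw0 : ∀ a, w a a = 0)
    {T : HCTree V} (hT : T.leafList.Nodup) : 2 * T.nodeCost w = T.pairCost w T.leaves := by
  induction T with
  | leaf v => simp [nodeCost, pairCost, hw0]
  | node l r ihl ihr =>
    obtain ⟨hl, hr, hd⟩ := nodup_node hT
    rw [leaves_node, pairCost_union hw _ hd, nodeCost,
      pairCost_congr (T' := l) fun a ha b hb => joinSize_node_left ha hb,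
      pairCost_congr (T' := r) (S := r.leaves) fun a ha b hb => joinSize_node_right hd ha hb,
      ← ihl hl, ← ihr hr]
    have : ∑ a ∈ l.leaves, ∑ b ∈ r.leaves, w a b * ((node l r).joinSize a b : ℝ) =
        (node l r).leaves.card * ∑ a ∈ l.leaves, ∑ b ∈ r.leaves, w a b := by
      rw [Finset.mul_sum]
      refine Finset.sum_congr rfl fun a ha => ?_
      rw [Finset.mul_sum]
      refine Finset.sum_congr rfl fun b hb => ?_
      rw [joinSize_node_cross hd ha hb, mul_comm]
    rw [this]
    ring

end HCTree

namespace WeightedGraph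

variable {n : ℕ} (G : WeightedGraph n)

open Classical in
theorem entry_fin (u v : Fin n) :
    G.entry u v = if G.graph.Adj u v then G.weight s(u, v) else 0 := by
  simp [entry]

theorem entry_comm (u v : Fin n) : G.entry u v = G.entry v u := by
  rw [entry_fin, entry_fin, Sym2.eq_swap]
  by_cases h : G.graph.Adj u v
  · rw [if_pos h, if_pos h.symm]
  · rw [if_neg h, if_neg fun h' => h h'.symm]

theorem entry_self (u : Fin n) : G.entry u u = 0 := by simp [entry_fin]

theorem entry_nonneg (u v : Fin n) : 0 ≤ G.entry u v := by
  rw [entry_fin]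
  split_ifs with h
  · exact G.weight_nonneg _ h
  · exact le_rfl

theorem two_mul_cost (T : HCTree (Fin n)) :
    2 * T.cost G = T.pairCost (fun u v : Fin n => G.entry u v) Finset.univ := by
  classical
  let p : Sym2 (Fin n) → ℝ := fun e =>
    if e ∈ G.graph.edgeSet then G.weight e * ((T.lca e.toFinset).leaves.card : ℝ) else 0
  have hp : ∀ a b, p s(a, b) = G.entry a b * T.joinSize a b := fun a b => by
    simp only [p, entry_fin, HCTree.joinSize, SimpleGraph.mem_edgeSet]
    have : (s(a, b)).toFinset = {a, b} := by ext; simp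
    rw [this]
    split_ifs <;> simp
  have h1 : T.cost G = ∑ e ∈ (Finset.univ : Finset (Fin n)).sym2 with ¬ e.IsDiag, p e := by
    rw [HCTree.cost]
    have : G.graph.edgeFinset =
        ((Finset.univ : Finset (Fin n)).sym2.filter fun e => ¬ e.IsDiag).filter
          (fun e => e ∈ G.graph.edgeSet) := by
      ext e
      simp only [SimpleGraph.mem_edgeFinset, Finset.mem_filter]
      constructor
      · intro h
        exact ⟨⟨by simp, G.graph.not_isDiag_of_mem_edgeSet h⟩, h⟩
      · exact fun h => h.2
    rw [Finset.sum_filter_of_ne (s := Finset.filter _ _) (p := fun e => e ∈ G.graph.edgeSet)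
      (f := p) (fun e _ he => by by_contra h; simp [p, h] at he)
        |>.symm]
    rw [← this]
    refine Finset.sum_congr (by ext; simp) fun e he => ?_
    simp only [SimpleGraph.mem_edgeFinset] at he
    simp [p, he]
  rw [h1, Finset.sum_sym2_filter_not_isDiag, HCTree.pairCost, ← Finset.sum_product',
    Finset.univ_product_univ]
  have h2 : ∑ x : Fin n × Fin n, G.entry x.1 x.2 * (T.joinSize x.1 x.2 : ℝ) =
      ∑ x ∈ (Finset.univ : Finset (Fin n)).offDiag, G.entry x.1 x.2 * (T.joinSize x.1 x.2 : ℝ) := by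
    symm
    refine Finset.sum_subset (Finset.subset_univ _) fun x _ hx => ?_
    have : x.1 = x.2 := by simpa using hx
    rw [this, entry_self, zero_mul]
  rw [h2, ← Finset.sum_filter_add_sum_filter_not Finset.univ.offDiag
    (fun x : Fin n × Fin n => x.1 < x.2)
    (fun x => G.entry x.1 x.2 * (T.joinSize x.1 x.2 : ℝ)), two_mul]
  congr 1
  · exact Finset.sum_congr rfl fun x _ => hp _ _
  · refine Finset.sum_bij (fun x _ => x.swap) ?_ ?_ ?_ ?_
    · rintro ⟨a, b⟩ h
      simp only [Finset.mem_filter, Finset.mem_offDiag, Finset.mem_univ, true_and,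
        Prod.swap] at h ⊢
      exact ⟨h.1.symm, by omega⟩
    · intro a _ b _ h; exact Prod.swap_injective h
    · rintro ⟨a, b⟩ h
      simp only [Finset.mem_filter, Finset.mem_offDiag, Finset.mem_univ, true_and] at h
      exact ⟨(b, a), by simp; omega, rfl⟩
    · rintro ⟨a, b⟩ _
      simp only [Prod.swap]
      rw [hp, G.entry_comm, T.joinSize_comm]

theorem cost_eq_nodeCost {T : HCTree (Fin n)} (hT : T.IsHC) :
    T.cost G = T.nodeCost fun u v : Fin n => G.entry u v := by
  have h := HCTree.two_mul_nodeCost (w := fun u v : Fin n => G.entry u v) G.entry_comm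
    G.entry_self hT.1
  have : T.leaves = Finset.univ := Finset.eq_univ_iff_forall.2 fun v =>
    List.mem_toFinset.2 (hT.2 v)
  rw [this, ← two_mul_cost] at h
  linarith

end WeightedGraph

/-! ### The comparison test -/

section Estimation

variable {n : ℕ} {T : HCTree (Fin n)} {O : Triplet n → Fin n}

/-- The answer on the triplet `{u, v, w}` is wrong. -/
def Misled (T : HCTree (Fin n)) (O : Triplet n → Fin n) (u v w : Fin n) : Prop :=
  ∃ h : ({u, v, w} : Finset (Fin n)).card = 3, ¬ T.SplitsAway {u, v, w} (O ⟨_, h⟩)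

open Classical in
/-- Among the triplets `{u, v, w}` with `w` in a ball around `u` of size `t ≥ m`, at most `t / 8`
are answered wrongly. -/
def Reliable (T : HCTree (Fin n)) (O : Triplet n → Fin n) (m : ℕ) : Prop :=
  ∀ u v, u ≠ v → ∀ t, m ≤ t → t ≤ 2 * n →
    8 * (Finset.univ.filter fun w => T.joinSize u w ≤ t ∧ Misled T O u v w).card ≤ t

theorem HCTree.IsHC.leaves_eq (hT : T.IsHC) : T.leaves = Finset.univ :=
  Finset.eq_univ_iff_forall.2 fun v => List.mem_toFinset.2 (hT.2 v)

theorem HCTree.IsHC.joinSize_self_le (hT : T.IsHC) (u v : Fin n) :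
    T.joinSize u u ≤ T.joinSize u v := by
  rw [HCTree.joinSize_self hT.1 (by simp [hT.leaves_eq])]
  exact T.one_le_joinSize u v

theorem HCTree.IsHC.joinSize_le_max (hT : T.IsHC) (u v w : Fin n) :
    T.joinSize u w ≤ max (T.joinSize u v) (T.joinSize v w) :=
  HCTree.joinSize_le_max hT.1 (by simp [hT.leaves_eq]) (by simp [hT.leaves_eq])
    (by simp [hT.leaves_eq])

theorem HCTree.IsHC.card_ball_le (hT : T.IsHC) (u : Fin n) {t : ℕ} (ht : 1 ≤ t) :
    (Finset.univ.filter fun w => T.joinSize u w ≤ t).card ≤ t := by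
  rw [← hT.leaves_eq]
  exact HCTree.card_joinSize_le hT.1 (by simp [hT.leaves_eq]) ht

theorem HCTree.IsHC.joinSize_le_card_ball (hT : T.IsHC) (u v : Fin n) :
    T.joinSize u v ≤ (Finset.univ.filter fun w => T.joinSize u w ≤ T.joinSize u v).card := by
  have := HCTree.joinSize_le_card hT.1 (u := u) (v := v) (by simp [hT.leaves_eq])
    (by simp [hT.leaves_eq])
  rwa [hT.leaves_eq] at this

theorem HCTree.IsHC.joinSize_le_n (hT : T.IsHC) (u v : Fin n) : T.joinSize u v ≤ n := by
  have := T.joinSize_le u v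
  rwa [hT.leaves_eq, Finset.card_univ, Fintype.card_fin] at this

theorem card_triplet {u v w : Fin n} (huv : u ≠ v) (hwu : w ≠ u) (hwv : w ≠ v) :
    ({u, v, w} : Finset (Fin n)).card = 3 :=
  Finset.card_eq_three.2 ⟨u, v, w, huv, hwu.symm, hwv.symm, rfl⟩

theorem oracleAnswer_fin {u v w : Fin n} (h : ({u, v, w} : Finset (Fin n)).card = 3) :
    oracleAnswer O u v w = O ⟨_, h⟩ := by
  simp [oracleAnswer, h]

theorem oracleAnswer_eq_of_lt (hT : T.IsHC) {u v w : Fin n} (huv : u ≠ v)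
    (hlt : T.joinSize u v < T.joinSize u w) (h : ¬ Misled T O u v w) :
    oracleAnswer O u v w = w := by
  have hwv : w ≠ v := by rintro rfl; omega
  have hwu : w ≠ u := by rintro rfl; exact absurd (hT.joinSize_self_le w v) (by omega)
  have hc := card_triplet huv hwu hwv
  have hs : T.SplitsAway {u, v, w} (O ⟨_, hc⟩) := by
    by_contra h'
    exact h ⟨hc, h'⟩
  rw [oracleAnswer_fin hc, hs.eq_of_joinSize_lt hT.1 hlt hwu.symm huv]

theorem oracleAnswer_ne_of_le (hT : T.IsHC) {u v w : Fin n} (huv : u ≠ v) (hwu : w ≠ u)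
    (hwv : w ≠ v) (hle : T.joinSize u w ≤ T.joinSize u v) (h : ¬ Misled T O u v w) :
    oracleAnswer O u v w ≠ w := by
  have hc := card_triplet huv hwu hwv
  have hs : T.SplitsAway {u, v, w} (O ⟨_, hc⟩) := by
    by_contra h'
    exact h ⟨hc, h'⟩
  rw [oracleAnswer_fin hc]
  intro e
  rw [Fin.val_injective e] at hs
  have := hs.joinSize_lt hT.1 (by simp [hT.leaves_eq]) (by simp [hT.leaves_eq])
    (by simp [hT.leaves_eq]) huv hwu.symm hwv.symm
  omega

/-- A vertex at distance exactly `σ` passes the test at scale `σ`. The constant `17` absorbs the two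
vertices `u` and `v`, for which there is no triplet. -/
theorem lt_count_of_joinSize_eq (hT : T.IsHC) {m σ : ℕ} (hR : Reliable T O m) (hm : m ≤ σ)
    (h17 : 17 ≤ σ) {u v : Fin n} (huv : u ≠ v) (hr : T.joinSize u v = σ) {h : Fin n → ℕ}
    (hh : ∀ w, w ≠ u → h w ≤ 2 * T.joinSize u w) :
    3 * σ < 4 * (Finset.univ.filter fun w : Fin n =>
      h w ≤ 2 * σ ∧ oracleAnswer O u v w ≠ w).card := by
  classical
  have h1 := hT.joinSize_le_card_ball u v
  have h2 := hR u v huv σ hm (by have := hT.joinSize_le_n u v; omega)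
  have hsub : (Finset.univ.filter fun w => T.joinSize u w ≤ T.joinSize u v) ⊆
      (Finset.univ.filter fun w : Fin n => h w ≤ 2 * σ ∧ oracleAnswer O u v w ≠ w) ∪
      (Finset.univ.filter fun w => T.joinSize u w ≤ σ ∧ Misled T O u v w) ∪ {u, v} := by
    intro w hw
    simp only [Finset.mem_filter, Finset.mem_univ, true_and, Finset.mem_union, Finset.mem_insert,
      Finset.mem_singleton] at hw ⊢
    by_cases hwu : w = u
    · exact .inr (.inl hwu)
    by_cases hwv : w = v
    · exact .inr (.inr hwv)
    by_cases hM : Misled T O u v w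
    · exact .inl (.inr ⟨hr ▸ hw, hM⟩)
    · exact .inl (.inl ⟨(hh w hwu).trans (by omega), oracleAnswer_ne_of_le hT huv hwu hwv hw hM⟩)
  have h3 := Finset.card_le_card hsub
  have h4 := Finset.card_union_le (Finset.filter (fun w : Fin n =>
    h w ≤ 2 * σ ∧ oracleAnswer O u v w ≠ w) Finset.univ ∪
      Finset.filter (fun w => T.joinSize u w ≤ σ ∧ Misled T O u v w) Finset.univ) {u, v}
  have h5 := Finset.card_union_le (Finset.filter (fun w : Fin n =>
    h w ≤ 2 * σ ∧ oracleAnswer O u v w ≠ w) Finset.univ)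
      (Finset.filter (fun w => T.joinSize u w ≤ σ ∧ Misled T O u v w) Finset.univ)
  have h6 := Finset.card_le_two (a := u) (b := v)
  omega

/-- A vertex at distance at most `σ / 2` fails the test at scale `σ`. -/
theorem count_le_of_joinSize_le (hT : T.IsHC) {m σ : ℕ} (hR : Reliable T O m) (hm : m ≤ 2 * σ)
    (hn : σ ≤ n) {u v : Fin n} (huv : u ≠ v) (hr : 2 * T.joinSize u v ≤ σ) {h : Fin n → ℕ}
    (hh : ∀ w, w ≠ u → σ < T.joinSize u w → T.joinSize u w ≤ h w) :
    4 * (Finset.univ.filter fun w : Fin n =>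
      h w ≤ 2 * σ ∧ oracleAnswer O u v w ≠ w).card ≤ 3 * σ := by
  classical
  have h1 := hT.card_ball_le u (T.one_le_joinSize u v)
  have h2 := hR u v huv (2 * σ) hm (by omega)
  have hsub : (Finset.univ.filter fun w : Fin n => h w ≤ 2 * σ ∧ oracleAnswer O u v w ≠ w) ⊆
      (Finset.univ.filter fun w => T.joinSize u w ≤ T.joinSize u v) ∪
      (Finset.univ.filter fun w => T.joinSize u w ≤ 2 * σ ∧ Misled T O u v w) := by
    intro w hw
    simp only [Finset.mem_filter, Finset.mem_univ, true_and, Finset.mem_union] at hw ⊢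
    by_contra! hcon
    obtain ⟨hlt, hM⟩ := hcon
    have hwu : w ≠ u := by rintro rfl; exact absurd (hT.joinSize_self_le w v) (by omega)
    refine hw.2 (oracleAnswer_eq_of_lt hT huv hlt (hM ?_))
    by_contra! hbig
    have := hh w hwu (by omega)
    omega
  have h3 := Finset.card_le_card hsub
  have h4 := Finset.card_union_le (Finset.filter (fun w => T.joinSize u w ≤ T.joinSize u v)
    Finset.univ) (Finset.filter (fun w => T.joinSize u w ≤ 2 * σ ∧ Misled T O u v w) Finset.univ)
  omega

end Estimation

/-! ### The oracle is reliable with high probability -/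

section Probability

variable {n : ℕ} {Ω : Type*} [MeasurableSpace Ω] {μ : Measure Ω} [IsProbabilityMeasure μ]

open Classical in
/-- Hoeffding's bound for the number of failures among independent events of probability `9/10`:
the excess over the mean `|s| / 10` that is needed is at least `t / 40`. -/
theorem measureReal_failures_le {ι : Type*} {D : ι → Set Ω} (hD : ∀ i, MeasurableSet (D i))
    (hI : iIndepSet D μ) (h9 : ∀ i, μ (D i) = 9 / 10) (s : Finset ι) {t : ℕ} (hs : s.card ≤ t) :
    μ.real {ω | t < 8 * (s.filter fun i => ω ∉ D i).card} ≤ Real.exp (-(t : ℝ) / 800) := by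
  set X : ι → Ω → ℝ := fun i => (D i).indicator fun _ => 1 with hX
  have hXm : ∀ i, Measurable (X i) := fun i => measurable_const.indicator (hD i)
  have hint : ∀ i, ∫ ω, X i ω ∂μ = 9 / 10 := fun i => by
    rw [hX]
    simp only
    rw [integral_indicator_const _ (hD i), Measure.real, h9]
    simp
  have hint' : ∀ i, ∫ ω, (1 - X i ω) ∂μ = 1 / 10 := fun i => by
    rw [integral_sub (integrable_const _) ((integrable_const (1 : ℝ)).indicator (hD i)), hint]
    norm_num
  have hind : iIndepFun (fun i ω => (1 - X i ω) - 1 / 10) μ :=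
    hI.iIndepFun_indicator.comp (fun _ x => 1 - x - 1 / 10) (fun _ => by fun_prop)
  have hsub : ∀ i ∈ s, HasSubgaussianMGF (fun ω => (1 - X i ω) - 1 / 10)
      ((‖(1 : ℝ) - 0‖₊ / 2) ^ 2) μ := fun i _ => by
    rw [← hint' i]
    refine hasSubgaussianMGF_of_mem_Icc (measurable_const.sub (hXm i)).aemeasurable ?_
    refine Filter.Eventually.of_forall fun ω => ?_
    by_cases h : ω ∈ D i <;> simp [hX, h]
  have key := HasSubgaussianMGF.measure_sum_ge_le_of_iIndepFun hind hsub
    (ε := (t : ℝ) / 40) (by positivity)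
  have hcount : ∀ ω, ∑ i ∈ s, ((1 - X i ω) - 1 / 10) =
      ((s.filter fun i => ω ∉ D i).card : ℝ) - s.card / 10 := fun ω => by
    have : ∀ i, 1 - X i ω = if ω ∉ D i then 1 else 0 := fun i => by
      by_cases h : ω ∈ D i <;> simp [hX, h]
    simp only [Finset.sum_sub_distrib, this, Finset.sum_boole, Finset.sum_const, nsmul_eq_mul]
    ring
  rcases Nat.eq_zero_or_pos s.card with h0 | hpos
  · have : {ω | t < 8 * (s.filter fun i => ω ∉ D i).card} = ∅ := by
      rw [Finset.card_eq_zero] at h0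
      ext; simp [h0]
    rw [this, measureReal_empty]
    positivity
  have hs' : (s.card : ℝ) ≤ t := by exact_mod_cast hs
  have hpos' : (0 : ℝ) < s.card := by exact_mod_cast hpos
  calc μ.real {ω | t < 8 * (s.filter fun i => ω ∉ D i).card}
      ≤ μ.real {ω | (t : ℝ) / 40 ≤ ∑ i ∈ s, ((1 - X i ω) - 1 / 10)} := by
        refine measureReal_mono fun ω hω => ?_
        rw [Set.mem_ofPred_eq] at hω ⊢
        rw [hcount]
        have : (t : ℝ) < 8 * (s.filter fun i => ω ∉ D i).card := by exact_mod_cast hω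
        linarith
    _ ≤ _ := key
    _ ≤ Real.exp (-(t : ℝ) / 800) := by
        rw [Real.exp_le_exp]
        have e : (((‖(1 : ℝ) - 0‖₊ / 2) ^ 2 : NNReal) : ℝ) = 1 / 4 := by
          push_cast; simp; norm_num
        rw [Finset.sum_const, nsmul_eq_mul]
        push_cast at e ⊢
        rw [e, div_le_div_iff₀ (by positivity) (by norm_num)]
        nlinarith

open Classical in
/-- For a fixed pair and a fixed radius. -/
theorem measureReal_misled_le {T : HCTree (Fin n)} (hT : T.IsHC) {O : Ω → Triplet n → Fin n}
    {D : Triplet n → Set Ω} (hD : ∀ X, MeasurableSet (D X)) (hI : iIndepSet D μ)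
    (h9 : ∀ X, μ (D X) = 9 / 10) (hO : ∀ X, ∀ ω ∈ D X, T.SplitsAway X.1 (O ω X))
    {u v : Fin n} {t : ℕ} (ht : 1 ≤ t) :
    μ.real {ω | t < 8 * (Finset.univ.filter fun w =>
      T.joinSize u w ≤ t ∧ Misled T (O ω) u v w).card} ≤ Real.exp (-(t : ℝ) / 800) := by
  set S : Finset (Fin n) := Finset.univ.filter fun w =>
    T.joinSize u w ≤ t ∧ ({u, v, w} : Finset (Fin n)).card = 3 with hS
  have hS3 : ∀ w ∈ S, ({u, v, w} : Finset (Fin n)).card = 3 := fun w hw =>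
    (Finset.mem_filter.1 hw).2.2
  let f : {w // w ∈ S} → Triplet n := fun w => ⟨{u, v, w.1}, hS3 _ w.2⟩
  have hf : Function.Injective f := by
    rintro ⟨w, hw⟩ ⟨w', hw'⟩ h
    have e : ({u, v, w} : Finset (Fin n)) = {u, v, w'} := congrArg Subtype.val h
    have h3 := hS3 w hw
    have hwu : w ≠ u := by
      rintro rfl
      rw [Finset.pair_comm, Finset.insert_idem] at h3
      exact absurd h3 (by have := Finset.card_le_two (a := w) (b := v); omega)
    have hwv : w ≠ v := by
      rintro rfl
      rw [Finset.pair_eq_singleton] at h3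
      exact absurd h3 (by have := Finset.card_le_two (a := u) (b := w); omega)
    have : w ∈ ({u, v, w'} : Finset (Fin n)) := e ▸ by simp
    simp only [Finset.mem_insert, hwu, hwv, Finset.mem_singleton, false_or] at this
    exact Subtype.ext this
  have hcard : (S.attach.map ⟨f, hf⟩).card ≤ t := by
    rw [Finset.card_map, Finset.card_attach]
    refine (Finset.card_le_card fun w hw => ?_).trans (hT.card_ball_le u ht)
    exact Finset.mem_filter.2 ⟨Finset.mem_univ _, (Finset.mem_filter.1 hw).2.1⟩
  refine le_trans (measureReal_mono fun ω hω => ?_)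
    (measureReal_failures_le hD hI h9 (S.attach.map ⟨f, hf⟩) hcard)
  rw [Set.mem_ofPred_eq] at hω ⊢
  refine lt_of_lt_of_le hω (Nat.mul_le_mul_left _ ?_)
  rw [Finset.filter_map, Finset.card_map]
  rw [← Finset.card_map (Function.Embedding.subtype _)]
  refine Finset.card_le_card fun w hw => ?_
  obtain ⟨hw1, h3, hM⟩ := (Finset.mem_filter.1 hw).2
  have hwS : w ∈ S := Finset.mem_filter.2 ⟨Finset.mem_univ _, hw1, h3⟩
  simp only [Finset.mem_map, Finset.mem_filter, Finset.mem_attach, true_and]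
  exact ⟨⟨w, hwS⟩, fun h => hM (hO _ ω h), rfl⟩

/-- The oracle is reliable with high probability; `m` is a large multiple of `log n`. -/
theorem one_sub_le_measureReal_reliable {T : HCTree (Fin n)} (hT : T.IsHC)
    {O : Ω → Triplet n → Fin n} (hO : IsSplittingOracle μ T O) (hn : 2 ≤ n) {c l : ℕ}
    (hl : n ≤ 2 ^ l) :
    1 - 1 / (n : ℝ) ^ c ≤ μ.real {ω | Reliable T (O ω) (800 * (c + 5) * l)} := by
  classical
  obtain ⟨-, D, hD, hI, h9, hO⟩ := hO
  set m := 800 * (c + 5) * l with hm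
  have hl1 : 1 ≤ l := by
    rcases Nat.eq_zero_or_pos l with rfl | h
    · simp at hl; omega
    · exact h
  have hm1 : 1 ≤ m := by rw [hm]; exact Nat.mul_pos (by omega) hl1
  have hn0 : (0 : ℝ) < n := by exact_mod_cast (by omega : 0 < n)
  set I : Finset ((Fin n × Fin n) × ℕ) := (Finset.univ ×ˢ (Finset.range (2 * n + 1))).filter
    fun p => m ≤ p.2 with hIdef
  set B : (Fin n × Fin n) × ℕ → Set Ω := fun p => {ω | p.2 < 8 * (Finset.univ.filter fun w =>
      T.joinSize p.1.1 w ≤ p.2 ∧ Misled T (O ω) p.1.1 p.1.2 w).card} with hB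
  have hexp : Real.exp (-(m : ℝ) / 800) ≤ 1 / (n : ℝ) ^ (c + 5) := by
    have h1 : (n : ℝ) ≤ Real.exp l := by
      calc (n : ℝ) ≤ 2 ^ l := by exact_mod_cast hl
        _ ≤ (Real.exp 1) ^ l := by
          gcongr
          have := Real.add_one_le_exp 1
          linarith
        _ = Real.exp l := by rw [← Real.exp_nat_mul, mul_one]
    have h2 : -(m : ℝ) / 800 = -(((c + 5 : ℕ) : ℝ) * l) := by
      rw [hm]; push_cast; ring
    rw [h2, Real.exp_neg, Real.exp_nat_mul, one_div]
    gcongr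
  have hbad : ∀ p ∈ I, μ.real (B p) ≤ 1 / (n : ℝ) ^ (c + 5) := fun p hp => by
    have hp2 : m ≤ p.2 := (Finset.mem_filter.1 hp).2
    refine (measureReal_misled_le hT hD hI h9 hO (hm1.trans hp2)).trans (le_trans ?_ hexp)
    rw [Real.exp_le_exp]
    have : (m : ℝ) ≤ p.2 := by exact_mod_cast hp2
    linarith
  have hcardI : (I.card : ℝ) ≤ (n : ℝ) ^ 5 := by
    have h1 : I.card ≤ n * n * (2 * n + 1) := by
      refine (Finset.card_filter_le _ _).trans ?_
      rw [Finset.card_product, Finset.card_univ, Fintype.card_prod, Fintype.card_fin,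
        Finset.card_range]
    have h2 : n * n * (2 * n + 1) ≤ n ^ 5 := by
      have : 2 * n + 1 ≤ n * n * n := by nlinarith [Nat.mul_le_mul hn hn]
      calc n * n * (2 * n + 1) ≤ n * n * (n * n * n) := Nat.mul_le_mul_left _ this
        _ = n ^ 5 := by ring
    exact_mod_cast h1.trans h2
  have hU : μ.real (⋃ p ∈ I, B p) ≤ 1 / (n : ℝ) ^ c := by
    calc μ.real (⋃ p ∈ I, B p) ≤ ∑ p ∈ I, μ.real (B p) := measureReal_biUnion_finset_le _ _
      _ ≤ I.card * (1 / (n : ℝ) ^ (c + 5)) := by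
        rw [← nsmul_eq_mul]; exact Finset.sum_le_card_nsmul _ _ _ hbad
      _ ≤ (n : ℝ) ^ 5 * (1 / (n : ℝ) ^ (c + 5)) := by gcongr
      _ = 1 / (n : ℝ) ^ c := by rw [pow_add]; field_simp
  have hcov : Set.univ ⊆ (⋃ p ∈ I, B p) ∪ {ω | Reliable T (O ω) m} := by
    intro ω _
    by_contra hcon
    rw [Set.mem_union, not_or] at hcon
    refine hcon.2 fun u v _ t ht htn => ?_
    by_contra! hlt
    refine hcon.1 (Set.mem_biUnion (x := ((u, v), t)) ?_ hlt)
    exact Finset.mem_coe.2 (Finset.mem_filter.2 ⟨Finset.mem_product.2 ⟨Finset.mem_univ _,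
      Finset.mem_range.2 (by simp only; omega)⟩, ht⟩)
  have h1 : (1 : ℝ) ≤ μ.real (⋃ p ∈ I, B p) + μ.real {ω | Reliable T (O ω) m} := by
    rw [← probReal_univ (μ := μ)]
    exact (measureReal_mono hcov).trans (measureReal_union_le _ _)
  linarith

end Probability

/-! ### Trees over a family of vertex sets -/

section Family

variable {n : ℕ}

/-- `Derivable F leaf x T`: the nodes of `T` are members of the indexed family `F`, the root has
index `x`, and indices decrease from parents to children. The mark `leaf x = v + 1` says that
`F x = {v}`, and `leaf x = 0` that `x` is to be split. -/
inductive Derivable (F : ℕ → Finset (Fin n)) (leaf : ℕ → ℕ) : ℕ → HCTree (Fin n) → Prop where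
  | leaf {x : ℕ} {v : Fin n} (h : leaf x = v + 1) (hF : F x = {v}) :
      Derivable F leaf x (.leaf v)
  | node {x y z : ℕ} {l r : HCTree (Fin n)} (h : leaf x = 0) (hy : y < x) (hz : z < x)
      (hd : Disjoint (F y) (F z)) (hF : F x = F y ∪ F z) (hl : Derivable F leaf y l)
      (hr : Derivable F leaf z r) : Derivable F leaf x (.node l r)

theorem Derivable.leaves_eq {F : ℕ → Finset (Fin n)} {leaf : ℕ → ℕ} {x : ℕ} {T : HCTree (Fin n)}
    (h : Derivable F leaf x T) : T.leaves = F x := by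
  induction h with
  | leaf h hF => simp [hF]
  | node h hy hz hd hF hl hr ihl ihr => rw [HCTree.leaves_node, ihl, ihr, hF]

/-- Derivability of a tree at `x` depends on the family only up to `x`. -/
theorem Derivable.congr {F F' : ℕ → Finset (Fin n)} {leaf leaf' : ℕ → ℕ} {x : ℕ}
    {T : HCTree (Fin n)} (h : Derivable F leaf x T) (hF : ∀ y ≤ x, F' y = F y)
    (hl : ∀ y ≤ x, leaf' y = leaf y) : Derivable F' leaf' x T := by
  induction h with
  | leaf h h' => exact .leaf (by rw [hl _ le_rfl, h]) (by rw [hF _ le_rfl, h'])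
  | @node x y z l r h hy hz hd hx _ _ ihl ihr =>
    exact .node (by rw [hl _ le_rfl, h]) hy hz (by rwa [hF _ hy.le, hF _ hz.le])
      (by rw [hF _ hy.le, hF _ hz.le, hF _ le_rfl, hx])
      (ihl (fun w hw => hF w (hw.trans hy.le)) fun w hw => hl w (hw.trans hy.le))
      (ihr (fun w hw => hF w (hw.trans hz.le)) fun w hw => hl w (hw.trans hz.le))

/-- The first `cur` members of the family are nonempty, singletons are marked, and the nonempty
proper subsets of a member come before it. -/
structure Hereditary (F : ℕ → Finset (Fin n)) (leaf : ℕ → ℕ) (cur : ℕ) : Prop where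
  nonempty : ∀ x < cur, (F x).Nonempty
  leaf_eq : ∀ x < cur, ∀ v, F x = {v} → leaf x = v + 1
  leaf_zero : ∀ x < cur, 2 ≤ (F x).card → leaf x = 0
  subsets : ∀ x < cur, ∀ S, S ⊂ F x → S.Nonempty → ∃ y < x, F y = S

/-- A tree can be restricted to any member of a hereditary family, without increasing the cost. -/
theorem Hereditary.exists_derivable {F : ℕ → Finset (Fin n)} {leaf : ℕ → ℕ} {cur : ℕ}
    (hH : Hereditary F leaf cur) {w : Fin n → Fin n → ℝ} (hw : ∀ a b, w a b = w b a)
    (hw0 : ∀ a b, 0 ≤ w a b) {T : HCTree (Fin n)} (hT : T.leafList.Nodup) {x : ℕ} (hx : x < cur)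
    (hS : F x ⊆ T.leaves) :
    ∃ T', Derivable F leaf x T' ∧ 2 * T'.nodeCost w ≤ T.pairCost w (F x) := by
  induction T generalizing x with
  | leaf v =>
    rw [HCTree.leaves_leaf] at hS
    have hF : F x = {v} := by
      rcases Finset.subset_singleton_iff.1 hS with h | h
      · exact absurd h (hH.nonempty x hx).ne_empty
      · exact h
    refine ⟨.leaf v, .leaf (hH.leaf_eq x hx v hF) hF, ?_⟩
    simp only [HCTree.nodeCost, mul_zero]
    exact Finset.sum_nonneg fun a _ => Finset.sum_nonneg fun b _ =>
      mul_nonneg (hw0 a b) (Nat.cast_nonneg _)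
  | node l r ihl ihr =>
    obtain ⟨hl, hr, hd⟩ := HCTree.nodup_node hT
    rw [HCTree.leaves_node] at hS
    by_cases h1 : F x ⊆ l.leaves
    · obtain ⟨T', h, hc⟩ := ihl hl hx h1
      refine ⟨T', h, hc.trans_eq (HCTree.pairCost_congr fun a ha b hb => ?_)⟩
      rw [HCTree.joinSize_node_left (h1 ha) (h1 hb)]
    by_cases h2 : F x ⊆ r.leaves
    · obtain ⟨T', h, hc⟩ := ihr hr hx h2
      refine ⟨T', h, hc.trans_eq (HCTree.pairCost_congr fun a ha b hb => ?_)⟩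
      rw [HCTree.joinSize_node_right hd (h2 ha) (h2 hb)]
    have hun : F x = (F x ∩ l.leaves) ∪ (F x ∩ r.leaves) := by
      rw [← Finset.inter_union_distrib_left, Finset.inter_eq_left.2 hS]
    have hdis : Disjoint (F x ∩ l.leaves) (F x ∩ r.leaves) :=
      hd.mono Finset.inter_subset_right Finset.inter_subset_right
    have hne1 : (F x ∩ l.leaves).Nonempty := by
      rw [Finset.nonempty_iff_ne_empty]
      intro h
      rw [h, Finset.empty_union] at hun
      exact h2 (hun ▸ Finset.inter_subset_right)
    have hne2 : (F x ∩ r.leaves).Nonempty := by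
      rw [Finset.nonempty_iff_ne_empty]
      intro h
      rw [h, Finset.union_empty] at hun
      exact h1 (hun ▸ Finset.inter_subset_right)
    obtain ⟨y, hy, hFy⟩ := hH.subsets x hx _ (Finset.ssubset_iff_subset_ne.2
      ⟨Finset.inter_subset_left, fun h => h1 (Finset.inter_eq_left.1 h)⟩) hne1
    obtain ⟨z, hz, hFz⟩ := hH.subsets x hx _ (Finset.ssubset_iff_subset_ne.2
      ⟨Finset.inter_subset_left, fun h => h2 (Finset.inter_eq_left.1 h)⟩) hne2
    obtain ⟨T₁, hT₁, hc₁⟩ := ihl hl (hy.trans hx) (hFy ▸ Finset.inter_subset_right)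
    obtain ⟨T₂, hT₂, hc₂⟩ := ihr hr (hz.trans hx) (hFz ▸ Finset.inter_subset_right)
    have hF : F x = F y ∪ F z := by rw [hFy, hFz, ← hun]
    have hd' : Disjoint (F y) (F z) := by rw [hFy, hFz]; exact hdis
    have hFl : F y ⊆ l.leaves := hFy ▸ Finset.inter_subset_right
    have hFr : F z ⊆ r.leaves := hFz ▸ Finset.inter_subset_right
    have hcard : 2 ≤ (F x).card := by
      rw [hF, Finset.card_union_of_disjoint hd']
      have h1 := hne1.card_pos
      have h2 := hne2.card_pos
      rw [hFy, hFz]; omega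
    refine ⟨.node T₁ T₂, .node (hH.leaf_zero x hx hcard) hy hz hd' hF hT₁ hT₂, ?_⟩
    rw [hF, HCTree.pairCost_union hw _ hd', HCTree.nodeCost, hT₁.leaves_eq, hT₂.leaves_eq,
      HCTree.leaves_node, hT₁.leaves_eq, hT₂.leaves_eq,
      HCTree.pairCost_congr (T' := l) fun a ha b hb =>
        HCTree.joinSize_node_left (hFl ha) (hFl hb),
      HCTree.pairCost_congr (T' := r) (S := F z) fun a ha b hb =>
        HCTree.joinSize_node_right hd (hFr ha) (hFr hb)]
    have hcross : ((F y ∪ F z).card : ℝ) * ∑ a ∈ F y, ∑ b ∈ F z, w a b ≤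
        ∑ a ∈ F y, ∑ b ∈ F z, w a b * ((HCTree.node l r).joinSize a b : ℝ) := by
      rw [Finset.mul_sum]
      refine Finset.sum_le_sum fun a ha => ?_
      rw [Finset.mul_sum]
      refine Finset.sum_le_sum fun b hb => ?_
      rw [HCTree.joinSize_node_cross hd (hFl ha) (hFr hb), mul_comm]
      refine mul_le_mul_of_nonneg_left ?_ (hw0 a b)
      rw [HCTree.leaves_node, ← hF]
      exact_mod_cast Finset.card_le_card hS
    linarith

/-! ### Single linkage -/

/-- The labels after the class of `u` has been merged into the class of `v`. -/
def mergeLabels (lab : Fin n → ℕ) (u v : Fin n) : Fin n → ℕ :=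
  fun w => if lab w = lab u then lab v else lab w

/-- The class of `u` with respect to a labelling. -/
def labelClass (lab : Fin n → ℕ) (u : Fin n) : Finset (Fin n) :=
  Finset.univ.filter fun w => lab w = lab u

theorem mem_labelClass {lab : Fin n → ℕ} {u w : Fin n} : w ∈ labelClass lab u ↔ lab w = lab u := by
  simp [labelClass]

theorem mergeLabels_eq {lab : Fin n → ℕ} {u v a b : Fin n} (h : lab a = lab b) :
    mergeLabels lab u v a = mergeLabels lab u v b := by simp [mergeLabels, h]

theorem mergeLabels_self {lab : Fin n → ℕ} {u v : Fin n} :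
    mergeLabels lab u v u = mergeLabels lab u v v := by
  simp [mergeLabels]

theorem mergeLabels_of_eq {lab : Fin n → ℕ} {u v : Fin n} (h : lab u = lab v) :
    mergeLabels lab u v = lab := by
  funext w
  simp only [mergeLabels]
  split_ifs with h'
  · rw [h', h]
  · rfl

theorem of_mergeLabels_eq {lab : Fin n → ℕ} {u v a b : Fin n}
    (h : mergeLabels lab u v a = mergeLabels lab u v b) :
    lab a = lab b ∨ (lab a = lab u ∧ lab b = lab v) ∨ (lab a = lab v ∧ lab b = lab u) := by
  simp only [mergeLabels] at h
  split_ifs at h <;> omega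

/-- All distances in a class stay at most `t` when two classes at distance at most `t` are
merged. -/
theorem joinSize_le_of_mergeLabels {T : HCTree (Fin n)} (hT : T.IsHC) {lab : Fin n → ℕ} {t : ℕ}
    (hlab : ∀ a b, lab a = lab b → T.joinSize a b ≤ t) {u v : Fin n} (huv : T.joinSize u v ≤ t)
    {a b : Fin n} (h : mergeLabels lab u v a = mergeLabels lab u v b) : T.joinSize a b ≤ t := by
  rcases of_mergeLabels_eq h with h | ⟨ha, hb⟩ | ⟨ha, hb⟩
  · exact hlab a b h
  · exact (hT.joinSize_le_max a u b).trans (max_le (hlab _ _ ha)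
      ((hT.joinSize_le_max u v b).trans (max_le huv (hlab _ _ hb.symm))))
  · exact (hT.joinSize_le_max a v b).trans (max_le (hlab _ _ ha)
      ((hT.joinSize_le_max v u b).trans (max_le (T.joinSize_comm u v ▸ huv) (hlab _ _ hb.symm))))

theorem card_labelClass_le {T : HCTree (Fin n)} (hT : T.IsHC) {lab : Fin n → ℕ} {t : ℕ}
    (ht : 1 ≤ t) (hlab : ∀ a b, lab a = lab b → T.joinSize a b ≤ t) (u : Fin n) :
    (labelClass lab u).card ≤ t := by
  refine (Finset.card_le_card fun w hw => ?_).trans (hT.card_ball_le u ht)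
  exact Finset.mem_filter.2 ⟨Finset.mem_univ _, hlab _ _ (mem_labelClass.1 hw).symm⟩

/-- The estimates `h` agree with the distances in `T` up to a factor `2`, down to distance `m`. -/
structure Estimates (T : HCTree (Fin n)) (m : ℕ) (h : Fin n → Fin n → ℕ) : Prop where
  le_two_mul : ∀ u v, u ≠ v → h u v ≤ 2 * T.joinSize u v
  le_of_le : ∀ u v, u ≠ v → m ≤ T.joinSize u v → T.joinSize u v ≤ h u v
  le_n : ∀ u v, h u v ≤ n

theorem Estimates.joinSize_le {T : HCTree (Fin n)} (hT : T.IsHC) {m : ℕ} {h : Fin n → Fin n → ℕ}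
    (hE : Estimates T m h) {t : ℕ} (hm : m ≤ t) (h1 : 1 ≤ m) {u v : Fin n} (huv : h u v ≤ t) :
    T.joinSize u v ≤ t := by
  by_cases he : u = v
  · subst he
    rw [HCTree.joinSize_self hT.1 (by simp [hT.leaves_eq])]
    exact h1.trans hm
  · by_contra! hlt
    have := hE.le_of_le u v he (by omega)
    omega

/-- The invariant of single linkage at threshold `t`: the classes have distances at most
`max m t`, pairs with estimate below `t` are together, and every class is the root of a derivable
tree whose cost is at most twice the cost of its pairs in the optimal tree. -/
structure Linkage (T : HCTree (Fin n)) (w : Fin n → Fin n → ℝ) (m : ℕ) (h : Fin n → Fin n → ℕ)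
    (t : ℕ) (lab : Fin n → ℕ) (F : ℕ → Finset (Fin n)) (leaf : ℕ → ℕ) (cur : ℕ) : Prop where
  joinSize_le : ∀ a b, lab a = lab b → T.joinSize a b ≤ max m t
  together : ∀ a b, h a b ≤ m ∨ h a b < t → lab a = lab b
  tree : ∀ a, ∃ x < cur, F x = labelClass lab a ∧ ∃ T', Derivable F leaf x T' ∧
    T'.nodeCost w ≤ T.pairCost w (F x)

theorem labelClass_mergeLabels {lab : Fin n → ℕ} {u v : Fin n} :
    labelClass (mergeLabels lab u v) u = labelClass lab u ∪ labelClass lab v := by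
  ext a
  simp only [mem_labelClass, mergeLabels, Finset.mem_union, if_true]
  split_ifs with h
  · simp [h]
  · simp [h]

/-- One step of single linkage: the classes of a pair with estimate `t` are merged, and the merged
class is appended to the family. Each pair that is joined by the merge has estimate at least `t`,
hence distance at least `t / 2`, and the new class has at most `t` elements. -/
theorem Linkage.step {T : HCTree (Fin n)} (hT : T.IsHC) {w : Fin n → Fin n → ℝ}
    (hw : ∀ a b, w a b = w b a) (hw0 : ∀ a b, 0 ≤ w a b) {m : ℕ} (hm : 1 ≤ m)
    {h : Fin n → Fin n → ℕ} (hE : Estimates T m h) {t : ℕ} {lab : Fin n → ℕ}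
    {F F' : ℕ → Finset (Fin n)} {leaf leaf' : ℕ → ℕ} {cur : ℕ}
    (hL : Linkage T w m h t lab F leaf cur) {u v : Fin n} (huv : h u v = t)
    (hF : ∀ x < cur, F' x = F x) (hleaf : ∀ x < cur, leaf' x = leaf x)
    (hFc : F' cur = labelClass (mergeLabels lab u v) u) (hlc : leaf' cur = 0) :
    Linkage T w m h t (mergeLabels lab u v) F' leaf' (cur + 1) := by
  have old : ∀ a, ∃ x < cur, F' x = labelClass lab a ∧ ∃ T', Derivable F' leaf' x T' ∧
      T'.nodeCost w ≤ T.pairCost w (F' x) := fun a => by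
    obtain ⟨x, hx, hFx, T', hD, hc⟩ := hL.tree a
    refine ⟨x, hx, by rw [hF x hx, hFx], T', hD.congr (fun y hy => hF y (by omega))
      (fun y hy => hleaf y (by omega)), by rwa [hF x hx]⟩
  by_cases heq : lab u = lab v
  · rw [mergeLabels_of_eq heq]
    refine ⟨hL.joinSize_le, hL.together, fun a => ?_⟩
    obtain ⟨x, hx, h'⟩ := old a
    exact ⟨x, by omega, h'⟩
  have hmt : m < t := by
    by_contra! hle
    exact heq (hL.together u v (.inl (by omega)))
  have hmax : max m t = t := max_eq_right hmt.le
  have hdiam : ∀ a b, mergeLabels lab u v a = mergeLabels lab u v b → T.joinSize a b ≤ t :=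
    fun a b hab => joinSize_le_of_mergeLabels hT (fun a b h => hmax ▸ hL.joinSize_le a b h)
      (hE.joinSize_le hT hmt.le hm huv.le) hab
  refine ⟨hmax.symm ▸ hdiam, fun a b hab => mergeLabels_eq (hL.together a b hab), fun a => ?_⟩
  by_cases ha : lab a = lab u ∨ lab a = lab v
  · obtain ⟨y, hy, hFy, T₁, hD₁, hc₁⟩ := old u
    obtain ⟨z, hz, hFz, T₂, hD₂, hc₂⟩ := old v
    have hd : Disjoint (F' y) (F' z) := by
      rw [hFy, hFz, Finset.disjoint_left]
      intro b hb hb'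
      exact heq ((mem_labelClass.1 hb).symm.trans (mem_labelClass.1 hb'))
    have hun : F' cur = F' y ∪ F' z := by rw [hFc, hFy, hFz, labelClass_mergeLabels]
    have hcard : (F' y ∪ F' z).card ≤ t := by
      rw [← hun, hFc]
      exact card_labelClass_le hT (by omega) hdiam u
    refine ⟨cur, by omega, ?_, .node T₁ T₂, .node hlc hy hz hd hun hD₁ hD₂, ?_⟩
    · rw [hFc]
      have : mergeLabels lab u v a = mergeLabels lab u v u := by
        rcases ha with ha | ha
        · exact mergeLabels_eq ha
        · rw [mergeLabels_self]; exact mergeLabels_eq ha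
      ext b; rw [mem_labelClass, mem_labelClass, this]
    · rw [hun, HCTree.pairCost_union hw _ hd, HCTree.nodeCost, HCTree.leaves_node, hD₁.leaves_eq,
        hD₂.leaves_eq]
      have hcross : ((F' y ∪ F' z).card : ℝ) * ∑ a ∈ F' y, ∑ b ∈ F' z, w a b ≤
          2 * ∑ a ∈ F' y, ∑ b ∈ F' z, w a b * (T.joinSize a b : ℝ) := by
        rw [Finset.mul_sum, Finset.mul_sum]
        refine Finset.sum_le_sum fun a ha => ?_
        rw [Finset.mul_sum, Finset.mul_sum]
        refine Finset.sum_le_sum fun b hb => ?_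
        rw [hFy, mem_labelClass] at ha
        rw [hFz, mem_labelClass] at hb
        have hne : lab a ≠ lab b := fun h => heq (ha.symm.trans (h.trans hb))
        have h1 : t ≤ h a b := by
          by_contra! hlt
          exact hne (hL.together a b (.inr hlt))
        have h2 := hE.le_two_mul a b fun h => hne (by rw [h])
        have h3 : ((F' y ∪ F' z).card : ℝ) ≤ 2 * T.joinSize a b := by
          exact_mod_cast (hcard.trans h1).trans h2
        nlinarith [mul_le_mul_of_nonneg_right h3 (hw0 a b)]
      linarith
  · push Not at ha
    obtain ⟨x, hx, hFx, h'⟩ := old a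
    refine ⟨x, by omega, ?_, h'⟩
    rw [hFx]
    ext b
    simp only [mem_labelClass, mergeLabels, if_neg ha.1]
    split_ifs with hb
    · simp only [hb]; exact ⟨fun h => absurd h.symm ha.1, fun h => absurd h.symm ha.2⟩
    · rfl

end Family

/-! ### The subsets of the classes -/

section Doubling

variable {n : ℕ}

/-- The family consists of all nonempty subsets of the label classes with elements below `k`,
without repetition; `key x` is the label of the elements of `F x`. -/
structure Subsets (lab : Fin n → ℕ) (k : ℕ) (F : ℕ → Finset (Fin n)) (leaf key : ℕ → ℕ)
    (cur : ℕ) : Prop where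
  hereditary : Hereditary F leaf cur
  label : ∀ x < cur, ∀ a ∈ F x, lab a = key x
  below : ∀ x < cur, ∀ a ∈ F x, (a : ℕ) < k
  exists_index : ∀ S : Finset (Fin n), S.Nonempty → (∀ a ∈ S, ∀ b ∈ S, lab a = lab b) →
    (∀ a ∈ S, (a : ℕ) < k) → ∃ x < cur, F x = S
  injective : ∀ x < cur, ∀ y < cur, F x = F y → x = y

theorem Subsets.zero (lab : Fin n → ℕ) (F : ℕ → Finset (Fin n)) (leaf key : ℕ → ℕ) :
    Subsets lab 0 F leaf key 0 := by
  refine ⟨⟨?_, ?_, ?_, ?_⟩, ?_, ?_, ?_, ?_⟩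
  case refine_7 =>
    rintro S ⟨a, ha⟩ _ h
    exact absurd (h a ha) (by omega)
  all_goals intro x hx; omega

theorem card_family_le {lab : Fin n → ℕ} {F : ℕ → Finset (Fin n)} {key : ℕ → ℕ} {cur m : ℕ}
    (hne : ∀ x < cur, (F x).Nonempty) (hlab : ∀ x < cur, ∀ a ∈ F x, lab a = key x)
    (hinj : ∀ x < cur, ∀ y < cur, F x = F y → x = y)
    (hm : ∀ a, (labelClass lab a).card ≤ m) : cur ≤ n * 2 ^ m := by
  have h1 : (Finset.range cur).image F ⊆
      Finset.univ.biUnion fun a => (labelClass lab a).powerset := by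
    intro S hS
    obtain ⟨x, hx, rfl⟩ := Finset.mem_image.1 hS
    rw [Finset.mem_range] at hx
    obtain ⟨a, ha⟩ := hne x hx
    refine Finset.mem_biUnion.2 ⟨a, Finset.mem_univ _, Finset.mem_powerset.2 fun b hb => ?_⟩
    rw [mem_labelClass, hlab x hx b hb, hlab x hx a ha]
  have h2 := Finset.card_le_card h1
  rw [Finset.card_image_of_injOn (fun x hx y hy h => hinj x (by simpa using hx) y
    (by simpa using hy) h), Finset.card_range] at h2
  refine h2.trans ((Finset.card_biUnion_le_card_mul _ _ (2 ^ m) fun a _ => ?_).trans ?_)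
  · rw [Finset.card_powerset]
    exact Nat.pow_le_pow_right (by norm_num) (hm a)
  · simp

theorem Subsets.cur_le {lab : Fin n → ℕ} {k : ℕ} {F : ℕ → Finset (Fin n)} {leaf key : ℕ → ℕ}
    {cur m : ℕ} (h : Subsets lab k F leaf key cur) (hm : ∀ a, (labelClass lab a).card ≤ m) :
    cur ≤ n * 2 ^ m :=
  card_family_le h.hereditary.nonempty h.label h.injective hm

/-- The situation while the sets that contain `v` are appended to the `start` sets below `v`: the
sets `F x ∪ {v}` with `x < k` of the right label have been appended, after `{v}`. -/
structure Extending (lab : Fin n → ℕ) (v : Fin n) (start k : ℕ) (F : ℕ → Finset (Fin n))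
    (leaf key : ℕ → ℕ) (cur : ℕ) : Prop where
  subsets : Subsets lab v F leaf key start
  hereditary : Hereditary F leaf cur
  label : ∀ x < cur, ∀ a ∈ F x, lab a = key x
  start_lt : start < cur
  F_start : F start = {v}
  done : ∀ x < start, x < k → key x = lab v → ∃ y < cur, F y = insert v (F x)
  source : ∀ y < cur, start < y → ∃ x < start, x < k ∧ F y = insert v (F x)

theorem Extending.notMem {lab : Fin n → ℕ} {v : Fin n} {start k : ℕ} {F : ℕ → Finset (Fin n)}
    {leaf key : ℕ → ℕ} {cur : ℕ} (h : Extending lab v start k F leaf key cur) {x : ℕ}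
    (hx : x < start) : v ∉ F x := fun hv =>
  absurd (h.subsets.below x hx v hv) (by omega)

theorem Extending.injective {lab : Fin n → ℕ} {v : Fin n} {start k : ℕ} {F : ℕ → Finset (Fin n)}
    {leaf key : ℕ → ℕ} {cur : ℕ} (h : Extending lab v start k F leaf key cur)
    (hinj : ∀ x < cur, ∀ y < cur, start < x → start < y → F x = F y → x = y) :
    ∀ x < cur, ∀ y < cur, F x = F y → x = y := by
  have mem : ∀ y < cur, start ≤ y → v ∈ F y := fun y hy hle => by
    rcases hle.eq_or_lt with rfl | hlt
    · simp [h.F_start]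
    · obtain ⟨x, -, -, e⟩ := h.source y hy hlt
      simp [e]
  have ne : ∀ y < cur, start < y → F y ≠ {v} := fun y hy hlt e => by
    obtain ⟨x, hx, -, e'⟩ := h.source y hy hlt
    obtain ⟨a, ha⟩ := h.subsets.hereditary.nonempty x hx
    have : a ∈ ({v} : Finset (Fin n)) := by rw [← e, e']; simp [ha]
    exact h.notMem hx (Finset.mem_singleton.1 this ▸ ha)
  intro x hx y hy e
  rcases lt_trichotomy x start with h1 | h1 | h1 <;> rcases lt_trichotomy y start with h2 | h2 | h2
  · exact h.subsets.injective x h1 y h2 e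
  · exact absurd (e ▸ mem y hy h2.ge) (h.notMem h1)
  · exact absurd (e ▸ mem y hy h2.le) (h.notMem h1)
  · exact absurd (e ▸ mem x hx h1.ge) (h.notMem h2)
  · exact h1.trans h2.symm
  · exact absurd (e.symm.trans (h1 ▸ h.F_start)) (ne y hy h2)
  · exact absurd (e ▸ mem x hx h1.le) (h.notMem h2)
  · exact absurd (e.trans (h2 ▸ h.F_start)) (ne x hx h1)
  · exact hinj x hx y hy h1 h2 e

/-- Appending a set all of whose nonempty proper subsets are present. -/
theorem Hereditary.append {F F' : ℕ → Finset (Fin n)} {leaf leaf' : ℕ → ℕ} {cur : ℕ}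
    (h : Hereditary F leaf cur) (hF : ∀ x < cur, F' x = F x) (hl : ∀ x < cur, leaf' x = leaf x)
    (hne : (F' cur).Nonempty) (h1 : ∀ v, F' cur = {v} → leaf' cur = v + 1)
    (h2 : 2 ≤ (F' cur).card → leaf' cur = 0)
    (hsub : ∀ S, S ⊂ F' cur → S.Nonempty → ∃ y < cur, F y = S) : Hereditary F' leaf' (cur + 1) := by
  refine ⟨fun x hx => ?_, fun x hx v hv => ?_, fun x hx hv => ?_, fun x hx S hS hSne => ?_⟩ <;>
  rcases (Nat.lt_succ_iff_lt_or_eq.1 hx) with hx | rfl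
  · rw [hF x hx]; exact h.nonempty x hx
  · exact hne
  · rw [hl x hx]; exact h.leaf_eq x hx v (hF x hx ▸ hv)
  · exact h1 v hv
  · rw [hl x hx]; exact h.leaf_zero x hx (hF x hx ▸ hv)
  · exact h2 hv
  · obtain ⟨y, hy, e⟩ := h.subsets x hx S (hF x hx ▸ hS) hSne
    exact ⟨y, hy, by rw [hF y (hy.trans hx), e]⟩
  · obtain ⟨y, hy, e⟩ := hsub S hS hSne
    exact ⟨y, hy, by rw [hF y hy, e]⟩

theorem Subsets.congr {lab : Fin n → ℕ} {k : ℕ} {F F' : ℕ → Finset (Fin n)}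
    {leaf leaf' key key' : ℕ → ℕ} {cur : ℕ} (h : Subsets lab k F leaf key cur)
    (hF : ∀ x < cur, F' x = F x) (hl : ∀ x < cur, leaf' x = leaf x)
    (hk : ∀ x < cur, key' x = key x) : Subsets lab k F' leaf' key' cur := by
  refine ⟨⟨fun x hx => ?_, fun x hx v hv => ?_, fun x hx hv => ?_, fun x hx S hS hSne => ?_⟩,
    fun x hx a ha => ?_, fun x hx a ha => ?_, fun S h1 h2 h3 => ?_, fun x hx y hy e => ?_⟩
  · rw [hF x hx]; exact h.hereditary.nonempty x hx
  · rw [hl x hx]; exact h.hereditary.leaf_eq x hx v (hF x hx ▸ hv)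
  · rw [hl x hx]; exact h.hereditary.leaf_zero x hx (hF x hx ▸ hv)
  · obtain ⟨y, hy, e⟩ := h.hereditary.subsets x hx S (hF x hx ▸ hS) hSne
    exact ⟨y, hy, by rw [hF y (hy.trans hx), e]⟩
  · rw [hk x hx]; exact h.label x hx a (hF x hx ▸ ha)
  · exact h.below x hx a (hF x hx ▸ ha)
  · obtain ⟨x, hx, e⟩ := h.exists_index S h1 h2 h3
    exact ⟨x, hx, by rw [hF x hx, e]⟩
  · exact h.injective x hx y hy (by rw [← hF x hx, ← hF y hy, e])

theorem Subsets.start {lab : Fin n → ℕ} {v : Fin n} {F F' : ℕ → Finset (Fin n)}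
    {leaf leaf' key key' : ℕ → ℕ} {cur : ℕ} (h : Subsets lab v F leaf key cur)
    (hF : ∀ x < cur, F' x = F x) (hl : ∀ x < cur, leaf' x = leaf x)
    (hk : ∀ x < cur, key' x = key x) (hFc : F' cur = {v}) (hlc : leaf' cur = v + 1)
    (hkc : key' cur = lab v) : Extending lab v cur 0 F' leaf' key' (cur + 1) := by
  refine ⟨h.congr hF hl hk, h.hereditary.append hF hl (by simp [hFc]) (fun w hw => ?_)
    (fun h2 => ?_) (fun S hS hne => ?_), fun x hx a ha => ?_, by omega, hFc,
    fun x _ hx => absurd hx (by omega), fun y hy hlt => absurd hlt (by omega)⟩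
  · rw [hFc, Finset.singleton_inj] at hw
    rw [hlc, hw]
  · rw [hFc, Finset.card_singleton] at h2; omega
  · rw [hFc, Finset.ssubset_singleton_iff] at hS
    exact absurd hS hne.ne_empty
  · rcases (Nat.lt_succ_iff_lt_or_eq.1 hx) with hx | rfl
    · rw [hk x hx]; exact h.label x hx a (hF x hx ▸ ha)
    · rw [hFc, Finset.mem_singleton] at ha
      rw [hkc, ha]

theorem Extending.skip {lab : Fin n → ℕ} {v : Fin n} {start k : ℕ} {F : ℕ → Finset (Fin n)}
    {leaf key : ℕ → ℕ} {cur : ℕ} (h : Extending lab v start k F leaf key cur)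
    (hk : ¬ (k < start ∧ key k = lab v)) : Extending lab v start (k + 1) F leaf key cur := by
  refine ⟨h.subsets, h.hereditary, h.label, h.start_lt, h.F_start, fun x hx hxk e => ?_,
    fun y hy hlt => ?_⟩
  · rcases (Nat.lt_succ_iff_lt_or_eq.1 hxk) with hxk | rfl
    · exact h.done x hx hxk e
    · exact absurd ⟨hx, e⟩ hk
  · obtain ⟨x, hx, hxk, e⟩ := h.source y hy hlt
    exact ⟨x, hx, by omega, e⟩

theorem Extending.append {lab : Fin n → ℕ} {v : Fin n} {start k : ℕ} {F F' : ℕ → Finset (Fin n)}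
    {leaf leaf' key key' : ℕ → ℕ} {cur : ℕ} (h : Extending lab v start k F leaf key cur)
    (hks : k < start) (hkv : key k = lab v) (hF : ∀ x < cur, F' x = F x)
    (hl : ∀ x < cur, leaf' x = leaf x) (hk : ∀ x < cur, key' x = key x)
    (hFc : F' cur = insert v (F k)) (hlc : leaf' cur = 0) (hkc : key' cur = lab v) :
    Extending lab v start (k + 1) F' leaf' key' (cur + 1) := by
  have hs := h.start_lt
  have hkF := h.subsets.hereditary.nonempty k hks
  have hcard : 2 ≤ (F' cur).card := by
    rw [hFc, Finset.card_insert_of_notMem (h.notMem hks)]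
    have := hkF.card_pos
    omega
  refine ⟨h.subsets.congr (fun x hx => hF x (hx.trans hs)) (fun x hx => hl x (hx.trans hs))
    (fun x hx => hk x (hx.trans hs)), h.hereditary.append hF hl (by simp [hFc]) (fun w hw => ?_)
    (fun _ => hlc) (fun S hS hne => ?_), fun x hx a ha => ?_, by omega, by rw [hF _ hs, h.F_start],
    fun x hx hxk e => ?_, fun y hy hlt => ?_⟩
  · rw [hw, Finset.card_singleton] at hcard; omega
  · rw [hFc] at hS
    by_cases hv : v ∈ S
    · by_cases hS1 : S = {v}
      · exact ⟨start, hs, by rw [h.F_start, hS1]⟩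
      have hne' : (S.erase v).Nonempty := by
        rw [Finset.nonempty_iff_ne_empty]
        intro he
        rcases Finset.erase_eq_empty_iff _ _ |>.1 he with h0 | h0
        · exact hne.ne_empty h0
        · exact hS1 h0
      have hss : S.erase v ⊂ F k := by
        refine Finset.ssubset_iff_subset_ne.2 ⟨fun a ha => ?_, fun he => ?_⟩
        · obtain ⟨h1, h2⟩ := Finset.mem_erase.1 ha
          exact (Finset.mem_insert.1 (hS.1 h2)).resolve_left h1
        · exact hS.ne (by rw [← he, Finset.insert_erase hv])
      obtain ⟨x, hx, e⟩ := h.subsets.hereditary.subsets k hks _ hss hne'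
      have hkey : key x = lab v := by
        obtain ⟨a, ha⟩ := hne'
        rw [← h.subsets.label x (hx.trans hks) a (e ▸ ha), ← hkv]
        exact h.subsets.label k hks a (hss.1 ha)
      obtain ⟨y, hy, e'⟩ := h.done x (hx.trans hks) hx hkey
      exact ⟨y, hy, by rw [e', e, Finset.insert_erase hv]⟩
    · have hsub : S ⊆ F k := fun a ha => (Finset.mem_insert.1 (hS.1 ha)).resolve_left
        fun he => hv (he ▸ ha)
      rcases eq_or_ne S (F k) with rfl | hSne
      · exact ⟨k, hks.trans hs, rfl⟩
      · obtain ⟨x, hx, e⟩ := h.subsets.hereditary.subsets k hks S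
          (Finset.ssubset_iff_subset_ne.2 ⟨hsub, hSne⟩) hne
        exact ⟨x, by omega, e⟩
  · rcases (Nat.lt_succ_iff_lt_or_eq.1 hx) with hx | rfl
    · rw [hk x hx]; exact h.label x hx a (hF x hx ▸ ha)
    · rw [hFc, Finset.mem_insert] at ha
      rw [hkc]
      rcases ha with rfl | ha
      · rfl
      · rw [h.subsets.label k hks a ha, hkv]
  · rcases (Nat.lt_succ_iff_lt_or_eq.1 hxk) with hxk | rfl
    · rw [hk x (hx.trans hs)] at e
      obtain ⟨y, hy, e'⟩ := h.done x hx hxk e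
      exact ⟨y, by omega, by rw [hF y hy, hF x (hx.trans hs), e']⟩
    · exact ⟨cur, by omega, by rw [hFc, hF x (hx.trans hs)]⟩
  · rcases (Nat.lt_succ_iff_lt_or_eq.1 hy) with hy | rfl
    · obtain ⟨x, hx, hxk, e⟩ := h.source y hy hlt
      exact ⟨x, hx, by omega, by rw [hF y hy, hF x (hx.trans hs), e]⟩
    · exact ⟨k, hks, by omega, by rw [hFc, hF k (hks.trans hs)]⟩

/-- No set is appended twice. -/
def Extending.Distinct (start cur : ℕ) (F : ℕ → Finset (Fin n)) : Prop :=
  ∀ x < cur, ∀ y < cur, start < x → start < y → F x = F y → x = y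

theorem Extending.distinct_append {lab : Fin n → ℕ} {v : Fin n} {start k : ℕ}
    {F F' : ℕ → Finset (Fin n)} {leaf key : ℕ → ℕ} {cur : ℕ}
    (h : Extending lab v start k F leaf key cur) (hd : Extending.Distinct start cur F)
    (hks : k < start) (hF : ∀ x < cur, F' x = F x) (hFc : F' cur = insert v (F k)) :
    Extending.Distinct start (cur + 1) F' := by
  have new : ∀ x < cur, start < x → F' x ≠ F' cur := fun x hx hlt e => by
    obtain ⟨y, hy, hyk, e'⟩ := h.source x hx hlt
    rw [hF x hx, hFc, e'] at e
    have e2 : F y = F k := by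
      have := congrArg (fun S => S.erase v) e
      simpa [Finset.erase_insert (h.notMem hy), Finset.erase_insert (h.notMem hks)] using this
    exact absurd (h.subsets.injective y hy k hks e2) (by omega)
  intro x hx y hy h1 h2 e
  rcases (Nat.lt_succ_iff_lt_or_eq.1 hx) with hx | rfl <;>
  rcases (Nat.lt_succ_iff_lt_or_eq.1 hy) with hy | rfl
  · exact hd x hx y hy h1 h2 (by rw [← hF x hx, ← hF y hy, e])
  · exact absurd e (new x hx h1)
  · exact absurd e.symm (new y hy h2)
  · rfl

theorem Extending.finish {lab : Fin n → ℕ} {v : Fin n} {start k : ℕ}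
    {F : ℕ → Finset (Fin n)} {leaf key : ℕ → ℕ} {cur : ℕ}
    (h : Extending lab v start k F leaf key cur) (hd : Extending.Distinct start cur F)
    (hk : start ≤ k) : Subsets lab (v + 1) F leaf key cur := by
  have hs := h.start_lt
  refine ⟨h.hereditary, h.label, fun x hx a ha => ?_, fun S hne hS hlt => ?_, h.injective hd⟩
  · rcases lt_trichotomy x start with h1 | rfl | h1
    · have := h.subsets.below x h1 a ha; omega
    · rw [h.F_start, Finset.mem_singleton] at ha; rw [ha]; omega
    · obtain ⟨y, hy, -, e⟩ := h.source x hx h1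
      rw [e, Finset.mem_insert] at ha
      rcases ha with rfl | ha
      · omega
      · have := h.subsets.below y hy a ha; omega
  · by_cases hv : v ∈ S
    · by_cases hS1 : S = {v}
      · exact ⟨start, hs, by rw [h.F_start, hS1]⟩
      have hne' : (S.erase v).Nonempty := by
        rw [Finset.nonempty_iff_ne_empty]
        intro he
        rcases Finset.erase_eq_empty_iff _ _ |>.1 he with h0 | h0
        · exact hne.ne_empty h0
        · exact hS1 h0
      obtain ⟨x, hx, e⟩ := h.subsets.exists_index (S.erase v) hne'
        (fun a ha b hb => hS a (Finset.mem_of_mem_erase ha) b (Finset.mem_of_mem_erase hb))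
        (fun a ha => by
          have h1 := hlt a (Finset.mem_of_mem_erase ha)
          have h2 : a ≠ v := (Finset.mem_erase.1 ha).1
          have h3 : (a : ℕ) ≠ v := fun h => h2 (Fin.ext h)
          omega)
      have hkey : key x = lab v := by
        obtain ⟨a, ha⟩ := hne'
        rw [← h.subsets.label x hx a (e ▸ ha)]
        exact hS a (Finset.mem_of_mem_erase ha) v hv
      obtain ⟨y, hy, e'⟩ := h.done x hx (by omega) hkey
      exact ⟨y, hy, by rw [e', e, Finset.insert_erase hv]⟩
    · obtain ⟨x, hx, e⟩ := h.subsets.exists_index S hne hS fun a ha => by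
        have h1 := hlt a ha
        have h3 : (a : ℕ) ≠ v := fun h => hv (Fin.ext h ▸ ha)
        omega
      exact ⟨x, by omega, e⟩

/-- Single linkage starts from the subsets of the classes. -/
theorem Subsets.linkage {T : HCTree (Fin n)} (hT : T.IsHC) {w : Fin n → Fin n → ℝ}
    (hw : ∀ a b, w a b = w b a) (hw0 : ∀ a b, 0 ≤ w a b) {m : ℕ} {h : Fin n → Fin n → ℕ}
    {lab : Fin n → ℕ} {F : ℕ → Finset (Fin n)} {leaf key : ℕ → ℕ} {cur : ℕ}
    (hS : Subsets lab n F leaf key cur) (h1 : ∀ a b, lab a = lab b → T.joinSize a b ≤ m)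
    (h2 : ∀ a b, h a b ≤ m → lab a = lab b) : Linkage T w m h 1 lab F leaf cur := by
  refine ⟨fun a b hab => (h1 a b hab).trans (le_max_left _ _), fun a b hab => h2 a b (by omega),
    fun a => ?_⟩
  obtain ⟨x, hx, e⟩ := hS.exists_index (labelClass lab a) ⟨a, mem_labelClass.2 rfl⟩
    (fun b hb c hc => (mem_labelClass.1 hb).trans (mem_labelClass.1 hc).symm) (fun b _ => b.2)
  obtain ⟨T', hD, hc⟩ := hS.hereditary.exists_derivable hw hw0 hT.1 hx (by simp [hT.leaves_eq])
  refine ⟨x, hx, e, T', hD, ?_⟩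
  have : 0 ≤ T.pairCost w (F x) := Finset.sum_nonneg fun a _ => Finset.sum_nonneg fun b _ =>
    mul_nonneg (hw0 a b) (Nat.cast_nonneg _)
  linarith

end Doubling

/-! ### Dynamic programming over the family -/

section DynamicProgram

variable {n : ℕ}

/-- `F x` is split into `F y` and `F z`, which come before it. -/
def IsSplit (F : ℕ → Finset (Fin n)) (x y z : ℕ) : Prop :=
  y < x ∧ z < x ∧ Disjoint (F y) (F z) ∧ F x = F y ∪ F z

/-- The cost of a split of `F x`, given the costs of the parts. -/
noncomputable def splitCost (w : Fin n → Fin n → ℝ) (F : ℕ → Finset (Fin n)) (val : ℕ → ℝ)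
    (x y z : ℕ) : ℝ :=
  val y + val z + (F x).card * ∑ a ∈ F y, ∑ b ∈ F z, w a b

/-- The entries of the table at `x`: `ok x ≠ 0` if `F x` has a tree, `val x` is the least cost of
such a tree, and `(left x, right x)` is the best split. -/
structure TableAt (w : Fin n → Fin n → ℝ) (F : ℕ → Finset (Fin n)) (leaf ok left right : ℕ → ℕ)
    (val : ℕ → ℝ) (x : ℕ) : Prop where
  of_leaf : leaf x ≠ 0 → ok x ≠ 0 ∧ val x = 0
  sound : leaf x = 0 → ok x ≠ 0 → IsSplit F x (left x) (right x) ∧ ok (left x) ≠ 0 ∧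
    ok (right x) ≠ 0 ∧ val x = splitCost w F val x (left x) (right x)
  best : leaf x = 0 → ∀ y z, IsSplit F x y z → ok y ≠ 0 → ok z ≠ 0 →
    ok x ≠ 0 ∧ val x ≤ splitCost w F val x y z

theorem TableAt.le_nodeCost {w : Fin n → Fin n → ℝ} {F : ℕ → Finset (Fin n)}
    {leaf ok left right : ℕ → ℕ} {val : ℕ → ℝ} {B : ℕ}
    (hT : ∀ x < B, TableAt w F leaf ok left right val x) {x : ℕ} (hx : x < B)
    {T : HCTree (Fin n)} (hD : Derivable F leaf x T) : ok x ≠ 0 ∧ val x ≤ T.nodeCost w := by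
  induction hD with
  | leaf h hF =>
    have := (hT _ hx).of_leaf (by omega)
    exact ⟨this.1, by rw [this.2]; simp [HCTree.nodeCost]⟩
  | @node x y z l r h hy hz hd hF hl hr ihl ihr =>
    obtain ⟨h1, h2⟩ := ihl (hy.trans hx)
    obtain ⟨h3, h4⟩ := ihr (hz.trans hx)
    obtain ⟨h5, h6⟩ := (hT x hx).best h y z ⟨hy, hz, hd, hF⟩ h1 h3
    refine ⟨h5, h6.trans ?_⟩
    rw [splitCost, HCTree.nodeCost, HCTree.leaves_node, hl.leaves_eq, hr.leaves_eq, hF]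
    linarith

/-- The tree at `x` that is stored in the arrays `leaf`, `left` and `right`. -/
inductive Represents (leaf left right : ℕ → ℕ) : ℕ → HCTree (Fin n) → Prop where
  | leaf {x : ℕ} {v : Fin n} (h : leaf x = v + 1) : Represents leaf left right x (.leaf v)
  | node {x : ℕ} {l r : HCTree (Fin n)} (h : leaf x = 0)
      (hl : Represents leaf left right (left x) l) (hr : Represents leaf left right (right x) r) :
      Represents leaf left right x (.node l r)

theorem TableAt.exists_represents {w : Fin n → Fin n → ℝ} {F : ℕ → Finset (Fin n)}
    {leaf ok left right : ℕ → ℕ} {val : ℕ → ℝ} {B : ℕ}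
    (hT : ∀ x < B, TableAt w F leaf ok left right val x)
    (hleaf : ∀ x < B, leaf x ≠ 0 → ∃ v : Fin n, leaf x = v + 1 ∧ F x = {v}) {x : ℕ} (hx : x < B)
    (hok : ok x ≠ 0) : ∃ T : HCTree (Fin n), Represents leaf left right x T ∧ T.leafList.Nodup ∧
      T.leaves = F x ∧ T.nodeCost w = val x := by
  induction x using Nat.strong_induction_on with
  | _ x ih =>
    by_cases h0 : leaf x = 0
    · obtain ⟨⟨hl, hr, hd, hF⟩, hokl, hokr, hval⟩ := (hT x hx).sound h0 hok
      obtain ⟨l, rl, nl, ll, cl⟩ := ih _ hl (hl.trans hx) hokl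
      obtain ⟨r, rr, nr, lr, cr⟩ := ih _ hr (hr.trans hx) hokr
      refine ⟨.node l r, .node h0 rl rr, ?_, ?_, ?_⟩
      · rw [HCTree.leafList, List.nodup_append]
        refine ⟨nl, nr, fun a ha b hb hab => ?_⟩
        subst hab
        rw [← ll, ← lr, Finset.disjoint_left] at hd
        exact hd (List.mem_toFinset.2 ha) (List.mem_toFinset.2 hb)
      · rw [HCTree.leaves_node, ll, lr, hF]
      · rw [HCTree.nodeCost, HCTree.leaves_node, ll, lr, cl, cr, hval, splitCost, ← hF]
    · obtain ⟨v, hv, hF⟩ := hleaf x hx h0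
      refine ⟨.leaf v, .leaf hv, by simp [HCTree.leafList], by rw [HCTree.leaves_leaf, hF], ?_⟩
      rw [((hT x hx).of_leaf h0).2, HCTree.nodeCost]

end DynamicProgram

/-! ### The memory layout -/

/-!
`reg_big` bounds the number of sets in the family and `reg_cur` is their number so far. Entry
`(x, j)` of a two-dimensional array with rows of length `n` has index `x * n + j`; as there is no
multiplication, the multiples of `n` are kept in `arr_row`. The array `arr_ans` holds the answers on
the triplets that contain the current `u`, `arr_est` the estimates of the distances, `arr_lab` the
labels of the classes, and `arr_mem` the membership table of the family. For the set with index `x`,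
`arr_leaf` holds `v + 1` if the set is known to be `{v}` and `0` otherwise, `arr_key` the label of
the class if the set was appended as a subset of a class, and `arr_ok`, `arr_left`, `arr_right` and
`warr_val` the entries of the dynamic program.
-/

notation "reg_n" => (0 : ℕ)
notation "reg_big" => (1 : ℕ)
notation "reg_m" => (2 : ℕ)
notation "reg_unit" => (3 : ℕ)
notation "reg_pow" => (4 : ℕ)
notation "reg_acc" => (5 : ℕ)
notation "reg_u" => (6 : ℕ)
notation "reg_v" => (7 : ℕ)
notation "reg_w" => (8 : ℕ)
notation "reg_i" => (9 : ℕ)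
notation "reg_x" => (10 : ℕ)
notation "reg_y" => (11 : ℕ)
notation "reg_z" => (12 : ℕ)
notation "reg_t" => (13 : ℕ)
notation "reg_scale" => (14 : ℕ)
notation "reg_cur" => (15 : ℕ)
notation "reg_start" => (16 : ℕ)
notation "reg_a" => (17 : ℕ)
notation "reg_b" => (18 : ℕ)
notation "reg_top" => (19 : ℕ)

notation "arr_row" => (0 : ℕ)
notation "arr_ans" => (1 : ℕ)
notation "arr_est" => (2 : ℕ)
notation "arr_lab" => (3 : ℕ)
notation "arr_mem" => (4 : ℕ)
notation "arr_leaf" => (5 : ℕ)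
notation "arr_key" => (6 : ℕ)
notation "arr_left" => (7 : ℕ)
notation "arr_right" => (8 : ℕ)
notation "arr_ok" => (9 : ℕ)
notation "arr_stack" => (10 : ℕ)

notation "warr_acc" => (0 : ℕ)
notation "warr_val" => (1 : ℕ)

namespace RAM

@[simp] theorem State.setVar_var (s : State) (x m y : ℕ) :
    (s.setVar x m).var y = if y = x then m else s.var y := by
  simp [State.setVar, Function.update_apply]

@[simp] theorem State.setVar_arr (s : State) (x m : ℕ) : (s.setVar x m).arr = s.arr := rfl
@[simp] theorem State.setVar_warr (s : State) (x m : ℕ) : (s.setVar x m).warr = s.warr := rfl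
@[simp] theorem State.setVar_out (s : State) (x m : ℕ) : (s.setVar x m).out = s.out := rfl

@[simp] theorem State.setArr_var (s : State) (a i m : ℕ) : (s.setArr a i m).var = s.var := rfl
@[simp] theorem State.setArr_arr (s : State) (a i m b : ℕ) :
    (s.setArr a i m).arr b = if b = a then Function.update (s.arr a) i m else s.arr b := by
  simp [State.setArr, Function.update_apply]
@[simp] theorem State.setArr_warr (s : State) (a i m : ℕ) : (s.setArr a i m).warr = s.warr := rfl
@[simp] theorem State.setArr_out (s : State) (a i m : ℕ) : (s.setArr a i m).out = s.out := rfl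

@[simp] theorem State.setWarr_var (s : State) (a i : ℕ) (r : ℝ) :
    (s.setWarr a i r).var = s.var := rfl
@[simp] theorem State.setWarr_arr (s : State) (a i : ℕ) (r : ℝ) :
    (s.setWarr a i r).arr = s.arr := rfl
@[simp] theorem State.setWarr_warr (s : State) (a i : ℕ) (r : ℝ) (b : ℕ) :
    (s.setWarr a i r).warr b = if b = a then Function.update (s.warr a) i r else s.warr b := by
  simp [State.setWarr, Function.update_apply]

@[simp] theorem State.write_var (s : State) (m : ℕ) : (s.write m).var = s.var := rfl
@[simp] theorem State.write_arr (s : State) (m : ℕ) : (s.write m).arr = s.arr := rfl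
@[simp] theorem State.write_out (s : State) (m : ℕ) : (s.write m).out = s.out ++ [m] := rfl

/-- The index of the entry in row `r` and column `j` of a two-dimensional array; `r` and `j` are
registers, and `arr_row` holds the multiples of `n`. -/
def AExpr.idx (r j : ℕ) : AExpr := .add (.load arr_row (.var r)) (.var j)

@[simp] theorem AExpr.eval_idx (s : State) (r j : ℕ) :
    (AExpr.idx r j).eval s = s.arr arr_row (s.var r) + s.var j := rfl

/-- Equality of integers. -/
def Test.eq (e f : AExpr) : Test := .conj (.neg (.lt e f)) (.neg (.lt f e))

@[simp] theorem Test.holds_eq (E : Env) (s : State) (e f : AExpr) :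
    (Test.eq e f).Holds E s ↔ e.eval s = f.eval s := by
  simp only [Test.eq, Test.Holds]
  omega

attribute [simp] AExpr.eval Test.Holds WExpr.eval

namespace Prog

/-! ### Sizes -/

/-- Computes `2 ^ l ≥ n` and `m = l * unit`. -/
def logProg : Prog :=
  .seq (.assign reg_pow (.lit 1))
    (.forTo reg_u reg_n
      (.ite (.lt (.var reg_pow) (.var reg_n))
        (.seq (.assign reg_pow (.add (.var reg_pow) (.var reg_pow)))
          (.assign reg_m (.add (.var reg_m) (.var reg_unit))))
        .skip))

theorem run_logProg (E : Env) (s : State) (hm : s.var reg_m = 0) (hn : 1 ≤ s.var reg_n) :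
    ∃ l, ((logProg.run E s).var reg_m = s.var reg_unit * l) ∧ s.var reg_n ≤ 2 ^ l ∧
      2 ^ l ≤ 2 * s.var reg_n := by
  rw [logProg, run]
  obtain ⟨s', h1, hF, l, h2, h3, h4, h5⟩ := run_forTo (E := E)
    (s := (Prog.assign reg_pow (.lit 1)).run E s) (i := reg_u) (b := reg_n)
    (P := (.ite (.lt (.var reg_pow) (.var reg_n))
        (.seq (.assign reg_pow (.add (.var reg_pow) (.var reg_pow)))
          (.assign reg_m (.add (.var reg_m) (.var reg_unit))))
        .skip))
    (fun k s' => ∃ l, s'.var reg_pow = 2 ^ l ∧ s'.var reg_m = s.var reg_unit * l ∧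
      2 ^ l ≤ 2 * s.var reg_n ∧ (s.var reg_n ≤ 2 ^ l ∨ l = k))
    ⟨0, by simp [run], by simp [run, hm], by simp; omega, .inr rfl⟩
    (by
      rintro k s' hk hF ⟨l, h2, h3, h4, h5⟩
      have hn' : s'.var reg_n = s.var reg_n := (hF.var reg_n (by decide)).trans (by simp [run])
      have hu : s'.var reg_unit = s.var reg_unit :=
        (hF.var reg_unit (by decide)).trans (by simp [run])
      by_cases hlt : 2 ^ l < s.var reg_n
      · refine ⟨l + 1, ?_, ?_, ?_, ?_⟩
        · simp [run, h2, hn', hlt]; ring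
        · simp [run, h2, hn', hlt, h3, hu]; ring
        · rw [pow_succ]; omega
        · right; omega
      · refine ⟨l, ?_, ?_, h4, .inl (by omega)⟩
        · simp [run, h2, hn', hlt]
        · simp [run, h2, hn', hlt, h3])
  rw [h1]
  refine ⟨l, by simp [h3], ?_, h4⟩
  rcases h5 with h5 | h5
  · exact h5
  · rw [h5]
    simp only [run, State.setVar_var]
    exact Nat.lt_two_pow_self.le

/-- Computes `2 ^ m`. -/
def powProg : Prog :=
  .seq (.assign reg_acc (.lit 1))
    (.forTo reg_u reg_m (.assign reg_acc (.add (.var reg_acc) (.var reg_acc))))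

theorem run_powProg (E : Env) (s : State) :
    (powProg.run E s).var reg_acc = 2 ^ s.var reg_m := by
  rw [powProg, run]
  obtain ⟨s', h1, hF, h2⟩ := run_forTo (E := E)
    (s := (Prog.assign reg_acc (.lit 1)).run E s) (i := reg_u) (b := reg_m)
    (P := (.assign reg_acc (.add (.var reg_acc) (.var reg_acc))))
    (fun k s' => s'.var reg_acc = 2 ^ k) (by simp [run])
    (by
      intro k s' hk hF h
      simp [run, h, pow_succ]
      ring)
  rw [h1]
  simpa [run] using h2

/-- Computes a bound for the size of the family of sets. -/
def bigProg : Prog :=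
  .seq (.assign reg_big (.lit 2))
    (.forTo reg_u reg_n (.forTo reg_v reg_n
      (.assign reg_big (.add (.var reg_big) (.add (.var reg_acc) (.var reg_n))))))

theorem run_bigProg (E : Env) (s : State) :
    (bigProg.run E s).var reg_big =
      2 + s.var reg_n * (s.var reg_n * (s.var reg_acc + s.var reg_n)) := by
  rw [bigProg, run]
  obtain ⟨s', h1, hF, h2⟩ := run_forTo (E := E)
    (s := (Prog.assign reg_big (.lit 2)).run E s) (i := reg_u) (b := reg_n)
    (P := .forTo reg_v reg_n
      (.assign reg_big (.add (.var reg_big) (.add (.var reg_acc) (.var reg_n)))))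
    (fun k s' => s'.var reg_big = 2 + k * (s.var reg_n * (s.var reg_acc + s.var reg_n)))
    (by simp [run])
    (by
      intro k s' hk hF h
      have hn' : s'.var reg_n = s.var reg_n := (hF.var reg_n (by decide)).trans (by simp [run])
      have ha : s'.var reg_acc = s.var reg_acc := (hF.var reg_acc (by decide)).trans (by simp [run])
      obtain ⟨s₁, h1, hF₁, h2⟩ := run_forTo (E := E) (s := s'.setVar reg_u k) (i := reg_v)
        (b := reg_n) (P := (.assign reg_big (.add (.var reg_big) (.add (.var reg_acc) (.var reg_n)))))
        (fun k' s₁ => s₁.var reg_big = 2 + k * (s.var reg_n * (s.var reg_acc + s.var reg_n)) +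
          k' * (s.var reg_acc + s.var reg_n)) (by simpa using h)
        (by
          intro k' s₁ hk' hF₁ h
          have hn₁ : s₁.var reg_n = s.var reg_n := (hF₁.var reg_n (by decide)).trans (by simpa)
          have ha₁ : s₁.var reg_acc = s.var reg_acc := (hF₁.var reg_acc (by decide)).trans (by simpa)
          simp [run, h, hn₁, ha₁]
          ring)
      rw [h1]
      simp [h2, hn']
      ring)
  rw [h1]
  simpa [run] using h2

/-- Computes the multiples of `n`. -/
def rowProg : Prog :=
  .seq (.assign reg_acc (.lit 0))
    (.forTo reg_u reg_big
      (.seq (.store arr_row (.var reg_u) (.var reg_acc))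
        (.assign reg_acc (.add (.var reg_acc) (.var reg_n)))))

theorem run_rowProg (E : Env) (s : State) {x : ℕ} (hx : x < s.var reg_big) :
    (rowProg.run E s).arr arr_row x = x * s.var reg_n := by
  rw [rowProg, run]
  obtain ⟨s', h1, hF, h2⟩ := run_forTo (E := E)
    (s := (Prog.assign reg_acc (.lit 0)).run E s) (i := reg_u) (b := reg_big)
    (P := (.seq (.store arr_row (.var reg_u) (.var reg_acc))
        (.assign reg_acc (.add (.var reg_acc) (.var reg_n)))))
    (fun k s' => s'.var reg_acc = k * s.var reg_n ∧
      ∀ x < k, s'.arr arr_row x = x * s.var reg_n) (by simp [run])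
    (by
      rintro k s' hk hF ⟨h, h'⟩
      have hn' : s'.var reg_n = s.var reg_n := (hF.var reg_n (by decide)).trans (by simp [run])
      refine ⟨by simp [run, h, hn']; ring, fun x hx => ?_⟩
      rcases (Nat.lt_succ_iff_lt_or_eq.1 hx) with hx | rfl
      · simp [run, hx.ne, h' x hx]
      · simp [run, h])
  rw [h1]
  exact h2.2 x (by simpa [run] using hx)

end Prog
end RAM

/-! ### Estimating the distances -/

section Scan

variable {n : ℕ} {T : HCTree (Fin n)} {O : Triplet n → Fin n}

/-- The estimates `h` of the distances from `u` while the scales are scanned downwards: the scales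
above `σ` are finished, and at scale `σ` the vertices below `k` have been tested. -/
structure Scanned (T : HCTree (Fin n)) (m : ℕ) (u : Fin n) (σ k : ℕ) (h : Fin n → ℕ) : Prop where
  le_two_mul : ∀ w, w ≠ u → h w ≤ 2 * T.joinSize u w
  le : ∀ w, w ≠ u → m ≤ T.joinSize u w →
    σ < T.joinSize u w ∨ σ = T.joinSize u w ∧ (w : ℕ) < k → T.joinSize u w ≤ h w
  le_n : ∀ w, h w ≤ n
  zero_or : ∀ w, h w = 0 ∨ σ ≤ h w

theorem Scanned.start (hT : T.IsHC) (m : ℕ) (u : Fin n) : Scanned T m u n 0 fun _ => 0 :=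
  ⟨fun _ _ => Nat.zero_le _, fun w _ _ h => by have := hT.joinSize_le_n u w; omega,
    fun _ => Nat.zero_le _, fun _ => .inl rfl⟩

theorem Scanned.next {m : ℕ} {u : Fin n} {σ : ℕ} {h : Fin n → ℕ} (hS : Scanned T m u σ n h) :
    Scanned T m u (σ - 1) 0 h :=
  ⟨hS.le_two_mul, fun w hw hm hlt => hS.le w hw hm (by have := w.2; omega), hS.le_n, fun w => by
    have := hS.zero_or w; omega⟩

theorem Scanned.skip {m : ℕ} {u : Fin n} {σ : ℕ} {h : Fin n → ℕ} (hS : Scanned T m u σ 0 h)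
    (hσ : σ < m) : Scanned T m u (σ - 1) 0 h :=
  ⟨hS.le_two_mul, fun w hw hm hlt => hS.le w hw hm (by omega), hS.le_n, fun w => by
    have := hS.zero_or w; omega⟩

/-- One test, which compares the number of vertices that seem to be at most as far from `u` as `v`
with `3 / 4` of the scale. -/
theorem Scanned.test (hT : T.IsHC) {m : ℕ} (hm : 17 ≤ m) (hR : Reliable T O m) {u v : Fin n}
    {σ : ℕ} (hmσ : m ≤ σ) (hσ : σ ≤ n) {h : Fin n → ℕ} (hS : Scanned T m u σ v h) :
    Scanned T m u σ (v + 1) (if h v = 0 ∧ 3 * σ < 4 * (Finset.univ.filter fun w : Fin n =>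
      h w ≤ 2 * σ ∧ oracleAnswer O u v w ≠ w).card then Function.update h v σ else h) := by
  have lo : u ≠ v → T.joinSize u v = σ → _ := fun huv hr =>
    lt_count_of_joinSize_eq hT hR hmσ (hm.trans hmσ) huv hr hS.le_two_mul
  have hi : u ≠ v → 2 * T.joinSize u v ≤ σ → _ := fun huv hr =>
    count_le_of_joinSize_le hT hR (by omega) hσ huv hr (h := h)
      fun w hw hlt => hS.le w hw (by omega) (.inl hlt)
  split_ifs with hc
  · refine ⟨fun w hw => ?_, fun w hw hmr hlt => ?_, fun w => ?_, fun w => ?_⟩ <;>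
    by_cases hwv : w = v
    · subst hwv
      rw [Function.update_self]
      by_contra! hcon
      have := hi hw.symm (by omega)
      omega
    · rw [Function.update_of_ne hwv]; exact hS.le_two_mul w hw
    · subst hwv
      rw [Function.update_self]
      rcases hlt with hlt | hlt
      · have := hS.le w hw hmr (.inl hlt)
        omega
      · omega
    · rw [Function.update_of_ne hwv]
      refine hS.le w hw hmr ?_
      have : (w : ℕ) ≠ v := fun h => hwv (Fin.ext h)
      omega
    · subst hwv; rw [Function.update_self]; exact hσ
    · rw [Function.update_of_ne hwv]; exact hS.le_n w
    · subst hwv; rw [Function.update_self]; exact .inr le_rfl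
    · rw [Function.update_of_ne hwv]; exact hS.zero_or w
  · refine ⟨hS.le_two_mul, fun w hw hmr hlt => ?_, hS.le_n, hS.zero_or⟩
    by_cases hwv : w = v
    · subst hwv
      rcases hlt with hlt | ⟨hlt, -⟩
      · exact hS.le w hw hmr (.inl hlt)
      · rcases hS.zero_or w with h0 | h0
        · exact absurd ⟨h0, lo hw.symm hlt.symm⟩ hc
        · omega
    · refine hS.le w hw hmr ?_
      have : (w : ℕ) ≠ v := fun h => hwv (Fin.ext h)
      omega

end Scan

namespace RAM

/-- The sizes are in their registers, and `arr_row` holds the multiples of `n`. -/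
structure Sized (n m B : ℕ) (s : State) : Prop where
  n_eq : s.var reg_n = n
  big_eq : s.var reg_big = B
  m_eq : s.var reg_m = m
  row : ∀ x < B, s.arr arr_row x = x * n

theorem row_inj {n u v u' v' : ℕ} (hv : v < n) (hv' : v' < n) (h : u * n + v = u' * n + v') :
    u = u' ∧ v = v' := by
  have h1 : (u * n + v) / n = u := by
    rw [Nat.add_comm, Nat.add_mul_div_right _ _ (by omega), Nat.div_eq_of_lt hv, Nat.zero_add]
  have h2 : (u' * n + v') / n = u' := by
    rw [Nat.add_comm, Nat.add_mul_div_right _ _ (by omega), Nat.div_eq_of_lt hv', Nat.zero_add]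
  have : u = u' := by rw [← h1, ← h2, h]
  subst this
  exact ⟨rfl, by omega⟩

namespace Prog

theorem Frame.sized {P : Prog} {s s' : State} (hF : P.Frame s s')
    (h0 : reg_n ∉ P.regs ∧ reg_big ∉ P.regs ∧ reg_m ∉ P.regs ∧ arr_row ∉ P.arrs) {n m B : ℕ}
    (h : Sized n m B s) : Sized n m B s' :=
  ⟨(hF.var _ h0.1).trans h.n_eq, (hF.var _ h0.2.1).trans h.big_eq, (hF.var _ h0.2.2.1).trans h.m_eq,
    fun x hx => by rw [hF.arr _ h0.2.2.2]; exact h.row x hx⟩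

theorem _root_.RAM.Sized.setVar {n m B : ℕ} {s : State} (h : Sized n m B s) {x : ℕ} (hx : 2 < x)
    (k : ℕ) : Sized n m B (s.setVar x k) :=
  ⟨by rw [State.setVar_var, if_neg (by omega), h.n_eq],
    by rw [State.setVar_var, if_neg (by omega), h.big_eq],
    by rw [State.setVar_var, if_neg (by omega), h.m_eq], h.row⟩

/-- Queries all triplets that contain `u`. -/
def askProg : Prog :=
  .forTo reg_v reg_n (.forTo reg_w reg_n
    (.seq (.query reg_t (.var reg_u) (.var reg_v) (.var reg_w))
      (.store arr_ans (.idx reg_v reg_w) (.var reg_t))))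

theorem run_askProg (E : Env) {n m B : ℕ} (hB : n ≤ B) {s : State} (hs : Sized n m B s) {v w : ℕ}
    (hv : v < n) (hw : w < n) :
    (askProg.run E s).arr arr_ans (v * n + w) = E.ans (s.var reg_u) v w := by
  rw [askProg]
  obtain ⟨s', h1, hF, h2⟩ := run_forTo (E := E) (s := s) (i := reg_v) (b := reg_n)
    (P := .forTo reg_w reg_n
    (.seq (.query reg_t (.var reg_u) (.var reg_v) (.var reg_w))
      (.store arr_ans (.idx reg_v reg_w) (.var reg_t))))
    (fun k s' => ∀ v < k, ∀ w < n, s'.arr arr_ans (v * n + w) = E.ans (s.var reg_u) v w)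
    (by simp) (by
      intro k s' hk hF ih
      rw [hs.n_eq] at hk
      have hu : s'.var reg_u = s.var reg_u := hF.var _ (by decide)
      have hs' := (hF.sized (by decide) hs).setVar (x := reg_v) (by decide) k
      obtain ⟨s₁, h1, hF₁, h2⟩ := run_forTo (E := E) (s := s'.setVar reg_v k) (i := reg_w)
        (b := reg_n)
        (P := (.seq (.query reg_t (.var reg_u) (.var reg_v) (.var reg_w))
          (.store arr_ans (.idx reg_v reg_w) (.var reg_t))))
        (fun k' s₁ => (∀ v < k, ∀ w < n, s₁.arr arr_ans (v * n + w) = E.ans (s.var reg_u) v w) ∧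
          ∀ w < k', s₁.arr arr_ans (k * n + w) = E.ans (s.var reg_u) k w)
        ⟨ih, by simp⟩
        (by
          rintro k' s₁ hk' hF₁ ⟨ih1, ih2⟩
          rw [hs'.n_eq] at hk'
          have hs₁ := hF₁.sized (by decide) hs'
          have hu₁ : s₁.var reg_u = s.var reg_u := (hF₁.var _ (by decide)).trans (by simpa using hu)
          have hv₁ : s₁.var reg_v = k := (hF₁.var _ (by decide)).trans (by simp)
          refine ⟨fun v hv w hw => ?_, fun w hw => ?_⟩
          · have : v * n + w ≠ k * n + k' := fun h => by have := row_inj hw hk' h; omega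
            simp [run, hv₁, hs₁.row k (by omega), this, ih1 v hv w hw]
          · rcases (Nat.lt_succ_iff_lt_or_eq.1 hw) with hw | rfl
            · simp [run, hv₁, hs₁.row k (by omega), hw.ne, ih2 w hw]
            · simp [run, hv₁, hs₁.row k (by omega), hu₁])
      rw [h1]
      rw [hs'.n_eq] at h2
      intro v hv w hw
      rcases (Nat.lt_succ_iff_lt_or_eq.1 hv) with hv | rfl
      · exact h2.1 v hv w hw
      · exact h2.2 w hw)
  rw [h1]
  exact h2 v (hs.n_eq.symm ▸ hv) w hw

/-- Counts the vertices `w` in the current ball around `u` that seem to be at most as far from `u`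
as `v`. -/
def countProg : Prog :=
  .seq (.assign reg_acc (.lit 0))
    (.forTo reg_w reg_n
      (.ite (.conj
          (.neg (.lt (.add (.var reg_scale) (.var reg_scale)) (.load arr_est (.idx reg_u reg_w))))
          (.neg (.eq (.load arr_ans (.idx reg_v reg_w)) (.var reg_w))))
        (.assign reg_acc (.add (.var reg_acc) (.lit 1)))
        .skip))

theorem run_countProg (E : Env) {n m B : ℕ} (hB : n ≤ B) {s : State} (hs : Sized n m B s)
    (hu : s.var reg_u < n) (hv : s.var reg_v < n) :
    (countProg.run E s).var reg_acc = (Finset.univ.filter fun w : Fin n =>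
      s.arr arr_est (s.var reg_u * n + w) ≤ 2 * s.var reg_scale ∧
        s.arr arr_ans (s.var reg_v * n + w) ≠ w).card := by
  rw [countProg, run]
  obtain ⟨s', h1, hF, h2⟩ := run_forTo (E := E)
    (s := (Prog.assign reg_acc (.lit 0)).run E s) (i := reg_w) (b := reg_n)
    (P := (.ite (.conj
          (.neg (.lt (.add (.var reg_scale) (.var reg_scale)) (.load arr_est (.idx reg_u reg_w))))
          (.neg (.eq (.load arr_ans (.idx reg_v reg_w)) (.var reg_w))))
        (.assign reg_acc (.add (.var reg_acc) (.lit 1)))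
        .skip))
    (fun k s' => s'.var reg_acc = ∑ w ∈ Finset.range k,
      if s.arr arr_est (s.var reg_u * n + w) ≤ 2 * s.var reg_scale ∧
        s.arr arr_ans (s.var reg_v * n + w) ≠ w then 1 else 0) (by simp [run])
    (by
      intro k s' hk hF h
      have hu' : s'.var reg_u = s.var reg_u := (hF.var _ (by decide)).trans (by simp [run])
      have hv' : s'.var reg_v = s.var reg_v := (hF.var _ (by decide)).trans (by simp [run])
      have hσ' : s'.var reg_scale = s.var reg_scale := (hF.var _ (by decide)).trans (by simp [run])
      have ha' : s'.arr arr_ans = s.arr arr_ans := (hF.arr _ (by decide)).trans (by simp [run])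
      have he' : s'.arr arr_est = s.arr arr_est := (hF.arr _ (by decide)).trans (by simp [run])
      have hr' : s'.arr arr_row = s.arr arr_row := (hF.arr _ (by decide)).trans (by simp [run])
      rw [Finset.sum_range_succ, ← h]
      simp only [run, Test.Holds, AExpr.eval, Test.holds_eq, AExpr.eval_idx, State.setVar_var,
        State.setVar_arr, hu', hv', hσ', ha', he', hr', not_lt, two_mul]
      simp only [show ((7 : ℕ) = 8) = False by simp, show ((6 : ℕ) = 8) = False by simp,
        show ((14 : ℕ) = 8) = False by simp, show ((5 : ℕ) = 8) = False by simp, if_true, if_false,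
        hs.row _ (hu.trans_le hB), hs.row _ (hv.trans_le hB)]
      split_ifs <;> simp)
  rw [h1, Finset.card_filter, ← Finset.sum_range (fun w =>
    if s.arr arr_est (s.var reg_u * n + w) ≤ 2 * s.var reg_scale ∧
        s.arr arr_ans (s.var reg_v * n + w) ≠ w then 1 else 0)]
  simpa [run, hs.n_eq] using h2

/-- Tests the vertex `v` at the current scale. -/
def testProg : Prog :=
  .seq countProg
    (.ite (.conj (.eq (.load arr_est (.idx reg_u reg_v)) (.lit 0))
        (.lt (.add (.var reg_scale) (.add (.var reg_scale) (.var reg_scale)))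
          (.add (.add (.var reg_acc) (.var reg_acc)) (.add (.var reg_acc) (.var reg_acc)))))
      (.store arr_est (.idx reg_u reg_v) (.var reg_scale))
      .skip)

open Classical in
theorem run_testProg (E : Env) {n m B : ℕ} (hB : n ≤ B) {s : State} (hs : Sized n m B s)
    (hu : s.var reg_u < n) (hv : s.var reg_v < n) :
    (testProg.run E s).arr arr_est =
      if s.arr arr_est (s.var reg_u * n + s.var reg_v) = 0 ∧ 3 * s.var reg_scale <
        4 * (Finset.univ.filter fun w : Fin n =>
          s.arr arr_est (s.var reg_u * n + w) ≤ 2 * s.var reg_scale ∧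
            s.arr arr_ans (s.var reg_v * n + w) ≠ w).card
      then Function.update (s.arr arr_est) (s.var reg_u * n + s.var reg_v) (s.var reg_scale)
      else s.arr arr_est := by
  rw [testProg, run]
  have hc := run_countProg E hB hs hu hv
  have hF := frame_run E countProg s
  generalize countProg.run E s = s' at hc hF
  have hu' : s'.var reg_u = s.var reg_u := hF.var _ (by decide)
  have hv' : s'.var reg_v = s.var reg_v := hF.var _ (by decide)
  have hσ' : s'.var reg_scale = s.var reg_scale := hF.var _ (by decide)
  have he' : s'.arr arr_est = s.arr arr_est := hF.arr _ (by decide)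
  have hr' : s'.arr arr_row = s.arr arr_row := hF.arr _ (by decide)
  generalize Finset.card _ = c at hc ⊢
  simp only [run, Test.Holds, AExpr.eval, Test.holds_eq, AExpr.eval_idx, hu', hv', hσ', he', hr',
    hs.row _ (hu.trans_le hB), hc]
  by_cases h : s.arr arr_est (s.var reg_u * n + s.var reg_v) = 0 ∧ 3 * s.var reg_scale < 4 * c
  · rw [if_pos h, if_pos (by omega)]
    simp [he']
  · rw [if_neg h, if_neg (by omega), he']

end Prog
end RAM

namespace RAM
namespace Prog

theorem update_row {n u : ℕ} (f : ℕ → ℕ) (v : Fin n) (σ : ℕ) :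
    (fun w : Fin n => Function.update f (u * n + v) σ (u * n + w)) =
      Function.update (fun w : Fin n => f (u * n + w)) v σ := by
  funext w
  by_cases h : w = v
  · subst h; simp
  · have : u * n + (w : ℕ) ≠ u * n + v := fun e => h (Fin.ext (by omega))
    rw [Function.update_of_ne h, Function.update_of_ne this]

/-- Scans the scales from `n` down to `m` and tests all vertices at each of them. -/
def scanProg : Prog :=
  .forTo reg_i reg_n
    (.seq (.assign reg_scale (.sub (.var reg_n) (.var reg_i)))
      (.ite (.neg (.lt (.var reg_scale) (.var reg_m))) (.forTo reg_v reg_n testProg) .skip))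

theorem run_scanProg {n m B : ℕ} {T : HCTree (Fin n)} (hT : T.IsHC) {O : Triplet n → Fin n}
    (hm : 17 ≤ m) (hR : Reliable T O m) (E : Env) (hB : n ≤ B) {s : State} (hs : Sized n m B s)
    (u : Fin n) (hu : s.var reg_u = u)
    (hans : ∀ v w : Fin n, s.arr arr_ans (v * n + w) = oracleAnswer O u v w)
    (h0 : ∀ w : Fin n, s.arr arr_est (u * n + w) = 0) :
    Scanned T m u 0 0 (fun w => (scanProg.run E s).arr arr_est (u * n + w)) ∧
      ∀ x, (∀ w : Fin n, x ≠ u * n + w) →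
        (scanProg.run E s).arr arr_est x = s.arr arr_est x := by
  rw [scanProg]
  obtain ⟨s', h1, hF, h2⟩ := run_forTo (E := E) (s := s) (i := reg_i) (b := reg_n)
    (P := (.seq (.assign reg_scale (.sub (.var reg_n) (.var reg_i)))
      (.ite (.neg (.lt (.var reg_scale) (.var reg_m))) (.forTo reg_v reg_n testProg) .skip)))
    (fun k s' => Scanned T m u (n - k) 0 (fun w => s'.arr arr_est (u * n + w)) ∧
      ∀ x, (∀ w : Fin n, x ≠ u * n + w) → s'.arr arr_est x = s.arr arr_est x)
    ⟨by simpa only [h0, Nat.sub_zero] using Scanned.start hT m u, fun _ _ => rfl⟩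
    (by
      rintro k s' hk hF ⟨ih, ih'⟩
      rw [hs.n_eq] at hk
      rw [run]
      have hs' := hF.sized (by decide) hs
      have hs₁ : Sized n m B ((Prog.assign reg_scale (.sub (.var reg_n) (.var reg_i))).run E
          (s'.setVar reg_i k)) :=
        (hs'.setVar (x := reg_i) (by decide) k).setVar (x := reg_scale) (by decide) _
      have hσ : ((Prog.assign reg_scale (.sub (.var reg_n) (.var reg_i))).run E
          (s'.setVar reg_i k)).var reg_scale = n - k := by simp [run, hs'.n_eq]
      have hu₁ : ((Prog.assign reg_scale (.sub (.var reg_n) (.var reg_i))).run E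
          (s'.setVar reg_i k)).var reg_u = u := by
        simpa [run, hu] using hF.var reg_u (by decide)
      have he₁ : ((Prog.assign reg_scale (.sub (.var reg_n) (.var reg_i))).run E
          (s'.setVar reg_i k)).arr arr_est = s'.arr arr_est := rfl
      have ha₁ : ((Prog.assign reg_scale (.sub (.var reg_n) (.var reg_i))).run E
          (s'.setVar reg_i k)).arr arr_ans = s.arr arr_ans := hF.arr _ (by decide)
      generalize (Prog.assign reg_scale (.sub (.var reg_n) (.var reg_i))).run E
          (s'.setVar reg_i k) = s₁ at hs₁ hσ hu₁ he₁ ha₁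
      have hnk : n - (k + 1) = n - k - 1 := by omega
      rw [run]
      by_cases hlt : n - k < m
      · rw [if_neg (by simpa [hσ, hs₁.m_eq] using hlt), run, hnk, he₁]
        exact ⟨ih.skip hlt, ih'⟩
      · rw [if_pos (by simpa [hσ, hs₁.m_eq] using hlt), hnk]
        obtain ⟨s₂, h1, hF₂, h2, h3⟩ := run_forTo (E := E) (s := s₁) (i := reg_v) (b := reg_n)
          (P := testProg)
          (fun k' s₂ => Scanned T m u (n - k) k' (fun w => s₂.arr arr_est (u * n + w)) ∧
            ∀ x, (∀ w : Fin n, x ≠ u * n + w) → s₂.arr arr_est x = s.arr arr_est x)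
          (by rw [he₁]; exact ⟨ih, ih'⟩)
          (by
            rintro k' s₂ hk' hF₂ ⟨ih, ih'⟩
            rw [hs₁.n_eq] at hk'
            have hu₂ : s₂.var reg_u = u := (hF₂.var _ (by decide)).trans hu₁
            have hσ₂ : s₂.var reg_scale = n - k := (hF₂.var _ (by decide)).trans hσ
            have ha₂ : s₂.arr arr_ans = s.arr arr_ans := (hF₂.arr _ (by decide)).trans ha₁
            have hs₂ := (hF₂.sized (by decide) hs₁).setVar (x := reg_v) (by decide) k'
            have ht := run_testProg E hB hs₂ (by simp [hu₂]) (by simpa using hk')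
            have step := ih.test hT hm hR (v := ⟨k', hk'⟩) (not_lt.1 hlt) (by omega)
            have ec : ∀ w : Fin n, s₂.arr arr_ans (k' * n + w) = oracleAnswer O u k' w :=
              fun w => by rw [ha₂]; exact hans ⟨k', hk'⟩ w
            simp only [State.setVar_var, State.setVar_arr, if_true, hu₂, hσ₂, ec,
              show ((6 : ℕ) = 7) = False by simp, show ((14 : ℕ) = 7) = False by simp,
              if_false] at ht
            rw [ht]
            split_ifs at step ⊢ with hc
            · refine ⟨?_, fun x hx => ?_⟩
              · rw [← update_row] at step
                exact step
              · rw [Function.update_of_ne (hx ⟨k', hk'⟩)]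
                exact ih' x hx
            · exact ⟨step, ih'⟩)
        rw [h1]
        rw [hs₁.n_eq] at h2
        exact ⟨h2.next, h3⟩)
  rw [h1]
  rw [hs.n_eq, Nat.sub_self] at h2
  exact h2

/-- Computes the estimates of all distances. -/
def estProg : Prog := .forTo reg_u reg_n (.seq askProg scanProg)

theorem run_estProg {n m B : ℕ} {T : HCTree (Fin n)} (hT : T.IsHC) {O : Triplet n → Fin n}
    (hm : 17 ≤ m) (hR : Reliable T O m) {E : Env}
    (hE : E.ans = oracleAnswer O) (hB : n ≤ B) {s : State}
    (hs : Sized n m B s) (h0 : ∀ x, s.arr arr_est x = 0) :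
    Estimates T m fun u v =>
      (estProg.run E s).arr arr_est (u * n + v) := by
  rw [estProg]
  obtain ⟨s', h1, hF, h2, -⟩ := run_forTo (E := E) (s := s) (i := reg_u)
    (b := reg_n) (P := .seq askProg scanProg)
    (fun k s' => (∀ u : Fin n, (u : ℕ) < k →
        Scanned T m u 0 0 (fun w => s'.arr arr_est (u * n + w))) ∧
      ∀ u : Fin n, k ≤ u → ∀ w : Fin n, s'.arr arr_est (u * n + w) = 0)
    ⟨fun _ h => absurd h (by omega), fun _ _ _ => h0 _⟩
    (by
      rintro k s' hk hF ⟨ih, ih'⟩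
      rw [hs.n_eq] at hk
      have hs' := (hF.sized (by decide) hs).setVar (x := reg_u) (by decide) k
      rw [run]
      have hask := fun v w : Fin n => run_askProg E hB hs' v.2 w.2
      have hFa := frame_run E askProg (s'.setVar reg_u k)
      generalize askProg.run E (s'.setVar reg_u k) = s₁ at hask hFa
      have hs₁ := hFa.sized (by decide) hs'
      have he₁ : s₁.arr arr_est = s'.arr arr_est := hFa.arr _ (by decide)
      have hu₁ : s₁.var reg_u = k := (hFa.var _ (by decide)).trans (by simp)
      obtain ⟨h1, h2⟩ := run_scanProg hT hm hR E hB hs₁ ⟨k, hk⟩ hu₁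
        (fun v w => by simpa [hE] using hask v w) (fun w => by rw [he₁]; exact ih' ⟨k, hk⟩ le_rfl w)
      have hne : ∀ u : Fin n, (u : ℕ) ≠ k → ∀ w : Fin n,
          (scanProg.run E s₁).arr arr_est (u * n + w) =
            s'.arr arr_est (u * n + w) := fun u hu w => by
        rw [h2 _ fun w' e => hu (row_inj w.2 w'.2 e).1, he₁]
      refine ⟨fun u hu => ?_, fun u hu w => ?_⟩
      · rcases (Nat.lt_succ_iff_lt_or_eq.1 hu) with hu | hu
        · simp only [hne u hu.ne]
          exact ih u hu
        · obtain rfl : u = ⟨k, hk⟩ := Fin.ext hu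
          exact h1
      · rw [hne u (by omega)]
        exact ih' u (by omega) w)
  rw [h1]
  have h3 : ∀ u : Fin n, Scanned T m u 0 0 (fun w => s'.arr arr_est (u * n + w)) := fun u =>
    h2 u (hs.n_eq.symm ▸ u.2)
  exact ⟨fun u v huv => (h3 u).le_two_mul v huv.symm, fun u v huv hmr =>
    (h3 u).le v huv.symm hmr (.inl (T.one_le_joinSize u v)), fun u v => (h3 u).le_n v⟩

end Prog
end RAM

/-! ### Merging classes -/

namespace RAM

/-- The labels in the memory. -/
def State.labels (n : ℕ) (s : State) : Fin n → ℕ := fun w => s.arr arr_lab w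

/-- The set of vertices in row `x` of the membership table. -/
def State.family (n : ℕ) (s : State) (x : ℕ) : Finset (Fin n) :=
  Finset.univ.filter fun w : Fin n => s.arr arr_mem (x * n + w) = 1

@[simp] theorem State.labels_setVar (n : ℕ) (s : State) (x k : ℕ) :
    (s.setVar x k).labels n = s.labels n := rfl

@[simp] theorem State.family_setVar (n : ℕ) (s : State) (x k : ℕ) :
    (s.setVar x k).family n = s.family n := rfl

namespace Prog

/-- Merges the class of `u` into the class of `v`. -/
def mergeProg : Prog :=
  .seq (.assign reg_a (.load arr_lab (.var reg_u)))
    (.seq (.assign reg_b (.load arr_lab (.var reg_v)))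
      (.forTo reg_w reg_n
        (.ite (.eq (.load arr_lab (.var reg_w)) (.var reg_a))
          (.store arr_lab (.var reg_w) (.var reg_b))
          .skip)))

theorem run_mergeProg (E : Env) {n : ℕ} {s : State} (hn : s.var reg_n = n) (u v : Fin n)
    (hu : s.var reg_u = u) (hv : s.var reg_v = v) :
    (mergeProg.run E s).labels n = mergeLabels (s.labels n) u v := by
  rw [mergeProg, run_seq, run_seq]
  generalize hs₁ : (Prog.assign reg_b (.load arr_lab (.var reg_v))).run E
    ((Prog.assign reg_a (.load arr_lab (.var reg_u))).run E s) = s₁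
  have ha : s₁.var reg_a = s.labels n u := by
    rw [← hs₁]; simp [run, hu, State.labels]
  have hb : s₁.var reg_b = s.labels n v := by
    rw [← hs₁]; simp [run, hv, State.labels]
  have hl : s₁.arr arr_lab = s.arr arr_lab := by
    rw [← hs₁]; simp [run]
  have hn₁ : s₁.var reg_n = n := by
    rw [← hs₁]; simp [run, hn]
  obtain ⟨s', h1, hF, h2⟩ := run_forTo (E := E) (s := s₁) (i := reg_w) (b := reg_n)
    (P := (.ite (.eq (.load arr_lab (.var reg_w)) (.var reg_a))
          (.store arr_lab (.var reg_w) (.var reg_b))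
          .skip))
    (fun k s' => ∀ w : Fin n, s'.arr arr_lab w =
      if (w : ℕ) < k then mergeLabels (s.labels n) u v w else s.labels n w)
    (fun w => by simp [hl, State.labels])
    (by
      intro k s' hk hF ih w
      rw [hn₁] at hk
      have ha' : s'.var reg_a = s.labels n u := (hF.var _ (by decide)).trans ha
      have hb' : s'.var reg_b = s.labels n v := (hF.var _ (by decide)).trans hb
      have hk' : s'.arr arr_lab k = s.labels n ⟨k, hk⟩ := by simpa using ih ⟨k, hk⟩
      rw [run]
      simp only [Test.holds_eq, AExpr.eval, State.setVar_var, State.setVar_arr, if_true, hk',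
        show ((17 : ℕ) = 8) = False by simp, if_false, ha']
      by_cases hw : (w : ℕ) = k
      · obtain rfl : w = ⟨k, hk⟩ := Fin.ext hw
        rw [if_pos (Nat.lt_succ_self k)]
        split_ifs with h
        · simp [run, hb', mergeLabels, h]
        · simp [run, hk', mergeLabels, h]
      · have e : ((w : ℕ) < k + 1) = ((w : ℕ) < k) := by simp only [eq_iff_iff]; omega
        simp only [e, ← ih w]
        split_ifs with h
        · simp [run, hw]
        · simp [run])
  rw [h1]
  funext w
  have := h2 w
  rw [hn₁, if_pos w.2] at this
  exact this

/-- Starts with singleton classes. -/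
def initProg : Prog := .forTo reg_u reg_n (.store arr_lab (.var reg_u) (.var reg_u))

theorem run_initProg (E : Env) {n : ℕ} {s : State} (hn : s.var reg_n = n) (w : Fin n) :
    (initProg.run E s).labels n w = w := by
  rw [initProg]
  obtain ⟨s', h1, hF, h2⟩ := run_forTo (E := E) (s := s) (i := reg_u) (b := reg_n)
    (P := (.store arr_lab (.var reg_u) (.var reg_u)))
    (fun k s' => ∀ w < k, s'.arr arr_lab w = w) (by simp)
    (by
      intro k s' hk hF ih w hw
      rcases (Nat.lt_succ_iff_lt_or_eq.1 hw) with hw | rfl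
      · simp [run, hw.ne, ih w hw]
      · simp [run])
  rw [h1]
  exact h2 w (hn.symm ▸ w.2)

/-- Merges all pairs with estimate at most `m`. -/
def closeProg : Prog :=
  .forTo reg_u reg_n (.forTo reg_v reg_n
    (.ite (.neg (.lt (.var reg_m) (.load arr_est (.idx reg_u reg_v)))) mergeProg .skip))

theorem run_closeProg (E : Env) {n m B : ℕ} (hB : n ≤ B) {s : State} (hs : Sized n m B s)
    {T : HCTree (Fin n)} (hT : T.IsHC) (hm : 1 ≤ m) {h : Fin n → Fin n → ℕ}
    (hE : Estimates T m h) (hh : ∀ u v : Fin n, s.arr arr_est (u * n + v) = h u v)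
    (hl : ∀ w, s.labels n w = w) :
    (∀ a b, (closeProg.run E s).labels n a = (closeProg.run E s).labels n b →
      T.joinSize a b ≤ m) ∧
    ∀ a b, h a b ≤ m → (closeProg.run E s).labels n a = (closeProg.run E s).labels n b := by
  rw [closeProg]
  obtain ⟨s', h1, hF, h2, h3⟩ := run_forTo (E := E) (s := s) (i := reg_u) (b := reg_n)
    (P := .forTo reg_v reg_n
      (.ite (.neg (.lt (.var reg_m) (.load arr_est (.idx reg_u reg_v)))) mergeProg .skip))
    (fun k s' => (∀ a b, s'.labels n a = s'.labels n b → T.joinSize a b ≤ m) ∧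
      ∀ a b : Fin n, (a : ℕ) < k → h a b ≤ m → s'.labels n a = s'.labels n b)
    ⟨fun a b hab => by
      rw [hl, hl] at hab
      rw [Fin.ext hab, HCTree.joinSize_self hT.1 (by simp [hT.leaves_eq])]
      exact hm, fun a b h => absurd h (by omega)⟩
    (by
      rintro k s' hk hF ⟨ih1, ih2⟩
      rw [hs.n_eq] at hk
      have hs' := (hF.sized (by decide) hs).setVar (x := reg_u) (by decide) k
      have he' : s'.arr arr_est = s.arr arr_est := hF.arr _ (by decide)
      obtain ⟨s₁, h1, hF₁, h2, h3, h4⟩ := run_forTo (E := E) (s := s'.setVar reg_u k)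
        (i := reg_v) (b := reg_n)
        (P := (.ite (.neg (.lt (.var reg_m) (.load arr_est (.idx reg_u reg_v)))) mergeProg .skip))
        (fun k' s₁ => (∀ a b, s₁.labels n a = s₁.labels n b → T.joinSize a b ≤ m) ∧
          (∀ a b : Fin n, (a : ℕ) < k → h a b ≤ m → s₁.labels n a = s₁.labels n b) ∧
          ∀ b : Fin n, (b : ℕ) < k' → h ⟨k, hk⟩ b ≤ m → s₁.labels n ⟨k, hk⟩ = s₁.labels n b)
        ⟨ih1, ih2, fun b h => absurd h (by omega)⟩
        (by
          rintro k' s₁ hk' hF₁ ⟨ih1, ih2, ih3⟩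
          rw [hs'.n_eq] at hk'
          have hs₁ := (hF₁.sized (by decide) hs').setVar (x := reg_v) (by decide) k'
          have hu₁ : (s₁.setVar reg_v k').var reg_u = k := by
            rw [State.setVar_var, if_neg (by decide), hF₁.var _ (by decide)]; simp
          have he₁ : s₁.arr arr_est = s.arr arr_est := (hF₁.arr _ (by decide)).trans he'
          have hv₁ : (s₁.setVar reg_v k').var reg_v = k' := by simp
          have hla : (s₁.setVar reg_v k').labels n = s₁.labels n := rfl
          have hea : (s₁.setVar reg_v k').arr arr_est = s.arr arr_est := he₁
          generalize s₁.setVar reg_v k' = s₂ at hs₁ hu₁ hv₁ hla hea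
          rw [run]
          have hcond : (Test.neg (.lt (.var reg_m) (.load arr_est (.idx reg_u reg_v)))).Holds E s₂ ↔
              h ⟨k, hk⟩ ⟨k', hk'⟩ ≤ m := by
            rw [← hh]
            simp [hu₁, hv₁, hea, hs₁.m_eq, hs₁.row k (by omega)]
          by_cases hc : h ⟨k, hk⟩ ⟨k', hk'⟩ ≤ m
          · rw [if_pos (hcond.2 hc), run_mergeProg E hs₁.n_eq ⟨k, hk⟩ ⟨k', hk'⟩ hu₁ hv₁, hla]
            refine ⟨fun a b hab => joinSize_le_of_mergeLabels hT ih1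
              (hE.joinSize_le hT le_rfl hm hc) hab, fun a b ha hab => mergeLabels_eq (ih2 a b ha hab),
              fun b hb hab => ?_⟩
            rcases (Nat.lt_succ_iff_lt_or_eq.1 hb) with hb | rfl
            · exact mergeLabels_eq (ih3 b hb hab)
            · exact mergeLabels_self
          · rw [if_neg (fun h => hc (hcond.1 h)), run, hla]
            refine ⟨ih1, ih2, fun b hb hab => ?_⟩
            rcases (Nat.lt_succ_iff_lt_or_eq.1 hb) with hb | rfl
            · exact ih3 b hb hab
            · exact absurd hab hc)
      rw [h1]
      rw [hs'.n_eq] at h4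
      refine ⟨h2, fun a b ha hab => ?_⟩
      rcases (Nat.lt_succ_iff_lt_or_eq.1 ha) with ha | rfl
      · exact h3 a b ha hab
      · exact h4 b b.2 hab)
  rw [h1]
  rw [hs.n_eq] at h3
  exact ⟨h2, fun a b => h3 a b a.2⟩

/-! ### Appending a set to the family -/

/-- Writes a row of the membership table; `e` depends on the column `reg_w`. -/
def fillProg (e : AExpr) : Prog := .forTo reg_w reg_n (.store arr_mem (.idx reg_cur reg_w) e)

theorem run_fillProg (E : Env) {n m B : ℕ} {s : State} (hs : Sized n m B s)
    (hcur : s.var reg_cur < B) (e : AExpr) (g : ℕ → ℕ)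
    (hg : ∀ k < n, ∀ s', (fillProg e).Frame s s' →
      (∀ x, (∀ w < n, x ≠ s.var reg_cur * n + w) → s'.arr arr_mem x = s.arr arr_mem x) →
      e.eval (s'.setVar reg_w k) = g k) :
    (∀ w < n, ((fillProg e).run E s).arr arr_mem (s.var reg_cur * n + w) = g w) ∧
      ∀ x, (∀ w < n, x ≠ s.var reg_cur * n + w) →
        ((fillProg e).run E s).arr arr_mem x = s.arr arr_mem x := by
  obtain ⟨s', h1, hF, h2⟩ := run_forTo (E := E) (s := s) (i := reg_w) (b := reg_n)
    (P := .store arr_mem (.idx reg_cur reg_w) e)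
    (fun k s' => (∀ w < k, s'.arr arr_mem (s.var reg_cur * n + w) = g w) ∧
      ∀ x, (∀ w < n, x ≠ s.var reg_cur * n + w) → s'.arr arr_mem x = s.arr arr_mem x)
    ⟨by simp, fun _ _ => rfl⟩
    (by
      rintro k s' hk hF ⟨ih1, ih2⟩
      rw [hs.n_eq] at hk
      have hc' : s'.var reg_cur = s.var reg_cur := hF.var _ (by simp [regs])
      have hr' : s'.arr arr_row = s.arr arr_row := hF.arr _ (by simp [arrs])
      have hval := hg k hk s' hF ih2
      refine ⟨fun w hw => ?_, fun x hx => ?_⟩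
      · rcases (Nat.lt_succ_iff_lt_or_eq.1 hw) with hw | rfl
        · simp [run, hc', hr', hs.row _ hcur, hw.ne, ih1 w hw]
        · simp [run, hc', hr', hs.row _ hcur, hval]
      · simp [run, hc', hr', hs.row _ hcur, hx k hk, ih2 x hx])
  rw [fillProg, h1]
  rw [hs.n_eq] at h2
  exact h2

/-- Appends a set to the family, with its leaf mark and its key. -/
def appendProg (e lf ky : AExpr) : Prog :=
  .seq (fillProg e) (.seq (.store arr_leaf (.var reg_cur) lf)
    (.seq (.store arr_key (.var reg_cur) ky) (.assign reg_cur (.add (.var reg_cur) (.lit 1)))))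

/-- The set `S` with leaf mark `lf` and key `ky` has been appended to the family. -/
structure _root_.RAM.Appended (n : ℕ) (s s' : State) (S : Finset (Fin n)) (lf ky : ℕ) : Prop where
  cur : s'.var reg_cur = s.var reg_cur + 1
  old : ∀ x, x ≠ s.var reg_cur → s'.family n x = s.family n x
  new : s'.family n (s.var reg_cur) = S
  leaf : s'.arr arr_leaf = Function.update (s.arr arr_leaf) (s.var reg_cur) lf
  key : s'.arr arr_key = Function.update (s.arr arr_key) (s.var reg_cur) ky
  le_one : (∀ j, s.arr arr_mem j ≤ 1) → ∀ j, s'.arr arr_mem j ≤ 1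

theorem run_appendProg (E : Env) {n m B : ℕ} {s : State} (hs : Sized n m B s)
    (hcur : s.var reg_cur < B) (e lf ky : AExpr) (S : Finset (Fin n)) (l y : ℕ)
    (hg : ∀ w : Fin n, ∀ s', (fillProg e).Frame s s' →
      (∀ x, (∀ w < n, x ≠ s.var reg_cur * n + w) → s'.arr arr_mem x = s.arr arr_mem x) →
      e.eval (s'.setVar reg_w w) = if w ∈ S then 1 else 0)
    (hl : ∀ s', (fillProg e).Frame s s' → lf.eval s' = l)
    (hy : ∀ s' : State, (fillProg e).Frame s s' →
      ky.eval (s'.setArr arr_leaf (s.var reg_cur) l) = y) :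
    Appended n s ((appendProg e lf ky).run E s) S l y := by
  obtain ⟨h1, h2⟩ := run_fillProg E hs hcur e
    (fun k => if h : k < n then if (⟨k, h⟩ : Fin n) ∈ S then 1 else 0 else 0)
    (fun k hk s' hF hx => by rw [dif_pos hk]; exact hg ⟨k, hk⟩ s' hF hx)
  rw [appendProg, run]
  have hF := frame_run E (fillProg e) s
  have hl' := hl _ hF
  have hy' := hy _ hF
  generalize (fillProg e).run E s = s' at h1 h2 hF hl' hy'
  have hc' : s'.var reg_cur = s.var reg_cur := hF.var _ (by simp [fillProg, regs])
  have hlf : s'.arr arr_leaf = s.arr arr_leaf := hF.arr _ (by simp [fillProg, arrs])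
  have hky : s'.arr arr_key = s.arr arr_key := hF.arr _ (by simp [fillProg, arrs])
  have hmem : (run E (.seq (.store arr_leaf (.var reg_cur) lf)
    (.seq (.store arr_key (.var reg_cur) ky) (.assign reg_cur (.add (.var reg_cur) (.lit 1))))) s').arr
      arr_mem = s'.arr arr_mem := by simp [run]
  refine ⟨by simp [run, hc'], fun x hx => ?_, ?_, ?_, ?_, fun hle j => ?_⟩
  · rw [State.family, State.family, hmem]
    refine Finset.filter_congr fun w _ => ?_
    rw [h2 _ fun w' hw' e => hx (row_inj w.2 hw' e).1]
  · rw [State.family, hmem]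
    ext w
    simp only [Finset.mem_filter, Finset.mem_univ, true_and, h1 w w.2, dif_pos w.2, Fin.eta]
    split_ifs <;> simp_all
  · simp [run, hc', hl', hlf]
  · simp [run, hc', hl', hky, hy']
  · rw [hmem]
    by_cases hj : ∃ w < n, j = s.var reg_cur * n + w
    · obtain ⟨w, hw, rfl⟩ := hj
      rw [h1 w hw, dif_pos hw]
      split_ifs <;> omega
    · push Not at hj
      rw [h2 j hj]
      exact hle j

end Prog

/-- The entries of the membership table are `0` or `1`, and marked sets are singletons of the
family. -/
structure FamilyOk (n : ℕ) (s : State) : Prop where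
  le_one : ∀ j, s.arr arr_mem j ≤ 1
  leaf : ∀ x, s.arr arr_leaf x ≠ 0 → x < s.var reg_cur ∧
    ∃ v : Fin n, s.arr arr_leaf x = v + 1 ∧ s.family n x = {v}

theorem Appended.familyOk {n : ℕ} {s s' : State} {S : Finset (Fin n)} {lf ky : ℕ}
    (h : Appended n s s' S lf ky) (hs : FamilyOk n s)
    (hS : lf ≠ 0 → ∃ v : Fin n, lf = v + 1 ∧ S = {v}) : FamilyOk n s' := by
  refine ⟨h.le_one hs.le_one, fun x hx => ?_⟩
  rw [h.leaf] at hx ⊢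
  rw [h.cur]
  by_cases hxc : x = s.var reg_cur
  · subst hxc
    rw [Function.update_self] at hx ⊢
    rw [h.new]
    exact ⟨by omega, hS hx⟩
  · rw [Function.update_of_ne hxc] at hx ⊢
    rw [h.old x hxc]
    have := hs.leaf x hx
    exact ⟨by omega, this.2⟩

theorem FamilyOk.setVar {n : ℕ} {s : State} (hs : FamilyOk n s) {x k : ℕ} (hx : x ≠ reg_cur) :
    FamilyOk n (s.setVar x k) :=
  ⟨hs.le_one, fun y hy => by
    rw [State.setVar_var, if_neg hx.symm]
    exact hs.leaf y hy⟩

end RAM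

/-! ### The program for the subsets of the classes -/

namespace RAM

/-- The number `1` if the values are equal, and `0` otherwise. -/
def AExpr.eqInd (e f : AExpr) : AExpr := .sub (.lit 1) (.add (.sub e f) (.sub f e))

theorem AExpr.eval_eqInd (s : State) (e f : AExpr) :
    (AExpr.eqInd e f).eval s = if e.eval s = f.eval s then 1 else 0 := by
  simp only [eqInd, eval]
  split_ifs <;> omega

theorem State.mem_family {n : ℕ} {s : State} {x : ℕ} {w : Fin n} :
    w ∈ s.family n x ↔ s.arr arr_mem (x * n + w) = 1 := by simp [State.family]

theorem State.mem_eq_ite {n : ℕ} {s : State} (hs : FamilyOk n s) (x : ℕ) (w : Fin n) :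
    s.arr arr_mem (x * n + w) = if w ∈ s.family n x then 1 else 0 := by
  have := hs.le_one (x * n + w)
  simp only [State.mem_family]
  split_ifs <;> omega

namespace Prog

/-- Appends the set `{v}`. -/
def singletonProg : Prog :=
  appendProg (.eqInd (.var reg_w) (.var reg_v)) (.add (.var reg_v) (.lit 1))
    (.load arr_lab (.var reg_v))

theorem run_singletonProg (E : Env) {n m B : ℕ} {s : State} (hs : Sized n m B s)
    (hcur : s.var reg_cur < B) (v : Fin n) (hv : s.var reg_v = v) :
    Appended n s (singletonProg.run E s) {v} (v + 1) (s.labels n v) := by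
  have hvar : ∀ s' : State, (fillProg (.eqInd (.var reg_w) (.var reg_v))).Frame s s' →
      s'.var reg_v = v := fun s' hF => (hF.var _ (by decide)).trans hv
  refine run_appendProg E hs hcur _ _ _ _ _ _ (fun w s' hF _ => ?_) (fun s' hF => ?_)
    (fun s' hF => ?_)
  · simp [AExpr.eval_eqInd, hvar s' hF, Fin.ext_iff]
  · simp [hvar s' hF]
  · have : s'.arr arr_lab = s.arr arr_lab := hF.arr _ (by decide)
    simp [hvar s' hF, this, State.labels]

/-- Appends the set `F x ∪ {v}`. -/
def insertProg : Prog :=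
  appendProg (.sub (.lit 1) (.sub (.sub (.lit 1) (.eqInd (.var reg_w) (.var reg_v)))
      (.load arr_mem (.idx reg_x reg_w)))) (.lit 0) (.load arr_lab (.var reg_v))

theorem run_insertProg (E : Env) {n m B : ℕ} {s : State} (hs : Sized n m B s)
    (hok : FamilyOk n s) (hcur : s.var reg_cur < B) (hx : s.var reg_x < s.var reg_cur) (v : Fin n)
    (hv : s.var reg_v = v) :
    Appended n s (insertProg.run E s) (insert v (s.family n (s.var reg_x))) 0 (s.labels n v) := by
  have hvar : ∀ s' : State, (fillProg (.sub (.lit 1) (.sub (.sub (.lit 1)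
      (.eqInd (.var reg_w) (.var reg_v))) (.load arr_mem (.idx reg_x reg_w))))).Frame s s' →
      s'.var reg_v = v := fun s' hF => (hF.var _ (by decide)).trans hv
  refine run_appendProg E hs hcur _ _ _ _ _ _ (fun w s' hF hmem => ?_) (fun s' hF => ?_)
    (fun s' hF => ?_)
  · have h1 : s'.var reg_x = s.var reg_x := hF.var _ (by decide)
    have h2 : s'.arr arr_row = s.arr arr_row := hF.arr _ (by decide)
    have h3 : s'.arr arr_mem (s.var reg_x * n + w) = s.arr arr_mem (s.var reg_x * n + w) :=
      hmem _ fun w' hw' e => by have := (row_inj w.2 hw' e).1; omega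
    simp only [AExpr.eval, AExpr.eval_eqInd, AExpr.eval_idx, State.setVar_var, State.setVar_arr,
      if_true, show ((7 : ℕ) = 8) = False by simp, show ((10 : ℕ) = 8) = False by simp, if_false,
      hvar s' hF, h1, h2, hs.row _ (hx.trans hcur), h3, State.mem_eq_ite hok, Finset.mem_insert]
    by_cases hwv : w = v
    · simp [hwv]
    · have : ¬ ((w : ℕ) = v) := fun h => hwv (Fin.ext h)
      by_cases hw : w ∈ s.family n (s.var reg_x) <;> simp [hwv, this, hw]
  · simp
  · have : s'.arr arr_lab = s.arr arr_lab := hF.arr _ (by decide)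
    simp [hvar s' hF, this, State.labels]

/-- Appends all nonempty subsets of the classes. -/
def subsetsProg : Prog :=
  .forTo reg_v reg_n
    (.seq (.assign reg_start (.var reg_cur))
      (.seq singletonProg
        (.forTo reg_x reg_big
          (.ite (.conj (.lt (.var reg_x) (.var reg_start))
              (.eq (.load arr_key (.var reg_x)) (.load arr_lab (.var reg_v))))
            insertProg .skip))))

theorem run_subsetsProg (E : Env) {n m B : ℕ} {s : State} (hs : Sized n m B s)
    (hB : n * 2 ^ m < B) (hok : FamilyOk n s) (hcur : s.var reg_cur = 0)
    (hm : ∀ a, (labelClass (s.labels n) a).card ≤ m) :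
    FamilyOk n (subsetsProg.run E s) ∧
      Subsets (s.labels n) n ((subsetsProg.run E s).family n) ((subsetsProg.run E s).arr arr_leaf)
        ((subsetsProg.run E s).arr arr_key) ((subsetsProg.run E s).var reg_cur) := by
  rw [subsetsProg]
  obtain ⟨s', h1, hF, h2, h3⟩ := run_forTo (E := E) (s := s) (i := reg_v) (b := reg_n)
    (P := (.seq (.assign reg_start (.var reg_cur))
      (.seq singletonProg
        (.forTo reg_x reg_big
          (.ite (.conj (.lt (.var reg_x) (.var reg_start))
              (.eq (.load arr_key (.var reg_x)) (.load arr_lab (.var reg_v))))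
            insertProg .skip)))))
    (fun k s' => FamilyOk n s' ∧ Subsets (s.labels n) k (s'.family n) (s'.arr arr_leaf)
      (s'.arr arr_key) (s'.var reg_cur))
    ⟨hok, by simpa only [hcur] using Subsets.zero (s.labels n) _ _ _⟩
    (by
      rintro k s' hk hF ⟨ih1, ih2⟩
      rw [hs.n_eq] at hk
      rw [run_seq, run_seq]
      have hs₁ : Sized n m B ((Prog.assign reg_start (.var reg_cur)).run E (s'.setVar reg_v k)) :=
        ((hF.sized (by decide) hs).setVar (x := reg_v) (by decide) k).setVar (by decide) _
      have hok₁ : FamilyOk n ((Prog.assign reg_start (.var reg_cur)).run E (s'.setVar reg_v k)) :=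
        (ih1.setVar (x := reg_v) (by decide)).setVar (by decide)
      have hsub₁ : Subsets (s.labels n) k
        (((Prog.assign reg_start (.var reg_cur)).run E (s'.setVar reg_v k)).family n)
        (((Prog.assign reg_start (.var reg_cur)).run E (s'.setVar reg_v k)).arr arr_leaf)
        (((Prog.assign reg_start (.var reg_cur)).run E (s'.setVar reg_v k)).arr arr_key)
        (((Prog.assign reg_start (.var reg_cur)).run E (s'.setVar reg_v k)).var reg_cur) := by
        simpa [run] using ih2
      have hl₁ : ((Prog.assign reg_start (.var reg_cur)).run E (s'.setVar reg_v k)).arr arr_lab =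
        s.arr arr_lab := hF.arr _ (by decide)
      have hv₁ : ((Prog.assign reg_start (.var reg_cur)).run E (s'.setVar reg_v k)).var reg_v =
        k := by simp [run]
      have hst₁ : ((Prog.assign reg_start (.var reg_cur)).run E (s'.setVar reg_v k)).var
        reg_start =
        ((Prog.assign reg_start (.var reg_cur)).run E (s'.setVar reg_v k)).var reg_cur := by
        simp [run]
      generalize (Prog.assign reg_start (.var reg_cur)).run E (s'.setVar reg_v k) = s₁
        at hs₁ hok₁ hsub₁ hl₁ hv₁ hst₁
      have hlab₁ : s₁.labels n = s.labels n := by funext w; simp only [State.labels, hl₁]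
      have hA := run_singletonProg E hs₁ ((hsub₁.cur_le hm).trans_lt hB) ⟨k, hk⟩ hv₁
      have hF₁ := frame_run E singletonProg s₁
      generalize singletonProg.run E s₁ = s₂ at hA hF₁
      have hok₂ := hA.familyOk hok₁ fun _ => ⟨⟨k, hk⟩, rfl, rfl⟩
      have hs₂ := hF₁.sized (by decide) hs₁
      have hl₂ : s₂.arr arr_lab = s.arr arr_lab := (hF₁.arr _ (by decide)).trans hl₁
      have hv₂ : s₂.var reg_v = k := (hF₁.var _ (by decide)).trans hv₁
      have hst₂ : s₂.var reg_start = s₁.var reg_cur := (hF₁.var _ (by decide)).trans hst₁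
      have hext : Extending (s.labels n) ⟨k, hk⟩ (s₁.var reg_cur) 0 (s₂.family n)
          (s₂.arr arr_leaf) (s₂.arr arr_key) (s₂.var reg_cur) := by
        rw [hA.cur]
        refine hsub₁.start (v := ⟨k, hk⟩) (fun x hx => hA.old x hx.ne) (fun x hx => ?_)
          (fun x hx => ?_) hA.new ?_ ?_
        · rw [hA.leaf, Function.update_of_ne hx.ne]
        · rw [hA.key, Function.update_of_ne hx.ne]
        · rw [hA.leaf, Function.update_self]
        · rw [hA.key, Function.update_self, hlab₁]
      have hdist : Extending.Distinct (s₁.var reg_cur) (s₂.var reg_cur) (s₂.family n) := by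
        intro x hx y hy h1 h2
        rw [hA.cur] at hx hy
        omega
      obtain ⟨s₃, h1, hF₂, h2, h3, h4⟩ := run_forTo (E := E) (s := s₂) (i := reg_x) (b := reg_big)
        (P := (.ite (.conj (.lt (.var reg_x) (.var reg_start))
              (.eq (.load arr_key (.var reg_x)) (.load arr_lab (.var reg_v))))
            insertProg .skip))
        (fun j s₃ => FamilyOk n s₃ ∧ Extending (s.labels n) ⟨k, hk⟩ (s₁.var reg_cur) j
          (s₃.family n) (s₃.arr arr_leaf) (s₃.arr arr_key) (s₃.var reg_cur) ∧
          Extending.Distinct (s₁.var reg_cur) (s₃.var reg_cur) (s₃.family n))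
        ⟨hok₂, hext, hdist⟩
        (by
          rintro j s₃ hj hF₂ ⟨ih1, ih2, ih3⟩
          have hs₃ := (hF₂.sized (by decide) hs₂).setVar (x := reg_x) (by decide) j
          have hl₃ : (s₃.setVar reg_x j).arr arr_lab = s.arr arr_lab :=
            (hF₂.arr _ (by decide)).trans hl₂
          have hv₃ : (s₃.setVar reg_x j).var reg_v = k := by
            rw [State.setVar_var, if_neg (by decide), hF₂.var _ (by decide), hv₂]
          have hst₃ : (s₃.setVar reg_x j).var reg_start = s₁.var reg_cur := by
            rw [State.setVar_var, if_neg (by decide), hF₂.var _ (by decide), hst₂]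
          have hx₃ : (s₃.setVar reg_x j).var reg_x = j := by simp
          have hok₃ := ih1.setVar (x := reg_x) (k := j) (by decide)
          replace ih2 : Extending (s.labels n) ⟨k, hk⟩ (s₁.var reg_cur) j
            ((s₃.setVar reg_x j).family n) ((s₃.setVar reg_x j).arr arr_leaf)
            ((s₃.setVar reg_x j).arr arr_key) ((s₃.setVar reg_x j).var reg_cur) := by
            simpa using ih2
          replace ih3 : Extending.Distinct (s₁.var reg_cur) ((s₃.setVar reg_x j).var reg_cur)
            ((s₃.setVar reg_x j).family n) := by simpa using ih3
          generalize s₃.setVar reg_x j = s₄ at hs₃ hl₃ hv₃ hst₃ hx₃ hok₃ ih2 ih3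
          have hlab₄ : s₄.labels n = s.labels n := by funext w; simp only [State.labels, hl₃]
          have hcond : (Test.conj (.lt (.var reg_x) (.var reg_start))
              (.eq (.load arr_key (.var reg_x)) (.load arr_lab (.var reg_v)))).Holds E s₄ ↔
              j < s₁.var reg_cur ∧ s₄.arr arr_key j = s.labels n ⟨k, hk⟩ := by
            simp [hx₃, hst₃, hl₃, hv₃, State.labels]
          have hlt := ih2.start_lt
          rw [run]
          by_cases hc : j < s₁.var reg_cur ∧ s₄.arr arr_key j = s.labels n ⟨k, hk⟩
          · rw [if_pos (hcond.2 hc)]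
            have hle := card_family_le ih2.hereditary.nonempty ih2.label (ih2.injective ih3) hm
            have hA := run_insertProg E hs₃ hok₃ (hle.trans_lt hB) (by rw [hx₃]; omega) ⟨k, hk⟩ hv₃
            rw [hx₃, hlab₄] at hA
            refine ⟨hA.familyOk hok₃ (fun h => absurd rfl h), ?_, ?_⟩
            · rw [hA.cur]
              refine ih2.append hc.1 hc.2 (fun x hx => hA.old x hx.ne) (fun x hx => ?_)
                (fun x hx => ?_) hA.new ?_ ?_
              · rw [hA.leaf, Function.update_of_ne hx.ne]
              · rw [hA.key, Function.update_of_ne hx.ne]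
              · rw [hA.leaf, Function.update_self]
              · rw [hA.key, Function.update_self]
            · rw [hA.cur]
              exact ih2.distinct_append ih3 hc.1 (fun x hx => hA.old x hx.ne) hA.new
          · rw [if_neg fun h => hc (hcond.1 h), run]
            exact ⟨hok₃, ih2.skip hc, ih3⟩)
      rw [h1]
      refine ⟨h2.setVar (by decide), ?_⟩
      have := h3.finish h4 (by
        rw [hs₂.big_eq]
        exact ((hsub₁.cur_le hm).trans_lt hB).le)
      simpa using this)
  rw [h1]
  rw [hs.n_eq] at h3
  exact ⟨h2.setVar (by decide), by simpa using h3⟩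

end Prog
end RAM

/-! ### The program for single linkage -/

namespace RAM

/-- The state satisfies the invariant of single linkage at threshold `t`. -/
structure LinkInv {n : ℕ} (T : HCTree (Fin n)) (w : Fin n → Fin n → ℝ) (m : ℕ)
    (h : Fin n → Fin n → ℕ) (t : ℕ) (s : State) : Prop where
  ok : FamilyOk n s
  linkage : Linkage T w m h t (s.labels n) (s.family n) (s.arr arr_leaf) (s.var reg_cur)

theorem LinkInv.setVar {n : ℕ} {T : HCTree (Fin n)} {w : Fin n → Fin n → ℝ} {m : ℕ}
    {h : Fin n → Fin n → ℕ} {t : ℕ} {s : State} (hs : LinkInv T w m h t s) {x k : ℕ}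
    (hx : x ≠ reg_cur) : LinkInv T w m h t (s.setVar x k) :=
  ⟨hs.ok.setVar hx, by simpa [hx.symm] using hs.linkage⟩

theorem LinkInv.next {n : ℕ} {T : HCTree (Fin n)} {w : Fin n → Fin n → ℝ} {m : ℕ}
    {h : Fin n → Fin n → ℕ} {t : ℕ} {s : State} (hs : LinkInv T w m h t s)
    (ht : ∀ a b, h a b = t → s.labels n a = s.labels n b) : LinkInv T w m h (t + 1) s := by
  refine ⟨hs.ok, fun a b hab => (hs.linkage.joinSize_le a b hab).trans (by omega),
    fun a b hab => ?_, hs.linkage.tree⟩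
  by_cases he : h a b = t
  · exact ht a b he
  · exact hs.linkage.together a b (by omega)

namespace Prog

/-- Appends the class of `u`. -/
def classProg : Prog :=
  appendProg (.eqInd (.load arr_lab (.var reg_w)) (.load arr_lab (.var reg_u))) (.lit 0) (.lit 0)

theorem run_classProg (E : Env) {n m B : ℕ} {s : State} (hs : Sized n m B s)
    (hcur : s.var reg_cur < B) (u : Fin n) (hu : s.var reg_u = u) :
    Appended n s (classProg.run E s) (labelClass (s.labels n) u) 0 0 := by
  refine run_appendProg E hs hcur _ _ _ _ _ _ (fun w s' hF _ => ?_) (fun s' hF => by simp)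
    (fun s' hF => by simp)
  have h1 : s'.arr arr_lab = s.arr arr_lab := hF.arr _ (by decide)
  have h2 : s'.var reg_u = u := (hF.var _ (by decide)).trans hu
  simp [AExpr.eval_eqInd, h1, h2, mem_labelClass, State.labels]

/-- Merges the classes of `u` and `v`, and appends the new class. -/
def joinProg : Prog := .seq mergeProg classProg

theorem run_joinProg (E : Env) {n m B : ℕ} {s : State} (hs : Sized n m B s)
    (hcur : s.var reg_cur < B) {T : HCTree (Fin n)} (hT : T.IsHC) {w : Fin n → Fin n → ℝ}
    (hw : ∀ a b, w a b = w b a) (hw0 : ∀ a b, 0 ≤ w a b) (hm : 1 ≤ m) {h : Fin n → Fin n → ℕ}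
    (hE : Estimates T m h) {t : ℕ} (hL : LinkInv T w m h t s) (u v : Fin n) (hu : s.var reg_u = u)
    (hv : s.var reg_v = v) (huv : h u v = t) :
    LinkInv T w m h t (joinProg.run E s) ∧
      (joinProg.run E s).labels n = mergeLabels (s.labels n) u v ∧
      (joinProg.run E s).var reg_cur = s.var reg_cur + 1 := by
  rw [joinProg, run_seq]
  have h1 := run_mergeProg E hs.n_eq u v hu hv
  have hF := frame_run E mergeProg s
  generalize mergeProg.run E s = s' at h1 hF
  have hs' := hF.sized (by decide) hs
  have hc' : s'.var reg_cur = s.var reg_cur := hF.var _ (by decide)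
  have hu' : s'.var reg_u = u := (hF.var _ (by decide)).trans hu
  have hm' : s'.arr arr_mem = s.arr arr_mem := hF.arr _ (by decide)
  have hf' : s'.family n = s.family n := by funext x; simp only [State.family, hm']
  have hl' : s'.arr arr_leaf = s.arr arr_leaf := hF.arr _ (by decide)
  have hok' : FamilyOk n s' := by
    refine ⟨fun j => by rw [hm']; exact hL.ok.le_one j, fun x hx => ?_⟩
    rw [hl'] at hx ⊢
    rw [hc', hf']
    exact hL.ok.leaf x hx
  have hA := run_classProg E hs' (hc' ▸ hcur) u hu'
  have hF' := frame_run E classProg s'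
  generalize classProg.run E s' = s'' at hA hF'
  have hlab : s''.labels n = mergeLabels (s.labels n) u v := by
    rw [← h1]; funext x; simp only [State.labels, hF'.arr arr_lab (by decide)]
  rw [h1] at hA
  refine ⟨⟨hA.familyOk hok' fun h => absurd rfl h, ?_⟩, hlab, by rw [hA.cur, hc']⟩
  rw [hlab, hA.cur, hc']
  refine hL.linkage.step hT hw hw0 hm hE huv (fun x hx => ?_) (fun x hx => ?_) ?_ ?_
  · rw [hA.old x (by rw [hc']; exact hx.ne), hf']
  · rw [hA.leaf, Function.update_of_ne (by rw [hc']; exact hx.ne), hl']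
  · rw [← hc', hA.new]
  · rw [hA.leaf, hc', Function.update_self]

/-- Single linkage. -/
def linkProg : Prog :=
  .forTo reg_t reg_n (.forTo reg_u reg_n (.forTo reg_v reg_n
    (.ite (.eq (.load arr_est (.idx reg_u reg_v)) (.add (.var reg_t) (.lit 1))) joinProg .skip)))

theorem run_linkProg (E : Env) {n m B : ℕ} {s : State} (hs : Sized n m B s) {c₀ : ℕ}
    (hcur : s.var reg_cur ≤ c₀) (hB : c₀ + n * (n * n) < B) {T : HCTree (Fin n)} (hT : T.IsHC)
    {w : Fin n → Fin n → ℝ} (hw : ∀ a b, w a b = w b a) (hw0 : ∀ a b, 0 ≤ w a b) (hm : 1 ≤ m)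
    {h : Fin n → Fin n → ℕ} (hE : Estimates T m h)
    (hh : ∀ u v : Fin n, s.arr arr_est (u * n + v) = h u v) (hL : LinkInv T w m h 1 s) :
    LinkInv T w m h (n + 1) (linkProg.run E s) ∧
      (linkProg.run E s).var reg_cur ≤ c₀ + n * (n * n) := by
  rw [linkProg]
  obtain ⟨s', h1, hF, h2, h3⟩ := run_forTo (E := E) (s := s) (i := reg_t) (b := reg_n)
    (P := .forTo reg_u reg_n (.forTo reg_v reg_n
    (.ite (.eq (.load arr_est (.idx reg_u reg_v)) (.add (.var reg_t) (.lit 1))) joinProg .skip)))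
    (fun k s' => LinkInv T w m h (k + 1) s' ∧ s'.var reg_cur ≤ c₀ + k * (n * n))
    ⟨hL, by simpa using hcur⟩
    (by
      rintro k s' hk hF ⟨ih1, ih2⟩
      rw [hs.n_eq] at hk
      have hs' := (hF.sized (by decide) hs).setVar (x := reg_t) (by decide) k
      have he' : s'.arr arr_est = s.arr arr_est := hF.arr _ (by decide)
      obtain ⟨s₁, h1, hF₁, h2, h3, h4⟩ := run_forTo (E := E) (s := s'.setVar reg_t k) (i := reg_u)
        (b := reg_n) (P := .forTo reg_v reg_n
        (.ite (.eq (.load arr_est (.idx reg_u reg_v)) (.add (.var reg_t) (.lit 1))) joinProg .skip))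
        (fun k₂ s₁ => LinkInv T w m h (k + 1) s₁ ∧
          (∀ a b : Fin n, (a : ℕ) < k₂ → h a b = k + 1 → s₁.labels n a = s₁.labels n b) ∧
          s₁.var reg_cur ≤ c₀ + k * (n * n) + k₂ * n)
        ⟨ih1.setVar (by decide), fun a b h => absurd h (by omega), by simpa using ih2⟩
        (by
          rintro k₂ s₁ hk₂ hF₁ ⟨ih1, ih2, ih3⟩
          rw [hs'.n_eq] at hk₂
          have hs₁ := (hF₁.sized (by decide) hs').setVar (x := reg_u) (by decide) k₂
          have he₁ : s₁.arr arr_est = s.arr arr_est := (hF₁.arr _ (by decide)).trans he'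
          have ht₁ : s₁.var reg_t = k := (hF₁.var _ (by decide)).trans (by simp)
          obtain ⟨s₂, h1, hF₂, h2, h3, h4, h5⟩ := run_forTo (E := E) (s := s₁.setVar reg_u k₂)
            (i := reg_v) (b := reg_n)
            (P := (.ite (.eq (.load arr_est (.idx reg_u reg_v)) (.add (.var reg_t) (.lit 1)))
              joinProg .skip))
            (fun k₃ s₂ => LinkInv T w m h (k + 1) s₂ ∧
              (∀ a b : Fin n, (a : ℕ) < k₂ → h a b = k + 1 → s₂.labels n a = s₂.labels n b) ∧
              (∀ b : Fin n, (b : ℕ) < k₃ → h ⟨k₂, hk₂⟩ b = k + 1 →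
                s₂.labels n ⟨k₂, hk₂⟩ = s₂.labels n b) ∧
              s₂.var reg_cur ≤ c₀ + k * (n * n) + k₂ * n + k₃)
            ⟨ih1.setVar (by decide), ih2, fun b h => absurd h (by omega), by simpa using ih3⟩
            (by
              rintro k₃ s₂ hk₃ hF₂ ⟨ih1, ih2, ih3, ih4⟩
              rw [hs₁.n_eq] at hk₃
              have hs₂ := (hF₂.sized (by decide) hs₁).setVar (x := reg_v) (by decide) k₃
              have he₂ : (s₂.setVar reg_v k₃).arr arr_est = s.arr arr_est :=
                (hF₂.arr _ (by decide)).trans he₁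
              have ht₂ : (s₂.setVar reg_v k₃).var reg_t = k := by
                rw [State.setVar_var, if_neg (by decide), hF₂.var _ (by decide)]
                simpa using ht₁
              have hu₂ : (s₂.setVar reg_v k₃).var reg_u = k₂ := by
                rw [State.setVar_var, if_neg (by decide), hF₂.var _ (by decide)]
                simp
              have hv₂ : (s₂.setVar reg_v k₃).var reg_v = k₃ := by simp
              have hc₂ : (s₂.setVar reg_v k₃).var reg_cur = s₂.var reg_cur := by simp
              have hl₂ : (s₂.setVar reg_v k₃).labels n = s₂.labels n := rfl
              have hL₂ := ih1.setVar (x := reg_v) (k := k₃) (by decide)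
              generalize s₂.setVar reg_v k₃ = s₃ at hs₂ he₂ ht₂ hu₂ hv₂ hc₂ hl₂ hL₂
              have hcond : (Test.eq (.load arr_est (.idx reg_u reg_v))
                  (.add (.var reg_t) (.lit 1))).Holds E s₃ ↔ h ⟨k₂, hk₂⟩ ⟨k₃, hk₃⟩ = k + 1 := by
                have h1 : n ≤ n * (n * n) := by nlinarith [Nat.mul_le_mul hk₂ hk₂]
                rw [← hh]
                simp [hu₂, hv₂, he₂, ht₂, hs₂.row k₂ (by omega)]
              have hlt : s₃.var reg_cur < B := by
                have e1 : (k + 1) * (n * n) ≤ n * (n * n) := Nat.mul_le_mul_right _ hk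
                have e2 : (k₂ + 1) * n ≤ n * n := Nat.mul_le_mul_right _ hk₂
                rw [Nat.add_mul] at e1 e2
                omega
              rw [run]
              by_cases hc : h ⟨k₂, hk₂⟩ ⟨k₃, hk₃⟩ = k + 1
              · rw [if_pos (hcond.2 hc)]
                obtain ⟨j1, j2, j3⟩ := run_joinProg E hs₂ hlt hT hw hw0 hm hE hL₂ ⟨k₂, hk₂⟩
                  ⟨k₃, hk₃⟩ hu₂ hv₂ hc
                rw [j2, j3, hl₂]
                refine ⟨j1, fun a b ha hab => mergeLabels_eq (ih2 a b ha hab), fun b hb hab => ?_,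
                  by omega⟩
                rcases (Nat.lt_succ_iff_lt_or_eq.1 hb) with hb | rfl
                · exact mergeLabels_eq (ih3 b hb hab)
                · exact mergeLabels_self
              · rw [if_neg fun h => hc (hcond.1 h), run, hl₂]
                refine ⟨hL₂, ih2, fun b hb hab => ?_, by omega⟩
                rcases (Nat.lt_succ_iff_lt_or_eq.1 hb) with hb | rfl
                · exact ih3 b hb hab
                · exact absurd hab hc)
          rw [h1]
          rw [hs₁.n_eq] at h4 h5
          refine ⟨h2.setVar (by decide), fun a b ha hab => ?_, ?_⟩
          · rcases (Nat.lt_succ_iff_lt_or_eq.1 ha) with ha | rfl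
            · exact h3 a b ha hab
            · exact h4 b b.2 hab
          · rw [Nat.add_mul]
            simp
            omega)
      rw [h1]
      rw [hs'.n_eq] at h3 h4
      refine ⟨(h2.setVar (by decide)).next fun a b hab => h3 a b a.2 hab, ?_⟩
      rw [Nat.add_mul]
      simp
      omega)
  rw [h1]
  rw [hs.n_eq] at h2 h3
  exact ⟨h2.setVar (by decide), by simpa using h3⟩

/-- Appends the set of all vertices. -/
def rootProg : Prog := appendProg (.lit 1) (.lit 0) (.lit 0)

theorem run_rootProg (E : Env) {n m B : ℕ} {s : State} (hs : Sized n m B s)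
    (hcur : s.var reg_cur < B) (hn : 2 ≤ n) {T : HCTree (Fin n)} {w : Fin n → Fin n → ℝ}
    {h : Fin n → Fin n → ℕ} (hh : ∀ u v, h u v ≤ n) (hL : LinkInv T w m h (n + 1) s) :
    FamilyOk n (rootProg.run E s) ∧ (rootProg.run E s).var reg_cur = s.var reg_cur + 1 ∧
      (rootProg.run E s).family n (s.var reg_cur) = Finset.univ ∧
      ∃ T', Derivable ((rootProg.run E s).family n) ((rootProg.run E s).arr arr_leaf)
        (s.var reg_cur) T' ∧ T'.nodeCost w ≤ T.pairCost w Finset.univ := by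
  have hA : Appended n s (rootProg.run E s) Finset.univ 0 0 :=
    run_appendProg E hs hcur _ _ _ _ _ _ (fun w s' hF _ => by simp) (fun s' hF => by simp)
      (fun s' hF => by simp)
  generalize rootProg.run E s = s' at hA
  obtain ⟨x, hx, hFx, T', hD, hc⟩ := hL.linkage.tree ⟨0, by omega⟩
  have huniv : s.family n x = Finset.univ := by
    rw [hFx]
    refine Finset.eq_univ_iff_forall.2 fun a => mem_labelClass.2 ?_
    exact hL.linkage.together _ _ (.inr (Nat.lt_succ_of_le (hh _ _)))
  refine ⟨hA.familyOk hL.ok fun h => absurd rfl h, hA.cur, hA.new, T', ?_, huniv ▸ hc⟩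
  have hD' : Derivable (s'.family n) (s'.arr arr_leaf) x T' := hD.congr
    (fun y hy => hA.old y (by omega))
    (fun y hy => by rw [hA.leaf, Function.update_of_ne (by omega)])
  have hx' : s'.family n x = Finset.univ := by rw [hA.old x hx.ne, huniv]
  cases hD' with
  | leaf h hF =>
    have := congrArg Finset.card (hF.symm.trans hx')
    rw [Finset.card_singleton, Finset.card_univ, Fintype.card_fin] at this
    omega
  | node h hy hz hd hF hl hr =>
    refine .node ?_ (hy.trans hx) (hz.trans hx) hd ?_ hl hr
    · rw [hA.leaf, Function.update_self]
    · rw [hA.new, ← hx', hF]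

end Prog
end RAM

/-! ### The program for the table -/

section PartialTable

variable {n : ℕ} {w : Fin n → Fin n → ℝ} {F : ℕ → Finset (Fin n)} {leaf ok left right : ℕ → ℕ}
  {val : ℕ → ℝ}

/-- The entries of the table at an unmarked `x`, while only the splits in `P` have been tried. -/
structure PartialAt (w : Fin n → Fin n → ℝ) (F : ℕ → Finset (Fin n)) (ok left right : ℕ → ℕ)
    (val : ℕ → ℝ) (x : ℕ) (P : ℕ → ℕ → Prop) : Prop where
  sound : ok x ≠ 0 → IsSplit F x (left x) (right x) ∧ ok (left x) ≠ 0 ∧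
    ok (right x) ≠ 0 ∧ val x = splitCost w F val x (left x) (right x)
  best : ∀ y z, P y z → IsSplit F x y z → ok y ≠ 0 → ok z ≠ 0 →
    ok x ≠ 0 ∧ val x ≤ splitCost w F val x y z

theorem splitCost_update {x y z : ℕ} (hy : y < x) (hz : z < x) (c : ℝ) :
    splitCost w F (Function.update val x c) x y z = splitCost w F val x y z := by
  simp [splitCost, hy.ne, hz.ne]

theorem PartialAt.skip {x : ℕ} {P Q : ℕ → ℕ → Prop} (h : PartialAt w F ok left right val x P)
    (hQ : ∀ y z, Q y z → IsSplit F x y z → ok y ≠ 0 → ok z ≠ 0 →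
      P y z ∨ (ok x ≠ 0 ∧ val x ≤ splitCost w F val x y z)) :
    PartialAt w F ok left right val x Q :=
  ⟨h.sound, fun y z hyz hs hy hz => (hQ y z hyz hs hy hz).elim (fun h' => h.best y z h' hs hy hz) id⟩

theorem PartialAt.update {x : ℕ} {P Q : ℕ → ℕ → Prop} (h : PartialAt w F ok left right val x P)
    {y z : ℕ} (hs : IsSplit F x y z) (hy : ok y ≠ 0) (hz : ok z ≠ 0)
    (hval : ok x = 0 ∨ splitCost w F val x y z < val x)
    (hQ : ∀ y' z', Q y' z' → P y' z' ∨ (y' = y ∧ z' = z)) :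
    PartialAt w F (Function.update ok x 1) (Function.update left x y) (Function.update right x z)
      (Function.update val x (splitCost w F val x y z)) x Q := by
  refine ⟨fun _ => ?_, fun y' z' hyz hs' hy' hz' => ?_⟩
  · simp only [Function.update_self, Function.update_of_ne hs.1.ne, Function.update_of_ne hs.2.1.ne,
      splitCost_update hs.1 hs.2.1]
    exact ⟨hs, hy, hz, trivial⟩
  · rw [Function.update_of_ne hs'.1.ne] at hy'
    rw [Function.update_of_ne hs'.2.1.ne] at hz'
    rw [Function.update_self, Function.update_self, splitCost_update hs'.1 hs'.2.1]
    refine ⟨one_ne_zero, ?_⟩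
    rcases hQ y' z' hyz with h' | ⟨rfl, rfl⟩
    · obtain ⟨h1, h2⟩ := h.best y' z' h' hs' hy' hz'
      rcases hval with h0 | hlt
      · exact absurd h0 h1
      · exact hlt.le.trans h2
    · exact le_rfl

theorem TableAt.congr {x : ℕ} (h : TableAt w F leaf ok left right val x)
    {ok' left' right' : ℕ → ℕ} {val' : ℕ → ℝ} (h1 : ∀ y ≤ x, ok' y = ok y)
    (h2 : ∀ y ≤ x, left' y = left y) (h3 : ∀ y ≤ x, right' y = right y)
    (h4 : ∀ y ≤ x, val' y = val y) : TableAt w F leaf ok' left' right' val' x := by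
  have hc : ∀ y z, y < x → z < x → splitCost w F val' x y z = splitCost w F val x y z :=
    fun y z hy hz => by rw [splitCost, splitCost, h4 y hy.le, h4 z hz.le]
  refine ⟨fun h0 => ?_, fun h0 hok => ?_, fun h0 y z hs hy hz => ?_⟩
  · rw [h1 x le_rfl, h4 x le_rfl]; exact h.of_leaf h0
  · rw [h1 x le_rfl] at hok
    obtain ⟨hs, hl, hr, hv⟩ := h.sound h0 hok
    rw [h2 x le_rfl, h3 x le_rfl, h1 _ hs.1.le, h1 _ hs.2.1.le, h4 x le_rfl, hc _ _ hs.1 hs.2.1]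
    exact ⟨hs, hl, hr, hv⟩
  · rw [h1 y hs.1.le] at hy
    rw [h1 z hs.2.1.le] at hz
    rw [h1 x le_rfl, h4 x le_rfl, hc _ _ hs.1 hs.2.1]
    exact h.best h0 y z hs hy hz

theorem splitCost_eq_sum (x y z : ℕ) : splitCost w F val x y z = val y + val z +
    ∑ a, ∑ b, ∑ c, if a ∈ F y ∧ b ∈ F z ∧ c ∈ F x then w a b else 0 := by
  rw [splitCost, Finset.mul_sum]
  congr 1
  rw [← Finset.sum_subset (Finset.subset_univ (F y)) fun a _ ha => by simp [ha]]
  refine Finset.sum_congr rfl fun a ha => ?_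
  rw [Finset.mul_sum, ← Finset.sum_subset (Finset.subset_univ (F z)) fun b _ hb => by simp [hb]]
  refine Finset.sum_congr rfl fun b hb => ?_
  simp [ha, hb, Finset.sum_ite_mem]

end PartialTable

namespace RAM

/-- The sums of the memberships decide whether `F x` is the disjoint union of `F y` and `F z`. -/
theorem disjoint_union_iff {n : ℕ} {s : State} (hs : FamilyOk n s) (x y z : ℕ) :
    (∀ v < n, s.arr arr_mem (x * n + v) = s.arr arr_mem (y * n + v) + s.arr arr_mem (z * n + v)) ↔
      Disjoint (s.family n y) (s.family n z) ∧ s.family n x = s.family n y ∪ s.family n z := by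
  constructor
  · intro h
    have h' : ∀ v : Fin n, (if v ∈ s.family n x then 1 else 0) =
        (if v ∈ s.family n y then 1 else 0) + if v ∈ s.family n z then 1 else 0 := fun v => by
      rw [← State.mem_eq_ite hs, ← State.mem_eq_ite hs, ← State.mem_eq_ite hs]
      exact h v v.2
    refine ⟨Finset.disjoint_left.2 fun v hy hz => ?_, Finset.ext fun v => ?_⟩
    · have := h' v
      rw [if_pos hy, if_pos hz] at this
      split_ifs at this
      omega
    · rw [Finset.mem_union]
      have := h' v
      clear h h'
      by_cases hx : v ∈ s.family n x <;> by_cases hy : v ∈ s.family n y <;>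
        by_cases hz : v ∈ s.family n z <;> simp [hx, hy, hz] at this ⊢
  · rintro ⟨hd, hu⟩ v hv
    have e1 := State.mem_eq_ite hs x ⟨v, hv⟩
    have e2 := State.mem_eq_ite hs y ⟨v, hv⟩
    have e3 := State.mem_eq_ite hs z ⟨v, hv⟩
    simp only at e1 e2 e3
    rw [e1, e2, e3]
    have hmem : (⟨v, hv⟩ : Fin n) ∈ s.family n x ↔
        (⟨v, hv⟩ : Fin n) ∈ s.family n y ∨ (⟨v, hv⟩ : Fin n) ∈ s.family n z := by
      rw [hu, Finset.mem_union]
    have hdis : ∀ a, a ∈ s.family n y → a ∉ s.family n z := fun _ h =>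
      Finset.disjoint_left.1 hd h
    by_cases hy : (⟨v, hv⟩ : Fin n) ∈ s.family n y <;>
      by_cases hz : (⟨v, hv⟩ : Fin n) ∈ s.family n z <;> simp [hmem, hy, hz]
    exact hdis _ hy hz

namespace Prog

/-- Computes a number that vanishes if and only if `F x` is the disjoint union of `F y` and
`F z`. -/
def splitProg : Prog :=
  .seq (.assign reg_acc (.lit 0))
    (.forTo reg_v reg_n (.assign reg_acc (.add (.var reg_acc)
      (.add
        (.sub (.load arr_mem (.idx reg_x reg_v))
          (.add (.load arr_mem (.idx reg_y reg_v)) (.load arr_mem (.idx reg_z reg_v))))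
        (.sub (.add (.load arr_mem (.idx reg_y reg_v)) (.load arr_mem (.idx reg_z reg_v)))
          (.load arr_mem (.idx reg_x reg_v)))))))

theorem run_splitProg (E : Env) {n m B : ℕ} {s : State} (hs : Sized n m B s) (hok : FamilyOk n s)
    {x y z : ℕ} (hx : s.var reg_x = x) (hy : s.var reg_y = y) (hz : s.var reg_z = z) (hxB : x < B)
    (hyB : y < B) (hzB : z < B) :
    (splitProg.run E s).var reg_acc = 0 ↔
      Disjoint (s.family n y) (s.family n z) ∧ s.family n x = s.family n y ∪ s.family n z := by
  rw [← disjoint_union_iff hok, splitProg, run_seq]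
  obtain ⟨s', h1, hF, h2⟩ := run_forTo (E := E) (s := (Prog.assign reg_acc (.lit 0)).run E s)
    (i := reg_v) (b := reg_n) (P := (.assign reg_acc (.add (.var reg_acc)
      (.add
        (.sub (.load arr_mem (.idx reg_x reg_v))
          (.add (.load arr_mem (.idx reg_y reg_v)) (.load arr_mem (.idx reg_z reg_v))))
        (.sub (.add (.load arr_mem (.idx reg_y reg_v)) (.load arr_mem (.idx reg_z reg_v)))
          (.load arr_mem (.idx reg_x reg_v)))))))
    (fun k s' => s'.var reg_acc = 0 ↔ ∀ v < k, s.arr arr_mem (x * n + v) =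
      s.arr arr_mem (y * n + v) + s.arr arr_mem (z * n + v)) (by simp [run])
    (by
      intro k s' hk hF ih
      have hx' : s'.var reg_x = x := (hF.var _ (by decide)).trans (by simpa [run])
      have hy' : s'.var reg_y = y := (hF.var _ (by decide)).trans (by simpa [run])
      have hz' : s'.var reg_z = z := (hF.var _ (by decide)).trans (by simpa [run])
      have hr' : s'.arr arr_row = s.arr arr_row := (hF.arr _ (by decide)).trans (by simp [run])
      have hm' : s'.arr arr_mem = s.arr arr_mem := (hF.arr _ (by decide)).trans (by simp [run])
      rw [Nat.forall_lt_succ_right, ← ih]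
      simp only [run, AExpr.eval, AExpr.eval_idx, State.setVar_var, State.setVar_arr, if_true,
        show ((5 : ℕ) = 7) = False by simp, show ((10 : ℕ) = 7) = False by simp,
        show ((11 : ℕ) = 7) = False by simp, show ((12 : ℕ) = 7) = False by simp, if_false,
        hx', hy', hz', hr', hm', hs.row _ hxB, hs.row _ hyB, hs.row _ hzB]
      omega)
  rw [h1]
  simpa [run, hs.n_eq] using h2

/-- Computes the cost of a split. -/
def costProg : Prog :=
  .seq (.wstore warr_acc (.lit 0)
      (.add (.load warr_val (.var reg_y)) (.load warr_val (.var reg_z))))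
    (.forTo reg_u reg_n (.forTo reg_v reg_n (.forTo reg_t reg_n
      (.ite (.conj (.eq (.load arr_mem (.idx reg_y reg_u)) (.lit 1))
          (.conj (.eq (.load arr_mem (.idx reg_z reg_v)) (.lit 1))
            (.eq (.load arr_mem (.idx reg_x reg_t)) (.lit 1))))
        (.wstore warr_acc (.lit 0)
          (.add (.load warr_acc (.lit 0)) (.edge (.var reg_u) (.var reg_v))))
        .skip))))

theorem run_costProg (E : Env) {n m B : ℕ} {s : State} (hs : Sized n m B s)
    {x y z : ℕ} (hx : s.var reg_x = x) (hy : s.var reg_y = y) (hz : s.var reg_z = z) (hxB : x < B)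
    (hyB : y < B) (hzB : z < B) :
    (costProg.run E s).warr warr_acc 0 =
      splitCost (fun a b : Fin n => E.edge a b) (s.family n) (s.warr warr_val) x y z := by
  set f : ℕ → ℕ → ℕ → ℝ := fun u v t => if s.arr arr_mem (y * n + u) = 1 ∧
    s.arr arr_mem (z * n + v) = 1 ∧ s.arr arr_mem (x * n + t) = 1 then E.edge u v else 0 with hf
  have hsum : splitCost (fun a b : Fin n => E.edge a b) (s.family n) (s.warr warr_val) x y z =
      s.warr warr_val y + s.warr warr_val z +
        ∑ u ∈ Finset.range n, ∑ v ∈ Finset.range n, ∑ t ∈ Finset.range n, f u v t := by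
    rw [splitCost_eq_sum, Finset.sum_range]
    congr 1
    refine Finset.sum_congr rfl fun a _ => ?_
    rw [Finset.sum_range]
    refine Finset.sum_congr rfl fun b _ => ?_
    rw [Finset.sum_range]
    refine Finset.sum_congr rfl fun c _ => ?_
    simp only [State.mem_family, hf]
  rw [hsum, costProg, run_seq]
  have hx₀ : ((Prog.wstore warr_acc (.lit 0) (.add (.load warr_val (.var reg_y))
      (.load warr_val (.var reg_z)))).run E s).var = s.var := by simp [run]
  have ha₀ : ((Prog.wstore warr_acc (.lit 0) (.add (.load warr_val (.var reg_y))
      (.load warr_val (.var reg_z)))).run E s).arr = s.arr := by simp [run]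
  have hw₀ : ((Prog.wstore warr_acc (.lit 0) (.add (.load warr_val (.var reg_y))
      (.load warr_val (.var reg_z)))).run E s).warr warr_acc 0 =
      s.warr warr_val y + s.warr warr_val z := by simp [run, hy, hz]
  generalize (Prog.wstore warr_acc (.lit 0) (.add (.load warr_val (.var reg_y))
      (.load warr_val (.var reg_z)))).run E s = s₀ at hx₀ ha₀ hw₀
  obtain ⟨s', h1, hF, h2⟩ := run_forTo (E := E) (s := s₀) (i := reg_u) (b := reg_n)
    (P := (.forTo reg_v reg_n (.forTo reg_t reg_n
      (.ite (.conj (.eq (.load arr_mem (.idx reg_y reg_u)) (.lit 1))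
          (.conj (.eq (.load arr_mem (.idx reg_z reg_v)) (.lit 1))
            (.eq (.load arr_mem (.idx reg_x reg_t)) (.lit 1))))
        (.wstore warr_acc (.lit 0)
          (.add (.load warr_acc (.lit 0)) (.edge (.var reg_u) (.var reg_v))))
        .skip))))
    (fun k s' => s'.warr warr_acc 0 = s.warr warr_val y + s.warr warr_val z +
      ∑ u ∈ Finset.range k, ∑ v ∈ Finset.range n, ∑ t ∈ Finset.range n, f u v t)
    (by simpa using hw₀)
    (by
      intro k s' hk hF ih
      have hn' : s'.var reg_n = n := by rw [hF.var _ (by decide), hx₀, hs.n_eq]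
      obtain ⟨s₁, h1, hF₁, h2⟩ := run_forTo (E := E) (s := s'.setVar reg_u k) (i := reg_v)
        (b := reg_n)
        (P := (.forTo reg_t reg_n
          (.ite (.conj (.eq (.load arr_mem (.idx reg_y reg_u)) (.lit 1))
              (.conj (.eq (.load arr_mem (.idx reg_z reg_v)) (.lit 1))
                (.eq (.load arr_mem (.idx reg_x reg_t)) (.lit 1))))
            (.wstore warr_acc (.lit 0)
              (.add (.load warr_acc (.lit 0)) (.edge (.var reg_u) (.var reg_v))))
            .skip)))
        (fun k₂ s₁ => s₁.warr warr_acc 0 = s.warr warr_val y + s.warr warr_val z +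
          ∑ u ∈ Finset.range k, ∑ v ∈ Finset.range n, ∑ t ∈ Finset.range n, f u v t +
          ∑ v ∈ Finset.range k₂, ∑ t ∈ Finset.range n, f k v t)
        (by simpa using ih)
        (by
          intro k₂ s₁ hk₂ hF₁ ih
          have hn₁ : s₁.var reg_n = n := by rw [hF₁.var _ (by decide)]; simpa using hn'
          obtain ⟨s₂, h1, hF₂, h2⟩ := run_forTo (E := E) (s := s₁.setVar reg_v k₂) (i := reg_t)
            (b := reg_n)
            (P := (.ite (.conj (.eq (.load arr_mem (.idx reg_y reg_u)) (.lit 1))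
                  (.conj (.eq (.load arr_mem (.idx reg_z reg_v)) (.lit 1))
                    (.eq (.load arr_mem (.idx reg_x reg_t)) (.lit 1))))
                (.wstore warr_acc (.lit 0)
                  (.add (.load warr_acc (.lit 0)) (.edge (.var reg_u) (.var reg_v))))
                .skip))
            (fun k₃ s₂ => s₂.warr warr_acc 0 = s.warr warr_val y + s.warr warr_val z +
              ∑ u ∈ Finset.range k, ∑ v ∈ Finset.range n, ∑ t ∈ Finset.range n, f u v t +
              ∑ v ∈ Finset.range k₂, ∑ t ∈ Finset.range n, f k v t +
              ∑ t ∈ Finset.range k₃, f k k₂ t)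
            (by simpa using ih)
            (by
              intro k₃ s₂ hk₃ hF₂ ih
              have hu₂ : s₂.var reg_u = k := by
                rw [hF₂.var _ (by decide), State.setVar_var, if_neg (by decide),
                  hF₁.var _ (by decide)]
                simp
              have hv₂ : s₂.var reg_v = k₂ := by rw [hF₂.var _ (by decide)]; simp
              have hvar : ∀ r, r = reg_x ∨ r = reg_y ∨ r = reg_z → s₂.var r = s.var r := by
                rintro r (rfl | rfl | rfl) <;>
                rw [hF₂.var _ (by decide), State.setVar_var, if_neg (by decide),
                  hF₁.var _ (by decide), State.setVar_var, if_neg (by decide),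
                  hF.var _ (by decide), hx₀]
              have ha₂ : s₂.arr = s.arr := by
                funext a
                rw [hF₂.arr _ (by simp [arrs]), State.setVar_arr, hF₁.arr _ (by simp [arrs]),
                  State.setVar_arr, hF.arr _ (by simp [arrs]), ha₀]
              have hx₂ := (hvar reg_x (by simp)).trans hx
              have hy₂ := (hvar reg_y (by simp)).trans hy
              have hz₂ := (hvar reg_z (by simp)).trans hz
              rw [Finset.sum_range_succ, ← add_assoc, ← ih]
              simp only [run, Test.Holds, Test.holds_eq, AExpr.eval, AExpr.eval_idx,
                State.setVar_var, State.setVar_arr, if_true, show ((6 : ℕ) = 13) = False by simp,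
                show ((7 : ℕ) = 13) = False by simp, show ((10 : ℕ) = 13) = False by simp,
                show ((11 : ℕ) = 13) = False by simp, show ((12 : ℕ) = 13) = False by simp,
                if_false, hx₂, hy₂, hz₂, hu₂, hv₂, ha₂, hs.row _ hxB, hs.row _ hyB, hs.row _ hzB,
                hf]
              split_ifs <;> simp [hu₂, hv₂])
          rw [h1]
          rw [State.setVar_var, if_neg (by decide), hn₁] at h2
          rw [Finset.sum_range_succ, ← add_assoc]
          exact h2)
      rw [h1]
      rw [State.setVar_var, if_neg (by decide), hn'] at h2
      rw [Finset.sum_range_succ, ← add_assoc]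
      exact h2)
  rw [h1]
  rw [hx₀, hs.n_eq] at h2
  exact h2

end Prog
end RAM

namespace RAM

/-- The states have the same table entries, except possibly at `x`. -/
structure AgreeOff (x : ℕ) (s s' : State) : Prop where
  ok : ∀ y, y ≠ x → s'.arr arr_ok y = s.arr arr_ok y
  left : ∀ y, y ≠ x → s'.arr arr_left y = s.arr arr_left y
  right : ∀ y, y ≠ x → s'.arr arr_right y = s.arr arr_right y
  val : ∀ y, y ≠ x → s'.warr warr_val y = s.warr warr_val y

theorem AgreeOff.refl (x : ℕ) (s : State) : AgreeOff x s s :=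
  ⟨fun _ _ => rfl, fun _ _ => rfl, fun _ _ => rfl, fun _ _ => rfl⟩

theorem AgreeOff.trans {x : ℕ} {s₁ s₂ s₃ : State} (h : AgreeOff x s₁ s₂) (h' : AgreeOff x s₂ s₃) :
    AgreeOff x s₁ s₃ :=
  ⟨fun y hy => (h'.ok y hy).trans (h.ok y hy), fun y hy => (h'.left y hy).trans (h.left y hy),
    fun y hy => (h'.right y hy).trans (h.right y hy), fun y hy => (h'.val y hy).trans (h.val y hy)⟩

theorem AgreeOff.setVar {x : ℕ} {s s' : State} (h : AgreeOff x s s') (i k : ℕ) :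
    AgreeOff x s (s'.setVar i k) :=
  ⟨h.ok, h.left, h.right, h.val⟩

/-- The entries at `x` of the table in the memory, while only the splits in `P` have been tried. -/
def State.PartialAt {n : ℕ} (w : Fin n → Fin n → ℝ) (F : ℕ → Finset (Fin n)) (x : ℕ)
    (P : ℕ → ℕ → Prop) (s : State) : Prop :=
  _root_.PartialAt w F (s.arr arr_ok) (s.arr arr_left) (s.arr arr_right) (s.warr warr_val) x P

/-- The entries at `x` of the table in the memory are final. -/
def State.TableAt {n : ℕ} (w : Fin n → Fin n → ℝ) (F : ℕ → Finset (Fin n)) (leaf : ℕ → ℕ) (x : ℕ)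
    (s : State) : Prop :=
  _root_.TableAt w F leaf (s.arr arr_ok) (s.arr arr_left) (s.arr arr_right) (s.warr warr_val) x

theorem State.TableAt.agree {n : ℕ} {w : Fin n → Fin n → ℝ} {F : ℕ → Finset (Fin n)}
    {leaf : ℕ → ℕ} {x k : ℕ} {s s' : State} (h : s.TableAt w F leaf x) (hA : AgreeOff k s s')
    (hx : x < k) : s'.TableAt w F leaf x :=
  _root_.TableAt.congr h (fun y hy => hA.ok y (by omega)) (fun y hy => hA.left y (by omega))
    (fun y hy => hA.right y (by omega)) (fun y hy => hA.val y (by omega))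

theorem State.family_congr {n : ℕ} {s s' : State} (h : s'.arr arr_mem = s.arr arr_mem) :
    s'.family n = s.family n := by
  funext x
  simp only [State.family, h]

theorem FamilyOk.congr {n : ℕ} {s s' : State} (hs : FamilyOk n s)
    (hm : s'.arr arr_mem = s.arr arr_mem) (hl : s'.arr arr_leaf = s.arr arr_leaf)
    (hc : s'.var reg_cur = s.var reg_cur) : FamilyOk n s' :=
  ⟨fun j => by rw [hm]; exact hs.le_one j, fun x hx => by
    rw [hl] at hx ⊢
    rw [hc, State.family_congr hm]
    exact hs.leaf x hx⟩

namespace Prog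

/-- Stores the split into `F y` and `F z` as the best one of `F x`. -/
def updateProg : Prog :=
  .seq (.wstore warr_val (.var reg_x) (.load warr_acc (.lit 0)))
    (.seq (.store arr_left (.var reg_x) (.var reg_y))
      (.seq (.store arr_right (.var reg_x) (.var reg_z))
        (.store arr_ok (.var reg_x) (.lit 1))))

/-- Tries the split of `F x` into `F y` and `F z`. -/
def tryProg : Prog :=
  .ite (.conj (.lt (.var reg_y) (.var reg_x)) (.conj (.lt (.var reg_z) (.var reg_x))
      (.conj (.lt (.lit 0) (.load arr_ok (.var reg_y))) (.lt (.lit 0) (.load arr_ok (.var reg_z))))))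
    (.seq splitProg (.ite (.eq (.var reg_acc) (.lit 0))
      (.seq costProg
        (.ite (.neg (.conj (.lt (.lit 0) (.load arr_ok (.var reg_x)))
            (.neg (.wlt (.load warr_acc (.lit 0)) (.load warr_val (.var reg_x))))))
          updateProg .skip))
      .skip))
    .skip

theorem run_tryProg (E : Env) {n m B : ℕ} {s : State} (hs : Sized n m B s) (hok : FamilyOk n s)
    {x y z : ℕ} (hx : s.var reg_x = x) (hy : s.var reg_y = y) (hz : s.var reg_z = z) (hxB : x < B)
    (hyB : y < B) (hzB : z < B) {P Q : ℕ → ℕ → Prop}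
    (hP : s.PartialAt (fun a b : Fin n => E.edge a b) (s.family n) x P)
    (hQ : ∀ y' z', Q y' z' → P y' z' ∨ (y' = y ∧ z' = z)) :
    (tryProg.run E s).PartialAt (fun a b : Fin n => E.edge a b) (s.family n) x Q ∧
      AgreeOff x s (tryProg.run E s) := by
  rw [tryProg, run]
  simp only [Test.Holds, AExpr.eval, hx, hy, hz]
  split_ifs with hc
  swap
  · refine ⟨PartialAt.skip hP fun y' z' hq hsp hy' hz' => ?_, AgreeOff.refl _ _⟩
    rcases hQ y' z' hq with h | ⟨rfl, rfl⟩
    · exact .inl h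
    · exact absurd ⟨hsp.1, hsp.2.1, Nat.pos_of_ne_zero hy', Nat.pos_of_ne_zero hz'⟩ hc
  obtain ⟨hyx, hzx, hoy, hoz⟩ := hc
  have hsplit := run_splitProg E hs hok hx hy hz hxB hyB hzB
  have hF₁ := frame_run E splitProg s
  rw [run_seq]
  generalize splitProg.run E s = s₁ at hsplit hF₁
  have a₁ : ∀ a, s₁.arr a = s.arr a := fun a => hF₁.arr a (by simp [splitProg, arrs])
  have w₁ : ∀ a, s₁.warr a = s.warr a := fun a => hF₁.warr a (by simp [splitProg, warrs])
  have x₁ : s₁.var reg_x = x := (hF₁.var _ (by decide)).trans hx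
  have y₁ : s₁.var reg_y = y := (hF₁.var _ (by decide)).trans hy
  have z₁ : s₁.var reg_z = z := (hF₁.var _ (by decide)).trans hz
  have hs₁ : Sized n m B s₁ := hF₁.sized (by decide) hs
  have f₁ : s₁.family n = s.family n := State.family_congr (a₁ _)
  have hA₁ : AgreeOff x s s₁ := ⟨fun _ _ => by rw [a₁], fun _ _ => by rw [a₁],
    fun _ _ => by rw [a₁], fun _ _ => by rw [w₁]⟩
  have hP₁ : s₁.PartialAt (fun a b : Fin n => E.edge a b) (s.family n) x P := by
    rw [State.PartialAt, a₁, a₁, a₁, w₁]; exact hP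
  rw [run]
  simp only [Test.holds_eq, AExpr.eval]
  split_ifs with hc
  swap
  · refine ⟨PartialAt.skip hP₁ fun y' z' hq hsp hy' hz' => ?_, hA₁⟩
    rcases hQ y' z' hq with h | ⟨rfl, rfl⟩
    · exact .inl h
    · exact absurd (hsplit.2 hsp.2.2) hc
  have hsp : IsSplit (s.family n) x y z := ⟨hyx, hzx, hsplit.1 hc⟩
  have hcost := run_costProg E hs₁ x₁ y₁ z₁ hxB hyB hzB
  have hF₂ := frame_run E costProg s₁
  rw [run_seq]
  generalize costProg.run E s₁ = s₂ at hcost hF₂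
  have a₂ : ∀ a, s₂.arr a = s.arr a := fun a => (hF₂.arr a (by simp [costProg, arrs])).trans (a₁ a)
  have w₂ : s₂.warr warr_val = s.warr warr_val := (hF₂.warr _ (by decide)).trans (w₁ _)
  have x₂ : s₂.var reg_x = x := (hF₂.var _ (by decide)).trans x₁
  have y₂ : s₂.var reg_y = y := (hF₂.var _ (by decide)).trans y₁
  have z₂ : s₂.var reg_z = z := (hF₂.var _ (by decide)).trans z₁
  rw [f₁, w₁] at hcost
  rw [run]
  simp only [Test.Holds, AExpr.eval, WExpr.eval, x₂, hcost, w₂, a₂]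
  split_ifs with hc
  swap
  · refine ⟨?_, ?_⟩
    · have := PartialAt.update hP hsp hoy.ne' hoz.ne' (by
        by_cases h0 : s.arr arr_ok x = 0
        · exact .inl h0
        · right
          by_contra hlt
          exact hc ⟨Nat.pos_of_ne_zero h0, hlt⟩) hQ
      rw [State.PartialAt]
      simpa [updateProg, run, x₂, y₂, z₂, a₂, w₂, hcost] using this
    · constructor <;> intro y' hy' <;> simp [updateProg, run, x₂, y₂, z₂, a₂, w₂, hy']
  · refine ⟨?_, ⟨fun _ _ => by rw [run, a₂], fun _ _ => by rw [run, a₂],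
      fun _ _ => by rw [run, a₂], fun _ _ => by rw [run, w₂]⟩⟩
    rw [State.PartialAt, run, a₂, a₂, a₂, w₂]
    refine PartialAt.skip hP fun y' z' hq _ _ _ => ?_
    rcases hQ y' z' hq with h | ⟨rfl, rfl⟩
    · exact .inl h
    · exact .inr ⟨hc.1.ne', not_lt.1 hc.2⟩

/-- Tries all splits of `F x`. -/
def bestProg : Prog := .forTo reg_y reg_big (.forTo reg_z reg_big tryProg)

theorem run_bestProg (E : Env) {n m B : ℕ} {s : State} (hs : Sized n m B s) (hok : FamilyOk n s)
    {x : ℕ} (hx : s.var reg_x = x) (hxB : x < B) (h0 : s.arr arr_ok x = 0) :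
    (bestProg.run E s).PartialAt (fun a b : Fin n => E.edge a b) (s.family n) x
        (fun y z => y < B ∧ z < B) ∧ AgreeOff x s (bestProg.run E s) := by
  rw [bestProg]
  obtain ⟨s', h1, hF, h2, h3⟩ := run_forTo (E := E) (s := s) (i := reg_y) (b := reg_big)
    (P := .forTo reg_z reg_big tryProg)
    (fun k s' => s'.PartialAt (fun a b : Fin n => E.edge a b) (s.family n) x
      (fun y z => y < k ∧ z < B) ∧ AgreeOff x s s')
    ⟨⟨fun h => absurd h0 h, fun y z h => absurd h.1 (by omega)⟩, AgreeOff.refl _ _⟩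
    (by
      rintro k s' hk hF ⟨ih1, ih2⟩
      rw [hs.big_eq] at hk
      have hs' := (hF.sized (by decide) hs).setVar (x := reg_y) (by decide) k
      have hok' : FamilyOk n (s'.setVar reg_y k) := (hok.congr (hF.arr _ (by decide))
        (hF.arr _ (by decide)) (hF.var _ (by decide))).setVar (by decide)
      have hf' : s'.family n = s.family n := State.family_congr (hF.arr _ (by decide))
      have hx' : s'.var reg_x = x := (hF.var _ (by decide)).trans hx
      obtain ⟨s₁, h1, hF₁, h2, h3⟩ := run_forTo (E := E) (s := s'.setVar reg_y k)
        (i := reg_z) (b := reg_big) (P := tryProg)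
        (fun k' s₁ => s₁.PartialAt (fun a b : Fin n => E.edge a b) (s.family n) x
          (fun y z => y < k ∧ z < B ∨ y = k ∧ z < k') ∧ AgreeOff x s s₁)
        ⟨PartialAt.skip ih1 fun y z h _ _ _ => .inl (by omega), ih2.setVar _ _⟩
        (by
          rintro k' s₁ hk' hF₁ ⟨ih1, ih2⟩
          rw [hs'.big_eq] at hk'
          have hs₁ := (hF₁.sized (by decide) hs').setVar (x := reg_z) (by decide) k'
          have hok₁ : FamilyOk n (s₁.setVar reg_z k') := (hok'.congr (hF₁.arr _ (by decide))
            (hF₁.arr _ (by decide)) (hF₁.var _ (by decide))).setVar (by decide)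
          have hf₁ : (s₁.setVar reg_z k').family n = s.family n :=
            (State.family_congr (hF₁.arr _ (by decide))).trans hf'
          have hx₁ : (s₁.setVar reg_z k').var reg_x = x := by
            rw [State.setVar_var, if_neg (by decide), hF₁.var _ (by decide), State.setVar_var,
              if_neg (by decide), hx']
          have hy₁ : (s₁.setVar reg_z k').var reg_y = k := by
            rw [State.setVar_var, if_neg (by decide), hF₁.var _ (by decide), State.setVar_var,
              if_pos rfl]
          have := run_tryProg E hs₁ hok₁ hx₁ hy₁ (z := k') (by simp) hxB hk hk'
            (P := fun y z => y < k ∧ z < B ∨ y = k ∧ z < k')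
            (Q := fun y z => y < k ∧ z < B ∨ y = k ∧ z < k' + 1) (by rw [hf₁]; exact ih1)
            (fun y z h => by omega)
          rw [hf₁] at this
          exact ⟨this.1, ih2.trans ⟨this.2.ok, this.2.left, this.2.right, this.2.val⟩⟩)
      rw [h1]
      rw [hs'.big_eq] at h2
      exact ⟨PartialAt.skip h2 fun y z h _ _ _ => .inl (by omega), h3.setVar _ _⟩)
  rw [h1]
  rw [hs.big_eq] at h2
  exact ⟨h2, h3.setVar _ _⟩

/-- Fills the table of best splits. -/
def tableProg : Prog :=
  .forTo reg_x reg_big (.ite (.lt (.lit 0) (.load arr_leaf (.var reg_x)))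
    (.seq (.store arr_ok (.var reg_x) (.lit 1)) (.wstore warr_val (.var reg_x) .zero))
    bestProg)

theorem run_tableProg (E : Env) {n m B : ℕ} {s : State} (hs : Sized n m B s) (hok : FamilyOk n s)
    (h0 : ∀ x, s.arr arr_ok x = 0) {x : ℕ} (hx : x < B) :
    (tableProg.run E s).TableAt (fun a b : Fin n => E.edge a b) (s.family n) (s.arr arr_leaf) x := by
  rw [tableProg]
  obtain ⟨s', h1, hF, h2, -⟩ := run_forTo (E := E) (s := s) (i := reg_x) (b := reg_big)
    (P := .ite (.lt (.lit 0) (.load arr_leaf (.var reg_x)))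
      (.seq (.store arr_ok (.var reg_x) (.lit 1)) (.wstore warr_val (.var reg_x) .zero))
      bestProg)
    (fun k s' => (∀ x < k, s'.TableAt (fun a b : Fin n => E.edge a b) (s.family n)
      (s.arr arr_leaf) x) ∧ ∀ x, k ≤ x → s'.arr arr_ok x = 0)
    ⟨fun x hx => absurd hx (by omega), fun x _ => h0 x⟩
    (by
      rintro k s' hk hF ⟨ih1, ih2⟩
      rw [hs.big_eq] at hk
      have hs' := (hF.sized (by decide) hs).setVar (x := reg_x) (by decide) k
      have hok' : FamilyOk n (s'.setVar reg_x k) := (hok.congr (hF.arr _ (by decide))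
        (hF.arr _ (by decide)) (hF.var _ (by decide))).setVar (by decide)
      have hf' : (s'.setVar reg_x k).family n = s.family n :=
        State.family_congr (hF.arr _ (by decide))
      have hl' : (s'.setVar reg_x k).arr arr_leaf = s.arr arr_leaf := hF.arr _ (by decide)
      have hx' : (s'.setVar reg_x k).var reg_x = k := by simp
      have ih1' : ∀ x < k, (s'.setVar reg_x k).TableAt (fun a b : Fin n => E.edge a b) (s.family n)
        (s.arr arr_leaf) x := ih1
      have ih2' : ∀ x, k ≤ x → (s'.setVar reg_x k).arr arr_ok x = 0 := ih2
      generalize s'.setVar reg_x k = s₁ at hs' hok' hf' hl' hx' ih1' ih2'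
      -- it is enough to treat the entry at `k`
      suffices ∀ s₂, AgreeOff k s₁ s₂ → s₂.TableAt (fun a b : Fin n => E.edge a b) (s.family n)
          (s.arr arr_leaf) k → (∀ x < k + 1, s₂.TableAt (fun a b : Fin n => E.edge a b)
          (s.family n) (s.arr arr_leaf) x) ∧ ∀ x, k + 1 ≤ x → s₂.arr arr_ok x = 0 by
        rw [run]
        simp only [Test.Holds, AExpr.eval, hl', hx']
        split_ifs with hc
        · refine this _ ?_ ?_
          · constructor <;> intro y hy <;> simp [run, hx', hy]
          · exact ⟨fun _ => by simp [run, hx'], fun h => absurd h hc.ne',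
              fun h => absurd h hc.ne'⟩
        · obtain ⟨g1, g2⟩ := run_bestProg E hs' hok' hx' hk (ih2' k le_rfl)
          rw [hf'] at g1
          exact this _ g2 ⟨fun h => absurd (Nat.pos_of_ne_zero h) hc, fun _ => g1.sound,
            fun _ y z h => g1.best y z ⟨h.1.trans hk, h.2.1.trans hk⟩ h⟩
      intro s₂ hA hT
      refine ⟨fun x hx => ?_, fun x hx => ?_⟩
      · rcases (Nat.lt_succ_iff_lt_or_eq.1 hx) with hx | rfl
        · exact (ih1' x hx).agree hA hx
        · exact hT
      · rw [hA.ok x (by omega), ih2' x (by omega)])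
  rw [h1]
  exact h2 x (hs.big_eq.symm ▸ hx)

end Prog
end RAM

/-! ### Writing the tree -/

theorem HCTree.length_code {n : ℕ} (T : HCTree (Fin n)) :
    T.code.length + 1 = 2 * T.leafList.length := by
  induction T with
  | leaf v => simp [code, leafList]
  | node l r ihl ihr => simp [code, leafList]; omega

/-- The cells `0, …, L.length - 1` of a stack hold indices related to the elements of `L`; the head
of `L` is on the top. -/
def Stacked {α : Type*} (R : ℕ → α → Prop) (stack : ℕ → ℕ) : List α → Prop
  | [] => True
  | T :: L => R (stack L.length) T ∧ Stacked R stack L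

theorem Stacked.congr {α : Type*} {R : ℕ → α → Prop} {stack stack' : ℕ → ℕ} {L : List α}
    (h : Stacked R stack L) (hst : ∀ j < L.length, stack' j = stack j) : Stacked R stack' L := by
  induction L with
  | nil => trivial
  | cons T L ih =>
    rw [List.length_cons] at hst
    exact ⟨by rw [hst _ (by omega)]; exact h.1, ih h.2 fun j hj => hst j (by omega)⟩

namespace RAM.Prog

/-- Pops an index from the stack, writes the first symbol of the code of its tree, and pushes the
indices of the subtrees. -/
def popProg : Prog :=
  .ite (.lt (.lit 0) (.var reg_top))
    (.seq (.assign reg_top (.sub (.var reg_top) (.lit 1)))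
      (.seq (.assign reg_x (.load arr_stack (.var reg_top)))
        (.seq (.emit (.load arr_leaf (.var reg_x)))
          (.ite (.lt (.lit 0) (.load arr_leaf (.var reg_x)))
            .skip
            (.seq (.store arr_stack (.var reg_top) (.load arr_right (.var reg_x)))
              (.seq (.store arr_stack (.add (.var reg_top) (.lit 1))
                  (.load arr_left (.var reg_x)))
                (.assign reg_top (.add (.var reg_top) (.lit 2)))))))))
    .skip

/-- Writes the preorder code of the tree at the last index. -/
def emitProg : Prog :=
  .seq (.assign reg_top (.lit 1))
    (.seq (.store arr_stack (.lit 0) (.sub (.var reg_cur) (.lit 1)))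
      (.forTo reg_i reg_big popProg))

theorem run_emitProg (E : Env) {n : ℕ} {s : State} {T : HCTree (Fin n)} (hout : s.out = [])
    (hT : Represents (s.arr arr_leaf) (s.arr arr_left) (s.arr arr_right) (s.var reg_cur - 1) T)
    (hB : T.code.length ≤ s.var reg_big) : (emitProg.run E s).out = T.code := by
  set R := Represents (n := n) (s.arr arr_leaf) (s.arr arr_left) (s.arr arr_right) with hR
  rw [emitProg, run_seq, run_seq]
  generalize hs₁ : (Prog.store arr_stack (.lit 0) (.sub (.var reg_cur) (.lit 1))).run E
    ((Prog.assign reg_top (.lit 1)).run E s) = s₁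
  have ht₁ : s₁.var reg_top = 1 := by rw [← hs₁]; simp [run]
  have hst₁ : s₁.arr arr_stack 0 = s.var reg_cur - 1 := by rw [← hs₁]; simp [run]
  have ho₁ : s₁.out = [] := by rw [← hs₁]; simp [run, hout]
  have hb₁ : s₁.var reg_big = s.var reg_big := by rw [← hs₁]; simp [run]
  have ha₁ : ∀ a, a ≠ arr_stack → s₁.arr a = s.arr a := by
    intro a ha
    rw [← hs₁]; simp [run, ha]
  clear hs₁
  obtain ⟨s', h1, hF, L, h2, h3, h4, h5⟩ := run_forTo (E := E) (s := s₁) (i := reg_i)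
    (b := reg_big) (P := popProg)
    (fun k s' => ∃ L : List (HCTree (Fin n)), s'.var reg_top = L.length ∧
      Stacked R (s'.arr arr_stack) L ∧ s'.out ++ L.flatMap HCTree.code = T.code ∧
      (L = [] ∨ s'.out.length = k))
    ⟨[T], by simp [ht₁], ⟨by simpa [hst₁] using hT, trivial⟩, by simp [ho₁], by simp [ho₁]⟩
    (by
      rintro k s' hk hF ⟨L, h2, h3, h4, h5⟩
      have ha' : ∀ a, a ≠ arr_stack → s'.arr a = s.arr a := fun a ha =>
        (hF.arr a (by simpa [popProg, arrs] using ha)).trans (ha₁ a ha)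
      cases L with
      | nil => exact ⟨[], by simp [popProg, run, h2], trivial, by simpa [popProg, run, h2] using h4,
          .inl rfl⟩
      | cons U L =>
        obtain ⟨hU, h3⟩ := h3
        replace h5 : s'.out.length = k := h5.resolve_left (by simp)
        rw [List.length_cons] at h2
        have hlf := ha' arr_leaf (by decide)
        have hlt := ha' arr_left (by decide)
        have hrt := ha' arr_right (by decide)
        cases hU with
        | leaf h =>
          rename_i v
          refine ⟨L, ?_, ?_, ?_, ?_⟩
          · simp [popProg, run, h2, hlf, h]
          · simpa [popProg, run, h2, hlf, h] using h3
          · simpa [popProg, run, h2, hlf, h, HCTree.code] using h4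
          · simp [popProg, run, h2, hlf, h, h5]
        | node h hl hr =>
          rename_i l r
          refine ⟨l :: r :: L, ?_, ⟨?_, ?_, ?_⟩, ?_, ?_⟩
          · simp [popProg, run, h2, hlf, h]
          · simpa [popProg, run, h2, hlf, h, hlt] using hl
          · simpa [popProg, run, h2, hlf, h, hrt] using hr
          · refine h3.congr fun j hj => ?_
            simp [popProg, run, h2, hlf, h, hj.ne, (hj.trans (Nat.lt_succ_self _)).ne]
          · simpa [popProg, run, h2, hlf, h, HCTree.code] using h4
          · simp [popProg, run, h2, hlf, h, h5])
  rw [h1, State.setVar_out]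
  rcases h5 with rfl | h5
  · simpa using h4
  · cases L with
    | nil => simpa using h4
    | cons U L =>
      have := congrArg List.length h4
      have hU := U.length_code
      have hpos : 0 < U.leafList.length := by
        rw [List.length_pos_iff]
        intro h0
        have := HCTree.leaves_nonempty U
        rw [HCTree.leaves, h0] at this
        simp at this
      rw [List.length_append, List.flatMap_cons, List.length_append] at this
      omega

end RAM.Prog

/-! ### The algorithm -/

namespace RAM.Prog

/-- The clustering of the vertices by means of the estimated distances. -/
def clusterProg : Prog :=
  .seq initProg (.seq closeProg (.seq subsetsProg (.seq linkProg
    (.seq rootProg (.seq tableProg emitProg)))))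

theorem run_clusterProg (E : Env) {n m B : ℕ} (hn : 2 ≤ n) (hm : 1 ≤ m)
    (hB : n * 2 ^ m + n * (n * n) < B) {s : State} (hs : Sized n m B s) {G : WeightedGraph n}
    (hG : E.edge = G.entry) {T : HCTree (Fin n)} (hT : T.IsHC) {h : Fin n → Fin n → ℕ}
    (hE : Estimates T m h) (hh : ∀ u v : Fin n, s.arr arr_est (u * n + v) = h u v)
    (hcur : s.var reg_cur = 0) (hout : s.out = []) (hmem : ∀ x, s.arr arr_mem x = 0)
    (hleaf : ∀ x, s.arr arr_leaf x = 0) (hok : ∀ x, s.arr arr_ok x = 0) :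
    ∃ T' : HCTree (Fin n), (clusterProg.run E s).out = T'.code ∧ T'.IsHC ∧
      T'.cost G ≤ 2 * T.cost G := by
  have hpow : n * 1 ≤ n * 2 ^ m := Nat.mul_le_mul_left _ Nat.one_le_two_pow
  have hcube : n * 1 ≤ n * (n * n) := Nat.mul_le_mul_left _ (by nlinarith)
  simp only [clusterProg, run_seq]
  have hlab := run_initProg E (s := s) hs.n_eq
  have hF := frame_run E initProg s
  have hs₁ := hF.sized (by decide) hs
  have hh₁ : ∀ u v : Fin n, (initProg.run E s).arr arr_est (u * n + v) = h u v := fun u v => by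
    rw [hF.arr _ (by decide), hh]
  have c₁ := (hF.var reg_cur (by decide)).trans hcur
  have o₁ := (hF.out (by decide)).trans hout
  have m₁ := hF.arr arr_mem (by decide)
  have l₁ := hF.arr arr_leaf (by decide)
  have k₁ := hF.arr arr_ok (by decide)
  generalize initProg.run E s = s₁ at hlab hs₁ hh₁ c₁ o₁ m₁ l₁ k₁
  obtain ⟨hdiam, htog⟩ := run_closeProg E (by omega) hs₁ hT hm hE hh₁ hlab
  have hF := frame_run E closeProg s₁
  have hs₂ := hF.sized (by decide) hs₁
  have hh₂ : ∀ u v : Fin n, (closeProg.run E s₁).arr arr_est (u * n + v) = h u v := fun u v => by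
    rw [hF.arr _ (by decide), hh₁]
  have c₂ := (hF.var reg_cur (by decide)).trans c₁
  have o₂ := (hF.out (by decide)).trans o₁
  have m₂ := (hF.arr arr_mem (by decide)).trans m₁
  have l₂ := (hF.arr arr_leaf (by decide)).trans l₁
  have k₂ := (hF.arr arr_ok (by decide)).trans k₁
  generalize closeProg.run E s₁ = s₂ at hdiam htog hs₂ hh₂ c₂ o₂ m₂ l₂ k₂
  have hcard := card_labelClass_le hT hm hdiam
  have hok₂ : FamilyOk n s₂ := ⟨fun j => by rw [m₂, hmem]; omega, fun x hx => by
    rw [l₂, hleaf] at hx; exact absurd rfl hx⟩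
  obtain ⟨hok₃, hS⟩ := run_subsetsProg E hs₂ (by omega) hok₂ c₂ hcard
  have hF := frame_run E subsetsProg s₂
  have hs₃ := hF.sized (by decide) hs₂
  have hh₃ : ∀ u v : Fin n, (subsetsProg.run E s₂).arr arr_est (u * n + v) = h u v := fun u v => by
    rw [hF.arr _ (by decide), hh₂]
  have o₃ := (hF.out (by decide)).trans o₂
  have k₃ := (hF.arr arr_ok (by decide)).trans k₂
  have b₃ : (subsetsProg.run E s₂).labels n = s₂.labels n := by
    funext a
    rw [State.labels, hF.arr _ (by decide), State.labels]
  generalize subsetsProg.run E s₂ = s₃ at hok₃ hS hs₃ hh₃ o₃ k₃ b₃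
  have c₃ : s₃.var reg_cur ≤ n * 2 ^ m := hS.cur_le hcard
  have hL : LinkInv T (fun a b : Fin n => G.entry a b) m h 1 s₃ :=
    ⟨hok₃, b₃ ▸ hS.linkage hT G.entry_comm G.entry_nonneg hdiam htog⟩
  obtain ⟨hL₄, c₄⟩ := run_linkProg E hs₃ c₃ hB hT G.entry_comm G.entry_nonneg hm hE hh₃ hL
  have hF := frame_run E linkProg s₃
  have hs₄ := hF.sized (by decide) hs₃
  have o₄ := (hF.out (by decide)).trans o₃
  have k₄ := (hF.arr arr_ok (by decide)).trans k₃
  generalize linkProg.run E s₃ = s₄ at hL₄ c₄ hs₄ o₄ k₄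
  obtain ⟨hok₅, c₅, huniv, T', hD, hcost⟩ := run_rootProg E hs₄ (by omega) hn hE.le_n hL₄
  have hF := frame_run E rootProg s₄
  have hs₅ := hF.sized (by decide) hs₄
  have o₅ := (hF.out (by decide)).trans o₄
  have k₅ := (hF.arr arr_ok (by decide)).trans k₄
  generalize rootProg.run E s₄ = s₅ at hok₅ c₅ huniv hD hs₅ o₅ k₅
  have htab : ∀ x < B, _ := fun x hx =>
    run_tableProg E hs₅ hok₅ (fun y => by rw [k₅, hok]) (x := x) hx
  have hF := frame_run E tableProg s₅
  have hs₆ := hF.sized (by decide) hs₅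
  have o₆ := (hF.out (by decide)).trans o₅
  have c₆ := (hF.var reg_cur (by decide)).trans c₅
  have l₆ := hF.arr arr_leaf (by decide)
  generalize tableProg.run E s₅ = s₆ at htab hs₆ o₆ c₆ l₆
  have hroot : s₄.var reg_cur < B := by omega
  rw [hG] at htab
  obtain ⟨hne, hval⟩ := TableAt.le_nodeCost htab hroot hD
  obtain ⟨T'', hR, hnd, hlv, hc⟩ := TableAt.exists_represents htab
    (fun x _ hx => (hok₅.leaf x hx).2) hroot hne
  have hHC : T''.IsHC := ⟨hnd, fun v => by
    have : v ∈ T''.leaves := by rw [hlv, huniv]; exact Finset.mem_univ v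
    exact List.mem_toFinset.1 this⟩
  refine ⟨T'', run_emitProg E o₆ ?_ ?_, hHC, ?_⟩
  · rw [c₆, l₆, Nat.add_sub_cancel]; exact hR
  · have h1 := T''.length_code
    have h2 : T''.leafList.length = n := by
      rw [← List.toFinset_card_of_nodup hnd, ← HCTree.leaves, hHC.leaves_eq, Finset.card_univ,
        Fintype.card_fin]
    rw [hs₆.big_eq]
    omega
  · rw [G.cost_eq_nodeCost hHC, hc, G.two_mul_cost]
    exact hval.trans hcost

/-- Computes `m = unit * l`, where `n ≤ 2 ^ l`. -/
def sizeProg (unit : ℕ) : Prog := .seq (.assign reg_unit (.lit unit)) logProg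

/-- The resources of a program of loop depth at most `d` whose loop bounds are below `M`. -/
theorem exec_run_le (E : Env) (P : Prog) (hP : P.wf = true) (s : State) {N M d : ℕ}
    (hN : ∀ b ∈ P.bounds, s.var b ≤ N) (hM : N + 1 ≤ M) (hd : P.depth ≤ d) :
    ∃ t q, Exec E P.toCmd s (P.run E s) t q ∧ t ≤ P.time 1 * M ^ d ∧ q ≤ P.queries N := by
  obtain ⟨t, q, h, ht, hq⟩ := exec_run E P N (wf_spec hP).1 (wf_spec hP).2 s hN
  refine ⟨t, q, h, ht.trans ((time_le N P).trans (Nat.mul_le_mul_left _ ?_)), hq⟩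
  exact (Nat.pow_le_pow_left hM _).trans (Nat.pow_le_pow_right (by omega) hd)

/-- The computation of the sizes and of the multiples of `n`. -/
def prepareCmd (unit : ℕ) : Cmd :=
  .seq (sizeProg unit).toCmd (.seq powProg.toCmd (.seq bigProg.toCmd rowProg.toCmd))

theorem exec_prepareCmd (E : Env) (unit : ℕ) {n : ℕ} (hn : 1 ≤ n) : ∃ l B s t,
    n ≤ 2 ^ l ∧ 2 ^ l ≤ 2 * n ∧ B = 2 + n * (n * (2 ^ (unit * l) + n)) ∧
    Exec E (prepareCmd unit) (State.init n) s t 0 ∧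
    t ≤ ((sizeProg 0).time 1 + powProg.time 1 + bigProg.time 1 + rowProg.time 1) * (B + 1) ^ 2 ∧
    Sized n (unit * l) B s ∧ s.out = [] ∧ s.var reg_cur = 0 ∧
    ∀ a, a ≠ arr_row → ∀ x, s.arr a x = 0 := by
  set s₀ := (Prog.assign reg_unit (.lit unit)).run E (State.init n) with hs₀
  obtain ⟨l, hm, hl, hl'⟩ := run_logProg E s₀ (by simp [hs₀, run, State.init])
    (by simpa [hs₀, run, State.init] using hn)
  have hn₀ : s₀.var reg_n = n := by simp [hs₀, run, State.init]
  have hu₀ : s₀.var reg_unit = unit := by simp [hs₀, run]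
  rw [hn₀] at hl hl'
  rw [hu₀] at hm
  set B := 2 + n * (n * (2 ^ (unit * l) + n)) with hB
  have hle : 2 ^ (unit * l) + n ≤ B := by
    have h1 := Nat.le_mul_of_pos_left (2 ^ (unit * l) + n) hn
    have h2 := Nat.le_mul_of_pos_left (n * (2 ^ (unit * l) + n)) hn
    omega
  have hlt : unit * l < 2 ^ (unit * l) := Nat.lt_two_pow_self
  obtain ⟨t₁, q₁, e₁, ht₁, hq₁⟩ := exec_run_le E (sizeProg unit) rfl (State.init n) (N := B)
    (M := B + 1) (d := 2) (by
      intro b hb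
      obtain rfl : b = reg_n := by simpa [sizeProg, logProg, bounds] using hb
      simp only [State.init, if_true]
      omega) le_rfl (by simp [sizeProg, logProg, depth])
  have hF₁ := frame_run E (sizeProg unit) (State.init n)
  have m₁ : ((sizeProg unit).run E (State.init n)).var reg_m = unit * l := hm
  have n₁ : ((sizeProg unit).run E (State.init n)).var reg_n = n :=
    hF₁.var _ (by simp [sizeProg, logProg, regs])
  have c₁ : ((sizeProg unit).run E (State.init n)).var reg_cur = 0 :=
    hF₁.var _ (by simp [sizeProg, logProg, regs])
  have o₁ : ((sizeProg unit).run E (State.init n)).out = [] := hF₁.out rfl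
  have a₁ : ∀ a, ((sizeProg unit).run E (State.init n)).arr a = fun _ => 0 := fun a =>
    hF₁.arr _ (by simp [sizeProg, logProg, arrs])
  generalize (sizeProg unit).run E (State.init n) = s₁ at e₁ m₁ n₁ c₁ o₁ a₁
  obtain ⟨t₂, q₂, e₂, ht₂, hq₂⟩ := exec_run_le E powProg (by decide) s₁ (N := B) (M := B + 1)
    (d := 2) (by
      intro b hb
      obtain rfl : b = reg_m := by simpa [powProg, bounds] using hb
      omega) le_rfl (by decide)
  have p₂ := run_powProg E s₁
  rw [m₁] at p₂
  have hF₂ := frame_run E powProg s₁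
  have m₂ := (hF₂.var reg_m (by decide)).trans m₁
  have n₂ := (hF₂.var reg_n (by decide)).trans n₁
  have c₂ := (hF₂.var reg_cur (by decide)).trans c₁
  have o₂ := (hF₂.out (by decide)).trans o₁
  have a₂ : ∀ a, (powProg.run E s₁).arr a = fun _ => 0 := fun a =>
    (hF₂.arr _ (by simp [powProg, arrs])).trans (a₁ a)
  generalize powProg.run E s₁ = s₂ at e₂ p₂ m₂ n₂ c₂ o₂ a₂
  obtain ⟨t₃, q₃, e₃, ht₃, hq₃⟩ := exec_run_le E bigProg (by decide) s₂ (N := B) (M := B + 1)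
    (d := 2) (by
      intro b hb
      obtain rfl : b = reg_n := by simpa [bigProg, bounds] using hb
      omega) le_rfl (by decide)
  have b₃ := run_bigProg E s₂
  rw [n₂, p₂, ← hB] at b₃
  have hF₃ := frame_run E bigProg s₂
  have m₃ := (hF₃.var reg_m (by decide)).trans m₂
  have n₃ := (hF₃.var reg_n (by decide)).trans n₂
  have c₃ := (hF₃.var reg_cur (by decide)).trans c₂
  have o₃ := (hF₃.out (by decide)).trans o₂
  have a₃ : ∀ a, (bigProg.run E s₂).arr a = fun _ => 0 := fun a =>
    (hF₃.arr _ (by simp [bigProg, arrs])).trans (a₂ a)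
  generalize bigProg.run E s₂ = s₃ at e₃ b₃ m₃ n₃ c₃ o₃ a₃
  obtain ⟨t₄, q₄, e₄, ht₄, hq₄⟩ := exec_run_le E rowProg (by decide) s₃ (N := B) (M := B + 1)
    (d := 2) (by
      intro b hb
      obtain rfl : b = reg_big := by simpa [rowProg, bounds] using hb
      omega) le_rfl (by decide)
  have hF₄ := frame_run E rowProg s₃
  have hq : q₁ + (q₂ + (q₃ + q₄)) = 0 := by
    simp only [sizeProg, logProg, powProg, bigProg, rowProg, queries, mul_zero,
      add_zero] at hq₁ hq₂ hq₃ hq₄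
    omega
  refine ⟨l, B, _, t₁ + (t₂ + (t₃ + t₄)), hl, hl', rfl,
    hq ▸ Exec.seq e₁ (Exec.seq e₂ (Exec.seq e₃ e₄)), ?_,
    ⟨(hF₄.var _ (by decide)).trans n₃, (hF₄.var _ (by decide)).trans b₃,
      (hF₄.var _ (by decide)).trans m₃, fun x hx => ?_⟩, (hF₄.out (by decide)).trans o₃,
    (hF₄.var _ (by decide)).trans c₃, fun a ha x => ?_⟩
  · have h0 : (sizeProg unit).time 1 = (sizeProg 0).time 1 := rfl
    rw [h0] at ht₁
    rw [Nat.add_mul, Nat.add_mul, Nat.add_mul]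
    omega
  · rw [run_rowProg E s₃ (b₃.symm ▸ hx), n₃]
  · rw [hF₄.arr a (by simpa [rowProg, arrs] using ha), a₃]

/-- The algorithm; `unit` is the factor of the logarithm in the distance below which the estimates
are not trusted. -/
def mainCmd (unit : ℕ) : Cmd :=
  .seq (prepareCmd unit) (.seq estProg.toCmd clusterProg.toCmd)

/-- The sizes of the loops are polynomial in `n`. -/
theorem size_le_pow {n l B unit : ℕ} (hn : 1 ≤ n) (hl : 2 ^ l ≤ 2 * n)
    (hB : B = 2 + n * (n * (2 ^ (unit * l) + n))) :
    B + 1 ≤ (4 + 2 ^ unit) * n ^ (unit + 3) := by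
  have h1 : 2 ^ (unit * l) ≤ 2 ^ unit * n ^ unit := by
    rw [mul_comm unit l, pow_mul, ← mul_pow]
    exact Nat.pow_le_pow_left hl unit
  have h2 : n * (n * (2 ^ unit * n ^ unit)) ≤ 2 ^ unit * n ^ (unit + 3) := by
    calc n * (n * (2 ^ unit * n ^ unit)) = 2 ^ unit * n ^ (unit + 2) := by ring
      _ ≤ _ := Nat.mul_le_mul_left _ (Nat.pow_le_pow_right hn (by omega))
  have h3 : n * (n * n) ≤ n ^ (unit + 3) := by
    calc n * (n * n) = n ^ 3 := by ring
      _ ≤ _ := Nat.pow_le_pow_right hn (by omega)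
  have h4 : 1 ≤ n ^ (unit + 3) := Nat.one_le_pow _ _ hn
  have h5 : n * (n * 2 ^ (unit * l)) ≤ n * (n * (2 ^ unit * n ^ unit)) :=
    Nat.mul_le_mul_left _ (Nat.mul_le_mul_left _ h1)
  rw [hB, mul_add, mul_add, add_mul]
  omega

/-- The sum of the times of the parts of the algorithm, for loop bounds `1`. -/
def totalTime : ℕ :=
  (sizeProg 0).time 1 + powProg.time 1 + bigProg.time 1 + rowProg.time 1 + estProg.time 1 +
    clusterProg.time 1

/-- The largest nesting of loops. -/
def totalDepth : ℕ := 2 + estProg.depth + clusterProg.depth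

theorem exec_mainCmd (E : Env) (unit : ℕ) {n : ℕ} (hn : 1 ≤ n) : ∃ l B s t q,
    n ≤ 2 ^ l ∧ B = 2 + n * (n * (2 ^ (unit * l) + n)) ∧ Sized n (unit * l) B s ∧ s.out = [] ∧
    s.var reg_cur = 0 ∧ (∀ a, a ≠ arr_row → ∀ x, s.arr a x = 0) ∧
    Exec E (mainCmd unit) (State.init n) (clusterProg.run E (estProg.run E s)) t q ∧
    t ≤ totalTime * (4 + 2 ^ unit) ^ totalDepth * n ^ ((unit + 3) * totalDepth) ∧ q ≤ n ^ 3 := by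
  obtain ⟨l, B, s, t₁, hl, hl', hB, e₁, ht₁, hs, hout, hcur, h0⟩ := exec_prepareCmd E unit hn
  have hnB : n ≤ B := by
    have h2 := Nat.le_mul_of_pos_left (n * (2 ^ (unit * l) + n)) hn
    have h1 := (Nat.le_add_left n _).trans (Nat.le_mul_of_pos_left (2 ^ (unit * l) + n) hn)
    omega
  obtain ⟨t₂, q₂, e₂, ht₂, hq₂⟩ := exec_run_le E estProg (by decide) s (N := n) (M := B + 1)
    (d := totalDepth) (by
      intro b hb
      obtain rfl : b = reg_n := by
        simpa [estProg, askProg, scanProg, testProg, countProg, bounds] using hb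
      exact hs.n_eq.le) (by omega) (by unfold totalDepth; omega)
  have hF := frame_run E estProg s
  obtain ⟨t₃, q₃, e₃, ht₃, hq₃⟩ := exec_run_le E clusterProg (by decide) (estProg.run E s) (N := B)
    (M := B + 1) (d := totalDepth) (by
      have hs' := hF.sized (by decide) hs
      intro b hb
      have : b = reg_n ∨ b = reg_big := by
        have : ∀ b ∈ clusterProg.bounds, b = reg_n ∨ b = reg_big := by decide
        exact this b hb
      rcases this with rfl | rfl
      · exact hs'.n_eq.le.trans hnB
      · exact hs'.big_eq.le) le_rfl (by unfold totalDepth; omega)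
  refine ⟨l, B, s, _, _, hl, hB, hs, hout, hcur, h0, Exec.seq e₁ (Exec.seq e₂ e₃), ?_, ?_⟩
  · have hpow : (B + 1) ^ 2 ≤ (B + 1) ^ totalDepth :=
      Nat.pow_le_pow_right (by omega) (by unfold totalDepth; omega)
    have ht₁' := ht₁.trans (Nat.mul_le_mul_left _ hpow)
    have hb : (B + 1) ^ totalDepth ≤ ((4 + 2 ^ unit) * n ^ (unit + 3)) ^ totalDepth :=
      Nat.pow_le_pow_left (size_le_pow hn hl' hB) _
    calc t₁ + (t₂ + t₃) ≤ totalTime * (B + 1) ^ totalDepth := by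
          rw [totalTime, Nat.add_mul, Nat.add_mul]; omega
      _ ≤ totalTime * ((4 + 2 ^ unit) * n ^ (unit + 3)) ^ totalDepth := Nat.mul_le_mul_left _ hb
      _ = _ := by rw [mul_pow, ← pow_mul, mul_assoc]
  · have h1 : estProg.queries n = n ^ 3 := by
      simp [estProg, askProg, scanProg, testProg, countProg, queries]
      ring
    have h2 : clusterProg.queries B = 0 := by
      simp [clusterProg, initProg, closeProg, subsetsProg, linkProg, rootProg, tableProg, emitProg,
        mergeProg, singletonProg, insertProg, appendProg, fillProg, joinProg, classProg, bestProg,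
        tryProg, splitProg, costProg, updateProg, popProg, queries]
    omega

/-- On reliable answers the output is a tree of cost at most twice that of `T`. -/
theorem outputs_mainCmd {n : ℕ} (hn : 2 ≤ n) (G : WeightedGraph n) {T : HCTree (Fin n)}
    (hT : T.IsHC) {O : Triplet n → Fin n} {unit : ℕ} (hunit : 17 ≤ unit)
    (hR : ∀ l, n ≤ 2 ^ l → Reliable T O (unit * l)) :
    ∃ T' : HCTree (Fin n), Outputs (mainCmd unit) G O T' ∧ T'.IsHC ∧ T'.cost G ≤ 2 * T.cost G := by
  obtain ⟨l, B, s, t, q, hl, hB, hs, hout, hcur, h0, hexec, -, -⟩ :=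
    exec_mainCmd ⟨G.entry, oracleAnswer O⟩ unit (n := n) (by omega)
  have hl0 : 1 ≤ l := by
    rcases Nat.eq_zero_or_pos l with rfl | h
    · simp at hl; omega
    · exact h
  have hm : 17 ≤ unit * l := hunit.trans (Nat.le_mul_of_pos_right _ hl0)
  have hB' : n * 2 ^ (unit * l) + n * (n * n) < B := by
    have := Nat.le_mul_of_pos_left (n * 2 ^ (unit * l)) (by omega : 0 < n)
    rw [hB, mul_add, mul_add]
    omega
  have hnB : n ≤ B := by
    have : n * 1 ≤ n * 2 ^ (unit * l) := Nat.mul_le_mul_left _ Nat.one_le_two_pow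
    omega
  have hE := run_estProg hT hm (hR l hl) (E := ⟨G.entry, oracleAnswer O⟩) rfl hnB hs
    (h0 _ (by decide))
  have hF := frame_run ⟨G.entry, oracleAnswer O⟩ estProg s
  obtain ⟨T', ho, hHC, hc⟩ := run_clusterProg ⟨G.entry, oracleAnswer O⟩ hn (by omega) hB'
    (hF.sized (by decide) hs) (G := G) rfl hT hE (fun _ _ => rfl)
    ((hF.var _ (by decide)).trans hcur) ((hF.out (by decide)).trans hout)
    (fun x => by rw [hF.arr _ (by decide), h0 _ (by decide)])
    (fun x => by rw [hF.arr _ (by decide), h0 _ (by decide)])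
    (fun x => by rw [hF.arr _ (by decide), h0 _ (by decide)])
  exact ⟨T', ⟨_, t, q, hexec, ho⟩, hHC, hc⟩

end RAM.Prog

/-- Reliability is needed at fewer scales if `m` is larger. -/
theorem Reliable.mono {n : ℕ} {T : HCTree (Fin n)} {O : Triplet n → Fin n} {m m' : ℕ}
    (h : Reliable T O m) (hm : m ≤ m') : Reliable T O m' :=
  fun u v huv t ht => h u v huv t (hm.trans ht)

theorem mainTheorem1 :
    ∃ (α : ℝ) (C : ℕ), ∀ c : ℕ, ∃ (P : RAM.Cmd) (k K : ℕ),
      ∀ (n : ℕ), 0 < n → ∀ G : WeightedGraph n,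
        (∀ O : Triplet n → Fin n, ∃ (s : RAM.State) (t q : ℕ),
          RAM.Runs P G O s t q ∧ t ≤ K * n ^ k ∧ q ≤ C * n ^ 3) ∧
        (∀ Topt : HCTree (Fin n), Topt.IsOptimal G →
          ∀ (Ω : Type*) [MeasurableSpace Ω] (μ : Measure Ω) [IsProbabilityMeasure μ]
            (O : Ω → Triplet n → Fin n), IsSplittingOracle μ Topt O →
            1 - 1 / (n : ℝ) ^ c ≤ μ.real {ω | ∃ T : HCTree (Fin n),
              RAM.Outputs P G (O ω) T ∧ T.IsHC ∧ T.cost G ≤ α * Topt.cost G}) := by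
  refine ⟨2, 1, fun c => ⟨RAM.Prog.mainCmd (800 * (c + 5)),
    (800 * (c + 5) + 3) * RAM.Prog.totalDepth,
    RAM.Prog.totalTime * (4 + 2 ^ (800 * (c + 5))) ^ RAM.Prog.totalDepth, fun n hn G => ⟨?_, ?_⟩⟩⟩
  · intro O
    obtain ⟨l, B, s, t, q, -, -, -, -, -, -, h, ht, hq⟩ :=
      RAM.Prog.exec_mainCmd ⟨G.entry, oracleAnswer O⟩ (800 * (c + 5)) hn
    exact ⟨_, t, q, h, ht, by simpa using hq⟩
  · intro T hT Ω _ μ _ O hO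
    rcases Nat.lt_or_ge n 2 with h1 | h2
    · -- for `n = 1` the claimed probability is `0`
      obtain rfl : n = 1 := by omega
      simp
    · -- the least `l` with `n ≤ 2 ^ l` gives the strongest demand of reliability
      refine (one_sub_le_measureReal_reliable hT.1 hO h2
        (Nat.le_pow_clog one_lt_two n)).trans (measureReal_mono fun ω hω => ?_)
      exact RAM.Prog.outputs_mainCmd h2 G hT.1 (by omega) fun l hl =>
        hω.mono (Nat.mul_le_mul_left _ (Nat.clog_le_of_le_pow hl))
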